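/- Let $k$ be an algebraically closed field of characteristic zero and let $A$ be a nonzero smooth affine (finitely generated commutative) Poisson $k$-algebra of pure dimension $\ell$, i.e. every irreducible component of $\operatorname{Spec} A$ has dimension $\ell$. Write $\omega_A=\bigwedge^{\ell}_A\Omega_{A/k}$, with the left Poisson $A$-module structure $\{a,w\}=L_{\{a,-\}}w$, where $L_{\{a,-\}}$ is the Lie derivative along the Hamiltonian derivation $\{a,-\}$: $$\{a,\,f\,db_1\wedge\cdots\wedge db_\ell\}=\{a,f\}\,db_1\wedge\cdots\wedge db_\ell+f\sum_{i}db_1\wedge\cdots\wedge d\{a,b_i\}\wedge\cdots\wedge db_\ell .$$ Let $\mathcal U(A)$ be the Poisson enveloping algebra: the $k$-algebra generated by symbols $M_a,H_a$, $k$-linear in $a\in A$, with relations $M_{ab}=M_aM_b$, $M_1=1$, $H_{\{a,b\}}=[H_a,H_b]$, $H_{ab}=M_aH_b+M_bH_a$, $M_{\{a,b\}}=[H_a,M_b]$. Identify right Poisson $A$-modules with right $\mathcal U(A)$-modules, and Poisson $A$-bimodules with left modules over $\mathcal U(A)\otimes_k\mathcal U(A)^{op}$. For a Poisson bimodule $N$,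 $\operatorname{Hom}_{A^e}(A,N)=\{n\in N: an=na\ \forall a\in A\}$ is a right Poisson module by $n\cdot a=na=an$ and $\{n,a\}=nH_a-H_an$; let $\operatorname{RHom}_{A^e}(A,-)$ be the right derived functor of $N\mapsto\operatorname{Hom}_{A^e}(A,N)$, from Poisson bimodules to right Poisson modules. The algebra $A^e=A\otimes_kA$ is a Poisson bimodule with $H_a(x\otimes y)=\{a,x\}\otimes y$, $(x\otimes y)H_a=x\otimes\{y,a\}$, $a(x\otimes y)b=ax\otimes yb$. The following are equivalent: (a) $A$ is homologically unimodular: $\omega_A\cong A$ as left Poisson $A$-modules. (b) $A$ is Calabi-Yau and unimodular. Here a $k$-algebra $B$, with $B^e=B\otimes_kB^{op}$, is Calabi-Yau if for some $d\ge 0$: $B$ has a finite-length resolution by finitely generated projective left $B^e$-modules; $B$ has injective dimension $d$ as a left and as a right $B$-module; $\operatorname{Ext}^i_{B^e}(B,B^e)=0$ for $i\ne d$; and $\operatorname{Ext}^d_{B^e}(B,B^e)\cong B^{\nu}$ as $B$-bimodules for some inner automorphism $\nu$ of $B$ ($B^\nu$ is $B$ with $r\cdot m\cdot s=rm\nu(s)$).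 A modular derivation of $A$ is a Poisson derivation $\delta$ with $\omega_A\cong{}^{\delta}A$ as left Poisson modules, where ${}^{\delta}A$ is $A$ with bracket $\{a,x\}_\delta=\{a,x\}+\delta(a)x$. $A$ is unimodular if a modular derivation exists and every modular derivation is log-Hamiltonian, i.e. of the form $u^{-1}\{u,-\}$ with $u\in A^{\times}$. (c) $\operatorname{RHom}_{A^e}(A,A^e)\cong A[-\ell]$ in the derived category of right Poisson $A$-modules, where $A$ is a right Poisson module by $x\cdot a=xa$ and the bracket $\{x,a\}$. -/

import Mathlib

open CategoryTheory TensorProduct MulOpposite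

universe u

set_option linter.unusedSectionVars false

noncomputable section

/-! ### Poisson algebras and their enveloping algebras -/

/-- A Poisson algebra over `k`: a commutative `k`-algebra with a `k`-bilinear bracket that is
skew-symmetric and satisfies the Jacobi identity and the Leibniz rule. -/
class PoissonAlgebra (k A : Type u) [Field k] [CommRing A] [Algebra k A] where
  br : A →ₗ[k] A →ₗ[k] A
  skew : ∀ a b, br a b = -br b a
  jacobi : ∀ a b c, br a (br b c) + br b (br c a) + br c (br a b) = 0
  leibniz : ∀ a b c, br (a * b) c = a * br b c + br a c * b

namespace Poisson

section Basic

variable (k A : Type u) [Field k] [CommRing A] [Algebra k A] [PoissonAlgebra k A]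

/-- The Poisson bracket `{a, b}`. -/
abbrev pb (a b : A) : A := PoissonAlgebra.br (k := k) a b

variable {A} in
lemma pb_skew (a b : A) : pb k A a b = -pb k A b a := PoissonAlgebra.skew a b

variable {A} in
lemma pb_mul_right (a b c : A) : pb k A a (b * c) = b * pb k A a c + c * pb k A a b := by
  rw [pb_skew, pb, PoissonAlgebra.leibniz, pb_skew k a b, pb_skew k a c]
  ring

variable {A} in
lemma pb_mul_left (a b c : A) : pb k A (a * b) c = a * pb k A b c + b * pb k A a c := by
  rw [pb, PoissonAlgebra.leibniz]
  ring

variable {A} in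
lemma pb_pb (a b c : A) :
    pb k A (pb k A a b) c = pb k A a (pb k A b c) - pb k A b (pb k A a c) := by
  have h := PoissonAlgebra.jacobi (k := k) a b c
  have h1 : pb k A b (pb k A c a) = - pb k A b (pb k A a c) := by
    rw [pb_skew k c a]; exact map_neg _ _
  have h2 := pb_skew k (pb k A a b) c
  change pb k A a (pb k A b c) + pb k A b (pb k A c a) + pb k A c (pb k A a b) = 0 at h
  rw [h2]
  linear_combination -h + h1

/-- The Hamiltonian derivation `{a, -}`. -/
def ham (a : A) : Derivation k A A :=
  Derivation.mk' (PoissonAlgebra.br a) fun b c => by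
    simpa using pb_mul_right k a b c

/-- The generators of the tensor algebra on `A ⊕ A` from the first summand. -/
abbrev preM (a : A) : TensorAlgebra k (A × A) := TensorAlgebra.ι k (a, 0)

/-- The generators of the tensor algebra on `A ⊕ A` from the second summand. -/
abbrev preH (a : A) : TensorAlgebra k (A × A) := TensorAlgebra.ι k (0, a)

/-- The defining relations of the Poisson enveloping algebra. -/
inductive Rel : TensorAlgebra k (A × A) → TensorAlgebra k (A × A) → Prop
  | mul (a b : A) : Rel (preM k A (a * b)) (preM k A a * preM k A b)
  | lie (a b : A) : Rel (preH k A (pb k A a b))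
      (preH k A a * preH k A b - preH k A b * preH k A a)
  | der (a b : A) : Rel (preH k A (a * b)) (preM k A a * preH k A b + preM k A b * preH k A a)
  | comm (a b : A) : Rel (preM k A (pb k A a b))
      (preH k A a * preM k A b - preM k A b * preH k A a)
  | one : Rel (preM k A 1) 1

/-- The Poisson universal enveloping algebra `U(A)`. -/
def UEnv : Type u := RingQuot (Rel k A)

instance : Ring (UEnv k A) := inferInstanceAs (Ring (RingQuot (Rel k A)))

instance : Algebra k (UEnv k A) := inferInstanceAs (Algebra k (RingQuot (Rel k A)))

/-- The quotient map from the tensor algebra. -/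
def UEnv.mk : TensorAlgebra k (A × A) →ₐ[k] UEnv k A := RingQuot.mkAlgHom k (Rel k A)

/-- The generators `M_a` of `U(A)`. -/
def UEnv.M (a : A) : UEnv k A := UEnv.mk k A (preM k A a)

/-- The generators `H_a` of `U(A)`. -/
def UEnv.H (a : A) : UEnv k A := UEnv.mk k A (preH k A a)

lemma UEnv.mk_rel {x y : TensorAlgebra k (A × A)} (h : Rel k A x y) :
    UEnv.mk k A x = UEnv.mk k A y := RingQuot.mkAlgHom_rel k h

lemma UEnv.M_one : UEnv.M k A 1 = 1 := by
  rw [UEnv.M, UEnv.mk_rel k A Rel.one, map_one]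

lemma preM_add (a b : A) : preM k A (a + b) = preM k A a + preM k A b := by
  rw [preM, preM, preM, ← map_add]; simp

lemma preH_add (a b : A) : preH k A (a + b) = preH k A a + preH k A b := by
  rw [preH, preH, preH, ← map_add]; simp

lemma preM_smul (c : k) (a : A) : preM k A (c • a) = c • preM k A a := by
  rw [preM, preM, ← map_smul]; simp

lemma preH_smul (c : k) (a : A) : preH k A (c • a) = c • preH k A a := by
  rw [preH, preH, ← map_smul]; simp

lemma UEnv.M_neg (a : A) : UEnv.M k A (-a) = -UEnv.M k A a := by
  rw [UEnv.M, UEnv.M, ← neg_one_smul k a, preM_smul]; simp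

lemma UEnv.M_mul (a b : A) : UEnv.M k A (a * b) = UEnv.M k A a * UEnv.M k A b := by
  rw [UEnv.M, UEnv.mk_rel k A (Rel.mul a b), map_mul]; rfl

lemma UEnv.H_pb (a b : A) : UEnv.H k A (pb k A a b) =
    UEnv.H k A a * UEnv.H k A b - UEnv.H k A b * UEnv.H k A a := by
  rw [UEnv.H, UEnv.mk_rel k A (Rel.lie a b), map_sub, map_mul, map_mul]; rfl

lemma UEnv.H_mul (a b : A) : UEnv.H k A (a * b) =
    UEnv.M k A a * UEnv.H k A b + UEnv.M k A b * UEnv.H k A a := by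
  rw [UEnv.H, UEnv.mk_rel k A (Rel.der a b), map_add, map_mul, map_mul]; rfl

lemma UEnv.M_pb (a b : A) : UEnv.M k A (pb k A a b) =
    UEnv.H k A a * UEnv.M k A b - UEnv.M k A b * UEnv.H k A a := by
  rw [UEnv.M, UEnv.mk_rel k A (Rel.comm a b), map_sub, map_mul, map_mul]; rfl

variable {k A} in
/-- Induction on `U(A)`, which is generated by the `M_a` and `H_a`. -/
lemma UEnv.induction {P : UEnv k A → Prop} (hk : ∀ c : k, P (algebraMap k _ c))
    (hM : ∀ a, P (UEnv.M k A a)) (hH : ∀ a, P (UEnv.H k A a))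
    (hadd : ∀ x y, P x → P y → P (x + y)) (hmul : ∀ x y, P x → P y → P (x * y))
    (x : UEnv k A) : P x := by
  obtain ⟨y, rfl⟩ := RingQuot.mkAlgHom_surjective k (Rel k A) x
  change P (UEnv.mk k A y)
  induction y using TensorAlgebra.induction with
  | algebraMap c => rw [AlgHom.commutes]; exact hk c
  | ι p =>
    have : TensorAlgebra.ι k p = preM k A p.1 + preH k A p.2 := by
      rw [preM, preH, ← map_add]; simp
    rw [this, map_add]
    exact hadd _ _ (hM _) (hH _)
  | mul x y hx hy => rw [map_mul]; exact hmul _ _ hx hy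
  | add x y hx hy => rw [map_add]; exact hadd _ _ hx hy

variable {k A} in
/-- The universal property of `U(A)`. -/
def UEnv.lift {B : Type u} [Ring B] [Algebra k B] (f g : A →ₗ[k] B)
    (h1 : ∀ a b, f (a * b) = f a * f b)
    (h2 : ∀ a b, g (pb k A a b) = g a * g b - g b * g a)
    (h3 : ∀ a b, g (a * b) = f a * g b + f b * g a)
    (h4 : ∀ a b, f (pb k A a b) = g a * f b - f b * g a)
    (h5 : f 1 = 1) : UEnv k A →ₐ[k] B :=
  RingQuot.liftAlgHom k ⟨TensorAlgebra.lift k (LinearMap.coprod f g), by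
    intro x y h
    cases h with
    | mul a b => simpa using h1 a b
    | lie a b => simpa using h2 a b
    | der a b => simpa using h3 a b
    | comm a b => simpa using h4 a b
    | one => simpa using h5⟩

section lift

variable {k A} {B : Type u} [Ring B] [Algebra k B] (f g : A →ₗ[k] B)
    (h1 : ∀ a b, f (a * b) = f a * f b)
    (h2 : ∀ a b, g (pb k A a b) = g a * g b - g b * g a)
    (h3 : ∀ a b, g (a * b) = f a * g b + f b * g a)
    (h4 : ∀ a b, f (pb k A a b) = g a * f b - f b * g a)
    (h5 : f 1 = 1)

@[simp] lemma UEnv.lift_M (a : A) : UEnv.lift f g h1 h2 h3 h4 h5 (UEnv.M k A a) = f a :=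
  (RingQuot.liftAlgHom_mkAlgHom_apply k _ _ _).trans (by simp)

@[simp] lemma UEnv.lift_H (a : A) : UEnv.lift f g h1 h2 h3 h4 h5 (UEnv.H k A a) = g a :=
  (RingQuot.liftAlgHom_mkAlgHom_apply k _ _ _).trans (by simp)

end lift

/-! ### The standard left and right Poisson module `A`, and the Poisson bimodule `A ⊗ A` -/

/-- `A` as a left Poisson module: `a · x = a x` and `H_a · x = {a, x}`. -/
def leftAct : UEnv k A →ₐ[k] Module.End k A :=
  UEnv.lift (LinearMap.mul k A) (PoissonAlgebra.br (k := k))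
    (fun a b => by ext x; simp [mul_assoc])
    (fun a b => by ext x; simpa using pb_pb k a b x)
    (fun a b => by ext x; simpa using pb_mul_left k a b x)
    (fun a b => by
      ext x
      have := pb_mul_right k a b x
      simp only [pb] at this
      simp [this, mul_comm])
    (by ext x; simp)

/-- `A` as a right Poisson module: `x · a = x a` and `x · H_a = {x, a}`. -/
def rightAct : (UEnv k A)ᵐᵒᵖ →ₐ[k] Module.End k A :=
  AlgHom.opComm (UEnv.lift (B := (Module.End k A)ᵐᵒᵖ)
    ((opLinearEquiv k).toLinearMap ∘ₗ LinearMap.mul k A)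
    ((opLinearEquiv k).toLinearMap ∘ₗ (PoissonAlgebra.br (k := k) (A := A)).flip)
    (fun a b => by apply unop_injective; ext x; simp [mul_left_comm, mul_assoc])
    (fun a b => by
      apply unop_injective; ext x
      have h := pb_pb k a b x
      have h1 := pb_skew k x (pb k A a b)
      have h2 := pb_skew k (pb k A x a) b
      have h3 := pb_skew k (pb k A x b) a
      have h4 : pb k A b (pb k A x a) = - pb k A b (pb k A a x) := by
        rw [pb_skew k x a]; exact map_neg _ _
      have h5 : pb k A a (pb k A x b) = - pb k A a (pb k A b x) := by
        rw [pb_skew k x b]; exact map_neg _ _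
      simp only [pb] at *
      simp
      rw [h1, h2, h3, h4, h5, h]
      ring)
    (fun a b => by
      apply unop_injective; ext x
      have := pb_mul_right k x a b
      have h1 := pb_mul_left k a x b
      have h2 := pb_mul_left k b x a
      have h3 := pb_skew k a b
      simp only [pb] at *
      simp [this, h1, h2, h3]
      ring)
    (fun a b => by
      apply unop_injective; ext x
      have h1 := pb_mul_left k b x a
      have h2 := pb_skew k a b
      simp only [pb] at *
      simp [h1, h2]
      ring)
    (by apply unop_injective; ext x; simp))

variable {k} in
/-- The module given by a representation `R → End_k(V)`. -/
def repModule {R V : Type u} [Ring R] [Algebra k R] [AddCommGroup V] [Module k V]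
    (ρ : R →ₐ[k] Module.End k V) : ModuleCat.{u} R :=
  letI : Module R V := Module.compHom V ρ.toRingHom
  ModuleCat.of R V

/-- The category of right Poisson `A`-modules, as right modules over `U(A)`. -/
abbrev RightPMod : Type (u + 1) := ModuleCat.{u} (UEnv k A)ᵐᵒᵖ

/-- The algebra `U(A)ᵉ = U(A) ⊗ U(A)ᵒᵖ`. -/
abbrev UEnvE : Type u := UEnv k A ⊗[k] (UEnv k A)ᵐᵒᵖ

/-- The category of Poisson `A`-bimodules, as left modules over `U(A)ᵉ`. -/
abbrev PBimod : Type (u + 1) := ModuleCat.{u} (UEnvE k A)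

/-- The right Poisson module `A`. -/
def rightTriv : RightPMod k A := repModule (rightAct k A)

/-- The Poisson bimodule `Aᵉ = A ⊗ A`: `U(A)` acts from the left on the first factor, and from
the right on the second factor. -/
def envBimod : PBimod k A :=
  repModule (V := A ⊗[k] A) ((Module.endTensorEndAlgHom (R := k) (S := k) (A := k)).comp
    (Algebra.TensorProduct.map (leftAct k A) (rightAct k A)))

end Basic

/-! ### The functor `Hom_{Aᵉ}(A, -)` from Poisson bimodules to right Poisson modules -/

section HomInv

variable (k A : Type u) [Field k] [CommRing A] [Algebra k A] [PoissonAlgebra k A]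

/-- `x ↦ x ⊗ 1`. -/
abbrev inL (x : UEnv k A) : UEnvE k A := x ⊗ₜ 1

/-- `x ↦ 1 ⊗ x`. -/
abbrev inR (x : UEnv k A) : UEnvE k A := 1 ⊗ₜ op x

lemma inL_comm_inR (x y : UEnv k A) : inL k A x * inR k A y = inR k A y * inL k A x := by
  simp

lemma inL_sub (x y : UEnv k A) : inL k A (x - y) = inL k A x - inL k A y :=
  TensorProduct.sub_tmul _ _ _

lemma inR_sub (x y : UEnv k A) : inR k A (x - y) = inR k A x - inR k A y := by
  rw [inR, MulOpposite.op_sub, TensorProduct.tmul_sub]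

lemma inL_add (x y : UEnv k A) : inL k A (x + y) = inL k A x + inL k A y :=
  TensorProduct.add_tmul _ _ _

lemma inR_add (x y : UEnv k A) : inR k A (x + y) = inR k A x + inR k A y := by
  rw [inR, MulOpposite.op_add, TensorProduct.tmul_add]

lemma inL_neg (x : UEnv k A) : inL k A (-x) = -inL k A x :=
  TensorProduct.neg_tmul _ _

lemma inL_mul (x y : UEnv k A) : inL k A (x * y) = inL k A x * inL k A y := by simp

lemma inR_mul (x y : UEnv k A) : inR k A (x * y) = inR k A y * inR k A x := by
  rw [Algebra.TensorProduct.tmul_mul_tmul, one_mul]; rfl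

variable (N : Type u) [AddCommGroup N] [Module k N] [Module (UEnvE k A) N]
  [IsScalarTower k (UEnvE k A) N]

/-- `Hom_{Aᵉ}(A, N) = {n ∈ N | a n = n a for all a ∈ A}` for a Poisson bimodule `N`. -/
def homSub : Submodule k N where
  carrier := {n | ∀ a : A, inL k A (UEnv.M k A a) • n = inR k A (UEnv.M k A a) • n}
  add_mem' {m n} hm hn a := by rw [smul_add, smul_add, hm a, hn a]
  zero_mem' a := by simp
  smul_mem' c n hn a := by
    rw [smul_comm _ c n, smul_comm _ c n, hn a]

/-- Multiplication by `a ∈ A` on `Hom_{Aᵉ}(A, N)`. -/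
def invM (a : A) : Module.End k (homSub k A N) :=
  ((Algebra.lsmul k k N (inR k A (UEnv.M k A a)))).restrict (fun n hn b => by
    change inL k A (UEnv.M k A b) • inR k A (UEnv.M k A a) • n
      = inR k A (UEnv.M k A b) • inR k A (UEnv.M k A a) • n
    rw [← mul_smul, ← mul_smul, inL_comm_inR, ← inR_mul, mul_smul, hn b, ← mul_smul, ← inR_mul,
      ← UEnv.M_mul, ← UEnv.M_mul, mul_comm])

/-- The bracket `{n, a} = n H_a - H_a n` on `Hom_{Aᵉ}(A, N)`. -/
def invH (a : A) : Module.End k (homSub k A N) :=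
  ((Algebra.lsmul k k N (inR k A (UEnv.H k A a) - inL k A (UEnv.H k A a)))).restrict
    (fun n hn b => by
    change inL k A (UEnv.M k A b) • (inR k A (UEnv.H k A a) - inL k A (UEnv.H k A a)) • n
      = inR k A (UEnv.M k A b) • (inR k A (UEnv.H k A a) - inL k A (UEnv.H k A a)) • n
    have e := UEnv.M_pb k A a b
    have h1 : inL k A (UEnv.M k A b) * inL k A (UEnv.H k A a) =
        inL k A (UEnv.H k A a) * inL k A (UEnv.M k A b) - inL k A (UEnv.M k A (pb k A a b)) := by
      rw [e, inL_sub, inL_mul, inL_mul]; abel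
    have h2 : inR k A (UEnv.M k A b) * inR k A (UEnv.H k A a) =
        inR k A (UEnv.H k A a) * inR k A (UEnv.M k A b) + inR k A (UEnv.M k A (pb k A a b)) := by
      rw [e, inR_sub, inR_mul, inR_mul]; abel
    have h3 := inL_comm_inR k A (UEnv.M k A b) (UEnv.H k A a)
    have h4 := inL_comm_inR k A (UEnv.H k A a) (UEnv.M k A b)
    rw [← mul_smul, ← mul_smul, mul_sub, mul_sub, h1, h2, h3, ← h4]
    simp only [sub_smul, add_smul, mul_smul]
    rw [hn b, hn (pb k A a b)]
    abel)

@[simp] lemma invM_coe (a : A) (n : homSub k A N) :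
    (invM k A N a n : N) = inR k A (UEnv.M k A a) • (n : N) := rfl

@[simp] lemma invH_coe (a : A) (n : homSub k A N) : (invH k A N a n : N) =
    inR k A (UEnv.H k A a) • (n : N) - inL k A (UEnv.H k A a) • (n : N) := by
  rw [← sub_smul]; rfl

lemma homSub_comm (n : homSub k A N) (a : A) :
    inL k A (UEnv.M k A a) • (n : N) = inR k A (UEnv.M k A a) • (n : N) := n.2 a

lemma inL_inR_smul (x y : UEnv k A) (n : N) :
    inL k A x • inR k A y • n = inR k A y • inL k A x • n := by
  rw [← mul_smul, ← mul_smul, inL_comm_inR]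

/-- The right Poisson module structure `n · a = n a = a n`, `{n, a} = n H_a - H_a n` on
`Hom_{Aᵉ}(A, N)`. -/
def invAct : (UEnv k A)ᵐᵒᵖ →ₐ[k] Module.End k (homSub k A N) :=
  AlgHom.opComm (UEnv.lift (B := (Module.End k (homSub k A N))ᵐᵒᵖ)
    ((opLinearEquiv k).toLinearMap ∘ₗ
      { toFun := invM k A N
        map_add' := fun a b => by
          ext n
          simp [inR, UEnv.M, preM_add, TensorProduct.tmul_add, add_smul]
        map_smul' := fun c a => by
          ext n
          simp [inR, UEnv.M, preM_smul] })
    ((opLinearEquiv k).toLinearMap ∘ₗ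
      { toFun := invH k A N
        map_add' := fun a b => by
          ext n
          simp [inR, inL, UEnv.H, preH_add, TensorProduct.tmul_add, TensorProduct.add_tmul,
            add_smul]
          abel
        map_smul' := fun c a => by
          ext n
          simp [inR, inL, UEnv.H, preH_smul, ← TensorProduct.smul_tmul', smul_sub] })
    (fun a b => by
      apply unop_injective; ext n
      change inR k A (UEnv.M k A (a * b)) • (n : N)
        = inR k A (UEnv.M k A b) • inR k A (UEnv.M k A a) • (n : N)
      rw [UEnv.M_mul, inR_mul, mul_smul])
    (fun a b => by
      apply unop_injective; ext n
      change (invH k A N (pb k A a b) n : N)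
        = (invH k A N b (invH k A N a n) : N) - (invH k A N a (invH k A N b n) : N)
      simp only [invH_coe, UEnv.H_pb, inL_sub, inR_sub, sub_smul, smul_sub, inL_mul, inR_mul,
        mul_smul, inL_inR_smul]
      abel)
    (fun a b => by
      apply unop_injective; ext n
      change (invH k A N (a * b) n : N)
        = (invH k A N b (invM k A N a n) : N) + (invH k A N a (invM k A N b n) : N)
      have h1 : inL k A (UEnv.M k A a) * inL k A (UEnv.H k A b) =
          inL k A (UEnv.H k A b) * inL k A (UEnv.M k A a)
            + inL k A (UEnv.M k A (pb k A a b)) := by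
        rw [pb_skew k a b, UEnv.M_neg, UEnv.M_pb, inL_neg, inL_sub, inL_mul, inL_mul]; abel
      have h2 : inL k A (UEnv.M k A b) * inL k A (UEnv.H k A a) =
          inL k A (UEnv.H k A a) * inL k A (UEnv.M k A b)
            - inL k A (UEnv.M k A (pb k A a b)) := by
        rw [UEnv.M_pb, inL_sub, inL_mul, inL_mul]; abel
      simp only [invH_coe, invM_coe, UEnv.H_mul, inL_add, inR_add, add_smul, inR_mul, mul_smul]
      rw [inL_mul, inL_mul, h1, h2]
      simp only [add_smul, sub_smul, mul_smul, homSub_comm]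
      abel)
    (fun a b => by
      apply unop_injective; ext n
      change (invM k A N (pb k A a b) n : N)
        = (invM k A N b (invH k A N a n) : N) - (invH k A N a (invM k A N b n) : N)
      simp only [invH_coe, invM_coe, UEnv.M_pb, inR_sub, sub_smul, smul_sub, inR_mul, mul_smul,
        inL_inR_smul]
      abel)
    (by
      apply unop_injective; ext n
      change inR k A (UEnv.M k A 1) • (n : N) = n
      rw [UEnv.M_one]
      exact one_smul (UEnvE k A) (n : N)))

lemma invAct_M (a : A) : invAct k A N (op (UEnv.M k A a)) = invM k A N a := by
  simp [invAct]

lemma invAct_H (a : A) : invAct k A N (op (UEnv.H k A a)) = invH k A N a := by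
  simp [invAct]

variable {N} {N' : Type u} [AddCommGroup N'] [Module k N'] [Module (UEnvE k A) N']
  [IsScalarTower k (UEnvE k A) N']

/-- Functoriality of `Hom_{Aᵉ}(A, -)`. -/
def invMap (f : N →ₗ[UEnvE k A] N') : homSub k A N →ₗ[k] homSub k A N' :=
  (f.restrictScalars k).restrict fun n hn a => by
    change inL k A (UEnv.M k A a) • f n = inR k A (UEnv.M k A a) • f n
    rw [← map_smul, ← map_smul, hn a]

@[simp] lemma invMap_coe (f : N →ₗ[UEnvE k A] N') (n : homSub k A N) :
    (invMap k A f n : N') = f n := rfl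

lemma invMap_act (f : N →ₗ[UEnvE k A] N') (x : UEnv k A) :
    ∀ n : homSub k A N, invMap k A f (invAct k A N (op x) n)
      = invAct k A N' (op x) (invMap k A f n) := by
  induction x using UEnv.induction with
  | hk c =>
    intro n
    have h : op (algebraMap k (UEnv k A) c) = algebraMap k (UEnv k A)ᵐᵒᵖ c := rfl
    rw [h, AlgHom.commutes, AlgHom.commutes]
    simp [Module.algebraMap_end_apply]
  | hM a =>
    intro n
    ext
    simp [invAct_M]
  | hH a =>
    intro n
    ext
    simp [invAct_H]
  | hadd x y hx hy =>
    intro n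
    simp [hx, hy]
  | hmul x y hx hy =>
    intro n
    simp [hx, hy]

end HomInv

section Functor

variable (k A : Type u) [Field k] [CommRing A] [Algebra k A] [PoissonAlgebra k A]

/-- The `k`-vector space underlying a Poisson bimodule. -/
@[reducible] def bimodK (N : PBimod k A) : Module k N :=
  Module.compHom N (algebraMap k (UEnvE k A))

attribute [local instance] bimodK

instance bimodK_tower (N : PBimod k A) : IsScalarTower k (UEnvE k A) N where
  smul_assoc c x n := by
    have h : c • x = algebraMap k (UEnvE k A) c * x := Algebra.smul_def c x
    exact (congrArg (· • n) h).trans (mul_smul _ _ _)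

/-- The right `U(A)`-module `Hom_{Aᵉ}(A, N)`. -/
@[reducible] def invModule (N : PBimod k A) : Module (UEnv k A)ᵐᵒᵖ (homSub k A N) :=
  Module.compHom _ (invAct k A N).toRingHom

attribute [local instance] invModule

/-- The functor `Hom_{Aᵉ}(A, -)` from Poisson `A`-bimodules to right Poisson `A`-modules. -/
def homEnv : PBimod k A ⥤ RightPMod k A where
  obj N := ModuleCat.of (UEnv k A)ᵐᵒᵖ (homSub k A N)
  map f := ModuleCat.ofHom
    { toFun := invMap k A f.hom
      map_add' := map_add _
      map_smul' := fun x n => invMap_act k A f.hom (unop x) n }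
  map_id _ := rfl
  map_comp _ _ := rfl

instance : (homEnv k A).Additive where
  map_add := rfl

end Functor

/-! ### Differential forms of maximal degree -/

section Lie

variable {k A : Type u} [Field k] [CommRing A] [Algebra k A]

/-- `N ⊕ ε N`, on which `a ∈ A` acts as `a + ε X(a)`, with `ε ^ 2 = 0`. An `A`-linear map into
it with first component `id` is the same as an operator `L` with
`L (a n) = a L n + X(a) n`. -/
def Tw (_X : Derivation k A A) (N : Type u) : Type u := N × N

section Tw

variable (X : Derivation k A A) (N : Type u) [AddCommGroup N] [Module k N] [Module A N]
  [IsScalarTower k A N]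

instance : AddCommGroup (Tw X N) := inferInstanceAs (AddCommGroup (N × N))

instance : Module k (Tw X N) := inferInstanceAs (Module k (N × N))

instance : Module A (Tw X N) where
  smul a p := (a • p.1, a • p.2 + X a • p.1)
  one_smul p := by
    change ((1 : A) • p.1, (1 : A) • p.2 + X 1 • p.1) = p
    simp only [one_smul, Derivation.map_one_eq_zero, zero_smul, add_zero]
    rfl
  mul_smul a b p := by
    change ((a * b) • p.1, (a * b) • p.2 + X (a * b) • p.1) =
      (a • b • p.1, a • (b • p.2 + X b • p.1) + X a • b • p.1)
    simp only [Derivation.leibniz, smul_add, add_smul, mul_smul, smul_eq_mul, add_assoc]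
    rw [smul_comm b (X a)]
  smul_zero a := by
    change (a • (0 : N), a • (0 : N) + X a • (0 : N)) = (0, 0)
    simp
  smul_add a p q := by
    change (a • (p.1 + q.1), a • (p.2 + q.2) + X a • (p.1 + q.1)) =
      (a • p.1 + a • q.1, a • p.2 + X a • p.1 + (a • q.2 + X a • q.1))
    simp only [smul_add, Prod.mk.injEq, true_and]
    abel
  add_smul a b p := by
    change ((a + b) • p.1, (a + b) • p.2 + X (a + b) • p.1) =
      (a • p.1 + b • p.1, a • p.2 + X a • p.1 + (b • p.2 + X b • p.1))
    simp only [add_smul, map_add, Prod.mk.injEq, true_and]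
    abel
  zero_smul p := by
    change ((0 : A) • p.1, (0 : A) • p.2 + X 0 • p.1) = (0, 0)
    simp

lemma Tw.smul_def (a : A) (p : Tw X N) : a • p = (a • p.1, a • p.2 + X a • p.1) := rfl

instance : IsScalarTower k A (Tw X N) where
  smul_assoc c a p := by
    change ((c • a) • p.1, (c • a) • p.2 + X (c • a) • p.1) =
      (c • a • p.1, c • (a • p.2 + X a • p.1))
    simp

end Tw

open KaehlerDifferential

/-- The derivation `b ↦ db + ε d(X b)`. -/
def twD (X : Derivation k A A) : Derivation k A (Tw X Ω[A⁄k]) :=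
  Derivation.mk' (LinearMap.prod (D k A : A →ₗ[k] Ω[A⁄k])
      ((D k A : A →ₗ[k] Ω[A⁄k]) ∘ₗ (X : A →ₗ[k] A))) fun a b => by
    change (D k A (a * b), D k A (X (a * b))) =
      (a • D k A b + b • D k A a, (a • D k A (X b) + X a • D k A b)
        + (b • D k A (X a) + X b • D k A a))
    simp only [Derivation.leibniz, map_add, smul_eq_mul, Prod.mk.injEq, true_and]
    abel

/-- The map `ω ↦ ω + ε L_X ω` on Kähler differentials. -/
def twΩ (X : Derivation k A A) : Ω[A⁄k] →ₗ[A] Tw X Ω[A⁄k] := (twD X).liftKaehlerDifferential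

/-- The Lie derivative `L_X` on Kähler differentials. -/
def lieΩ (X : Derivation k A A) (ω : Ω[A⁄k]) : Ω[A⁄k] := (twΩ X ω).2

lemma lieΩ_D (X : Derivation k A A) (b : A) : lieΩ X (D k A b) = D k A (X b) := by
  rw [lieΩ, twΩ, Derivation.liftKaehlerDifferential_comp_D]; rfl

lemma twΩ_fst (X : Derivation k A A) (ω : Ω[A⁄k]) : (twΩ X ω).1 = ω := by
  let fst : Tw X Ω[A⁄k] →ₗ[A] Ω[A⁄k] :=
    { toFun := fun p => p.1, map_add' := fun _ _ => rfl, map_smul' := fun _ _ => rfl }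
  have : fst ∘ₗ twΩ X = LinearMap.id := by
    apply Derivation.liftKaehlerDifferential_unique
    ext b
    change (twΩ X (D k A b)).1 = D k A b
    rw [twΩ, Derivation.liftKaehlerDifferential_comp_D]; rfl
  exact LinearMap.congr_fun this ω

lemma lieΩ_add (X : Derivation k A A) (ω η : Ω[A⁄k]) :
    lieΩ X (ω + η) = lieΩ X ω + lieΩ X η := by
  rw [lieΩ, map_add]; rfl

lemma lieΩ_smul (X : Derivation k A A) (a : A) (ω : Ω[A⁄k]) :
    lieΩ X (a • ω) = a • lieΩ X ω + X a • ω := by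
  rw [lieΩ, map_smul, Tw.smul_def, twΩ_fst]; rfl

/-- `(ω₁, …, ωₙ) ↦ ∑ᵢ ω₁ ∧ ⋯ ∧ L_X ωᵢ ∧ ⋯ ∧ ωₙ`. -/
def lieSum (X : Derivation k A A) (n : ℕ) (v : Fin n → Ω[A⁄k]) : ⋀[A]^n Ω[A⁄k] :=
  ∑ i, exteriorPower.ιMulti A n (Function.update v i (lieΩ X (v i)))

lemma lieSum_update (X : Derivation k A A) (n : ℕ) [DecidableEq (Fin n)] (v : Fin n → Ω[A⁄k])
    (j : Fin n) (x : Ω[A⁄k]) :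
    lieSum X n (Function.update v j x) =
      exteriorPower.ιMulti A n (Function.update v j (lieΩ X x)) +
      ∑ i ∈ Finset.univ.erase j, exteriorPower.ιMulti A n
        (Function.update (Function.update v i (lieΩ X (v i))) j x) := by
  rw [lieSum, ← Finset.add_sum_erase _ _ (Finset.mem_univ j)]
  congr 1
  · congr 1
    ext i
    by_cases h : i = j
    · subst h; simp
    · simp [h]
  · refine Finset.sum_congr rfl fun i hi => ?_
    have hij : i ≠ j := Finset.ne_of_mem_erase hi
    rw [Function.update_of_ne hij]
    congr 1
    ext l
    by_cases h : l = i
    · subst h; simp [hij]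
    · by_cases h' : l = j
      · subst h'; simp [h]
      · simp [h, h']

/-- `v ↦ ⋀ v + ε L_X (⋀ v)`. -/
def twAlt (X : Derivation k A A) (n : ℕ) :
    Ω[A⁄k] [⋀^Fin n]→ₗ[A] Tw X (⋀[A]^n Ω[A⁄k]) where
  toFun v := (exteriorPower.ιMulti A n v, lieSum X n v)
  map_update_add' v j x y := by
    change (_, _) = (_ + _, _ + _)
    rw [lieSum_update, lieSum_update, lieSum_update, lieΩ_add]
    simp only [AlternatingMap.map_update_add, Finset.sum_add_distrib, Prod.mk.injEq, true_and]
    abel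
  map_update_smul' v j a x := by
    change (_, _) = (a • _, a • _ + X a • _)
    rw [lieSum_update, lieSum_update, lieΩ_smul]
    simp only [AlternatingMap.map_update_add, AlternatingMap.map_update_smul, smul_add,
      Finset.smul_sum, Prod.mk.injEq, true_and]
    abel
  map_eq_zero_of_eq' v i j hv hij := by
    change (_, _) = ((0 : ⋀[A]^n Ω[A⁄k]), (0 : ⋀[A]^n Ω[A⁄k]))
    rw [AlternatingMap.map_eq_zero_of_eq _ _ hv hij, Prod.mk.injEq]
    refine ⟨rfl, ?_⟩
    rw [lieSum, Fintype.sum_eq_add i j hij]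
    · have : Function.update v j (lieΩ X (v j)) =
          Function.update v i (lieΩ X (v i)) ∘ Equiv.swap i j := by
        ext l
        by_cases h : l = i
        · subst h; simp [hij, hij.symm, hv]
        · by_cases h' : l = j
          · subst h'; simp [hv]
          · simp [h, h', Equiv.swap_apply_of_ne_of_ne]
      rw [this, AlternatingMap.map_swap _ _ hij, add_neg_cancel]
    · rintro l ⟨hi, hj⟩
      exact AlternatingMap.map_eq_zero_of_eq _ _ (by simp [hi.symm, hj.symm, hv]) hij

/-- The Lie derivative `L_X` on `⋀ⁿ Ω`. -/
def lieForm (X : Derivation k A A) (n : ℕ) (w : ⋀[A]^n Ω[A⁄k]) : ⋀[A]^n Ω[A⁄k] :=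
  (exteriorPower.alternatingMapLinearEquiv (twAlt X n) w).2

lemma lieForm_ιMulti (X : Derivation k A A) (n : ℕ) (v : Fin n → Ω[A⁄k]) :
    lieForm X n (exteriorPower.ιMulti A n v) =
      ∑ i, exteriorPower.ιMulti A n (Function.update v i (lieΩ X (v i))) := by
  rw [lieForm, exteriorPower.alternatingMapLinearEquiv_apply_ιMulti]; rfl

lemma lieForm_smul (X : Derivation k A A) (n : ℕ) (a : A) (w : ⋀[A]^n Ω[A⁄k]) :
    lieForm X n (a • w) = a • lieForm X n w + X a • w := by
  let fst : Tw X (⋀[A]^n Ω[A⁄k]) →ₗ[A] ⋀[A]^n Ω[A⁄k] :=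
    { toFun := fun p => p.1, map_add' := fun _ _ => rfl, map_smul' := fun _ _ => rfl }
  have h : fst ∘ₗ exteriorPower.alternatingMapLinearEquiv (twAlt X n) = LinearMap.id := by
    apply exteriorPower.linearMap_ext
    ext v
    change ((exteriorPower.alternatingMapLinearEquiv (twAlt X n)
      (exteriorPower.ιMulti A n v)).1 : ExteriorAlgebra A Ω[A⁄k]) = exteriorPower.ιMulti A n v
    rw [exteriorPower.alternatingMapLinearEquiv_apply_ιMulti]
    rfl
  have h' : (exteriorPower.alternatingMapLinearEquiv (twAlt X n) w).1 = w :=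
    LinearMap.congr_fun h w
  rw [lieForm, map_smul, Tw.smul_def, h']; rfl

end Lie

section Unimodular

variable (k A : Type u) [Field k] [CommRing A] [Algebra k A] [PoissonAlgebra k A] (ℓ : ℕ)

/-- The module `ω = ⋀^ℓ Ω` of differential forms of degree `ℓ`. -/
abbrev topForms : Type u := ⋀[A]^ℓ Ω[A⁄k]

/-- The left Poisson bracket `{a, w} = L_{{a, -}} w` on `⋀^ℓ Ω`. -/
def topBr (a : A) (w : topForms k A ℓ) : topForms k A ℓ := lieForm (ham k A a) ℓ w

/-- Homological unimodularity: `ω ≅ A` as left Poisson modules. -/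
def IsHomologicallyUnimodular : Prop :=
  ∃ e : topForms k A ℓ ≃ₗ[A] A, ∀ (a : A) (w : topForms k A ℓ),
    e (topBr k A ℓ a w) = pb k A a (e w)

/-- Poisson derivations. -/
def IsPoissonDerivation (δ : Derivation k A A) : Prop :=
  ∀ a b, δ (pb k A a b) = pb k A (δ a) b + pb k A a (δ b)

/-- Log-Hamiltonian derivations `u⁻¹ {u, -}`, for a unit `u`. -/
def IsLogHamiltonian (δ : Derivation k A A) : Prop :=
  ∃ u : Aˣ, ∀ a, δ a = (↑u⁻¹ : A) * pb k A u a

/-- `δ` is a modular derivation: a Poisson derivation with `ω ≅ ᵟA` as left Poisson modules, where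
`ᵟA` is `A` with the bracket `{a, x}_δ = {a, x} + δ(a) x`. -/
def IsModularDerivation (δ : Derivation k A A) : Prop :=
  IsPoissonDerivation k A δ ∧ ∃ e : topForms k A ℓ ≃ₗ[A] A, ∀ (a : A) (w : topForms k A ℓ),
    e (topBr k A ℓ a w) = pb k A a (e w) + δ a * e w

/-- `A` is unimodular: it has a modular derivation, and the modular class, that is, the class of
any modular derivation modulo log-Hamiltonian derivations, is zero. -/
def IsUnimodular : Prop :=
  (∃ δ, IsModularDerivation k A ℓ δ) ∧
    ∀ δ, IsModularDerivation k A ℓ δ → IsLogHamiltonian k A δ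

end Unimodular

/-! ### Calabi-Yau algebras -/

section CY

variable (k B : Type u) [Field k] [Ring B] [Algebra k B]

/-- `B` as a left module over `Bᵉ = B ⊗ Bᵒᵖ`: `(a ⊗ b) · x = a x b`. -/
def diagBimod : ModuleCat.{u} (B ⊗[k] Bᵐᵒᵖ) :=
  letI : Module (B ⊗[k] Bᵐᵒᵖ) B := TensorProduct.Algebra.module
  ModuleCat.of (B ⊗[k] Bᵐᵒᵖ) B

/-- `Bᵉ` as a left module over itself. -/
abbrev regBimod : ModuleCat.{u} (B ⊗[k] Bᵐᵒᵖ) := ModuleCat.of (B ⊗[k] Bᵐᵒᵖ) (B ⊗[k] Bᵐᵒᵖ)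

/-- Right multiplication by `z` on `Bᵉ`, an endomorphism of the left module `Bᵉ`. -/
def rmulBimod (z : B ⊗[k] Bᵐᵒᵖ) : regBimod k B ⟶ regBimod k B :=
  ModuleCat.ofHom (LinearMap.toSpanSingleton (B ⊗[k] Bᵐᵒᵖ) (B ⊗[k] Bᵐᵒᵖ) z)

/-- `B` is homologically smooth: as a left `Bᵉ`-module it has a resolution of finite length by
finitely generated projective modules. -/
def IsHomologicallySmooth : Prop :=
  ∃ P : ProjectiveResolution (diagBimod k B),
    (∀ n, Module.Finite (B ⊗[k] Bᵐᵒᵖ) (P.complex.X n)) ∧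
    ∃ N, ∀ n, N < n → Limits.IsZero (P.complex.X n)

/-- `B` is skew Calabi-Yau of dimension `d` with Nakayama automorphism `ν`: it is homologically
smooth, of injective dimension `d` on both sides, `Extⁱ_{Bᵉ}(B, Bᵉ) = 0` for `i ≠ d`, and
`Extᵈ_{Bᵉ}(B, Bᵉ) ≅ B^ν` as `B`-bimodules. The bimodule structure of `Ext` comes from the right
multiplication of `Bᵉ` on itself: `r · ξ · s` is the image of `ξ` under right multiplication by
`s ⊗ r`. -/
structure IsSkewCY (d : ℕ) (ν : B ≃ₐ[k] B) : Prop where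
  smooth : IsHomologicallySmooth k B
  injDim_left : injectiveDimension (ModuleCat.of B B) = d
  injDim_right : injectiveDimension (ModuleCat.of Bᵐᵒᵖ B) = d
  ext_zero : ∀ i, i ≠ d → Subsingleton (Abelian.Ext (diagBimod k B) (regBimod k B) i)
  ext_top : ∃ e : Abelian.Ext (diagBimod k B) (regBimod k B) d ≃+ B, ∀ (r s : B) ξ,
    e (ξ.comp (Abelian.Ext.mk₀ (rmulBimod k B (s ⊗ₜ op r))) (add_zero d)) = r * e ξ * ν s

/-- `B` is Calabi-Yau: skew Calabi-Yau of some dimension, with an inner automorphism as a Nakayama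
automorphism. -/
def IsCalabiYau : Prop :=
  ∃ (d : ℕ) (ν : B ≃ₐ[k] B), IsSkewCY k B d ν ∧ ∃ u : Bˣ, ∀ x, ν x = u * x * (↑u⁻¹ : B)

end CY

/-! ### `RHom_{Aᵉ}(A, Aᵉ)` -/

section RHom

variable (k A : Type u) [Field k] [CommRing A] [Algebra k A] [PoissonAlgebra k A]

/-- `RHom_{Aᵉ}(A, Aᵉ)`, an object of the bounded below derived category of right Poisson modules:
the value at `Aᵉ` of the total right derived functor of `Hom_{Aᵉ}(A, -)`. -/
def rhomEnv [HasDerivedCategory (PBimod k A)] [HasDerivedCategory (RightPMod k A)] :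
    DerivedCategory.Plus (RightPMod k A) :=
  (homEnv k A).rightDerivedFunctorPlus.obj
    ((DerivedCategory.Plus.singleFunctor (PBimod k A) 0).obj (envBimod k A))

end RHom

end Poisson
end

/-! Put S = A ⊗ Aᵒᵖ and let I be the kernel of the multiplication S → A, so that I/I² = Ω. The heart
of the matter is the fundamental local isomorphism: Extⁱ_S(A, S) vanishes for i ≠ ℓ, and Ext^ℓ_S(A,
S) ≅ Hom_A(ω_A, A). It has to be explicit enough to carry the Hamiltonian operators.

Étale coordinates show that I is generated by a regular sequence of length ℓ at every prime
containing it (`SA.isLocallyRegular`). If J is an injective resolution of S, the elements of J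
killed by such a sequence form a complex with cohomology in degree ℓ only (`cohomology_kill`). A
form is attached to a cocycle ξ of degree ℓ killed by I without choosing generators of I: in the
double complex of J-valued cochains on lists of elements of I, a zigzag leads from ξ to an S-valued
cochain ψ. Koszul coboundaries take values in I, so ψ is well defined modulo I on lists of length ℓ.
Locally, ψ is a scalar times the determinant of the coordinates in I/I² (`Ch.zig`,
`Zig.sub_det_mem`), so it is alternating and factors through Ω. Checking at primes shows that
classes and alternating forms correspond (`exists_isForm`, `IsForm.cobI`, `exists_isForm_eq`). As no
generators are involved, the construction commutes with derivations of S that lift to J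
(`IsForm.lie`).

RHom is computed by an injective resolution of Poisson bimodules. The above applies to it because
such a resolution stays injective over S, U(A)ᵉ being a flat right S-module (`injective_bimod`). The
flatness comes from a Poincaré-Birkhoff-Witt theorem at each prime (`Coord.pbw`): ordered monomials
in the H of local coordinates form a basis of the localized U(A). Hence the only cohomology of RHom
is Hom_A(ω_A, A), on which H_a sends G to w ↦ G{a, w} - {a, G w}. A Poisson trivialization of ω_A
identifies this module with A, by evaluation at the element w with e(w) = 1. Conversely, the form of
a cocycle that corresponds to 1 ∈ A is a Poisson isomorphism ω_A → A. This is (a) ⇔ (c).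

For (a) ⇔ (b): multiplying a trivialization of ω_A by a unit changes the modular derivation by a
log-Hamiltonian one, so unimodularity means that 0 is a modular derivation, which is (a). An
isomorphism ω_A ≅ A of A-modules turns the same local isomorphism into Ext^ℓ(A, Aᵉ) ≅ A with trivial
Nakayama automorphism. The finite resolution comes from the bound ℓ for the projective dimension of
A over S. Tensoring bimodule resolutions bounds the injective dimension of A by ℓ, and a regular
sequence through a point of an étale chart shows that it is not smaller. -/

noncomputable section

namespace Poisson

/-! ### Koszul-type cochains on lists -/

section Cochains

variable {S G : Type*} [CommRing S] {M M' : Type*} [AddCommGroup M] [Module S M]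
  [AddCommGroup M'] [Module S M']

/-- The Koszul differential `(g₀, …, gₚ) ↦ ∑ᵢ (-1)ⁱ τ(gᵢ) φ(g₀, …, ĝᵢ, …, gₚ)` of a cochain `φ`. -/
def kd (τ : G → S) : List G → (List G → M) → M
  | [], _ => 0
  | g :: l, φ => τ g • φ l - kd τ l fun l' => φ (g :: l')

@[simp] lemma kd_nil (τ : G → S) (φ : List G → M) : kd τ [] φ = 0 := rfl

@[simp] lemma kd_cons (τ : G → S) (g : G) (l : List G) (φ : List G → M) :
    kd τ (g :: l) φ = τ g • φ l - kd τ l fun l' => φ (g :: l') := rfl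

/-- The Koszul differential of a cochain, as a cochain. -/
def kD (τ : G → S) (φ : List G → M) : List G → M := fun l => kd τ l φ

lemma kd_add (τ : G → S) (l : List G) (φ ψ : List G → M) :
    kd τ l (φ + ψ) = kd τ l φ + kd τ l ψ := by
  induction l generalizing φ ψ with
  | nil => simp
  | cons g l ih =>
    have := ih (fun l' => φ (g :: l')) (fun l' => ψ (g :: l'))
    have e : (fun l' => (φ + ψ) (g :: l')) =
      (fun l' => φ (g :: l')) + (fun l' => ψ (g :: l')) := rfl
    rw [kd_cons, e, this, kd_cons, kd_cons, Pi.add_apply, smul_add]; abel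

lemma kd_smul (τ : G → S) (l : List G) (s : S) (φ : List G → M) :
    kd τ l (s • φ) = s • kd τ l φ := by
  induction l generalizing φ with
  | nil => simp
  | cons g l ih =>
    have := ih (fun l' => φ (g :: l'))
    have e : (fun l' => (s • φ) (g :: l')) = s • (fun l' => φ (g :: l')) := rfl
    rw [kd_cons, e, this, kd_cons, Pi.smul_apply, smul_sub, smul_comm]

/-- The Koszul differential as a linear map. -/
def kDL (τ : G → S) : (List G → M) →ₗ[S] (List G → M) where
  toFun := kD τ
  map_add' φ ψ := funext fun l => kd_add τ l φ ψ
  map_smul' s φ := funext fun l => kd_smul τ l s φ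

lemma kD_add (τ : G → S) (φ ψ : List G → M) : kD τ (φ + ψ) = kD τ φ + kD τ ψ :=
  (kDL τ).map_add φ ψ

lemma kD_sub (τ : G → S) (φ ψ : List G → M) : kD τ (φ - ψ) = kD τ φ - kD τ ψ :=
  (kDL τ).map_sub φ ψ

lemma kD_smul (τ : G → S) (s : S) (φ : List G → M) : kD τ (s • φ) = s • kD τ φ :=
  (kDL τ).map_smul s φ

lemma kD_zero (τ : G → S) : kD τ (0 : List G → M) = 0 := (kDL τ).map_zero

/-- Deleting two entries of a list in the two possible orders produces opposite signs, and the
scalars commute. -/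
lemma kD_anticomm (τ σ : G → S) (φ : List G → M) :
    kD τ (kD σ φ) + kD σ (kD τ φ) = 0 := by
  funext l
  change kd τ l (kD σ φ) + kd σ l (kD τ φ) = 0
  induction l generalizing φ with
  | nil => simp
  | cons g l ih =>
    have e (σ : G → S) : (fun l' => kD σ φ (g :: l')) =
      σ g • φ - kD σ (fun l' => φ (g :: l')) := rfl
    have := ih (fun l' => φ (g :: l'))
    rw [kd_cons, kd_cons, e, e]
    change _ • kd σ l φ - kD τ (_ - _) l + (_ • kd τ l φ - kD σ (_ - _) l) = 0
    rw [kD_sub, kD_sub, kD_smul, kD_smul]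
    simp only [Pi.sub_apply, Pi.smul_apply]
    change _ • kd σ l φ - (_ • kd τ l φ - kd τ l _) + (_ • kd τ l φ - (_ • kd σ l φ - kd σ l _)) = 0
    rw [← this]
    abel

/-- Proved separately from `kD_anticomm`, which for equal functions gives only twice the square,
whereas `S` may have 2-torsion. -/
lemma kD_kD (τ : G → S) (φ : List G → M) : kD τ (kD τ φ) = 0 := by
  funext l
  change kd τ l (kD τ φ) = 0
  induction l generalizing φ with
  | nil => simp
  | cons g l ih =>
    have e : (fun l' => kD τ φ (g :: l')) = τ g • φ - kD τ (fun l' => φ (g :: l')) := rfl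
    have := ih (fun l' => φ (g :: l'))
    rw [kd_cons, e]
    change _ • kd τ l φ - kD τ (_ - _) l = 0
    rw [kD_sub, kD_smul]
    simp only [Pi.sub_apply, Pi.smul_apply]
    change _ • kd τ l φ - (_ • kd τ l φ - kd τ l _) = 0
    rw [this]
    abel

/-- `σ` is a mere function, so that linear maps (`σ = id`) and localization maps are both covered.
-/
lemma kd_map {S' M'' : Type*} [CommRing S'] [AddCommGroup M''] [Module S' M''] (σ : S → S')
    (f : M →+ M'')
    (hf : ∀ s m, f (s • m) = σ s • f m) (τ : G → S) (l : List G) (φ : List G → M) :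
    f (kd τ l φ) = kd (fun g => σ (τ g)) l (fun l => f (φ l)) := by
  induction l generalizing φ with
  | nil => simp
  | cons g l ih => rw [kd_cons, map_sub, hf, ih]; rfl

lemma map_kD (f : M →ₗ[S] M') (τ : G → S) (φ : List G → M) :
    f ∘ kD τ φ = kD τ (f ∘ φ) :=
  funext fun l => kd_map id f.toAddMonoidHom (fun s m => f.map_smul s m) τ l φ

/-- This makes the end of a zigzag well defined modulo the ideal: its ambiguity is a Koszul
coboundary. -/
lemma kd_mem (τ : G → S) (I : Ideal S) (hτ : ∀ g, τ g ∈ I) (l : List G) (φ : List G → M) :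
    kd τ l φ ∈ I • (⊤ : Submodule S M) := by
  induction l generalizing φ with
  | nil => simp
  | cons g l ih =>
    exact Submodule.sub_mem _ (Submodule.smul_mem_smul (hτ g) trivial) (ih _)

lemma kd_sum {ι : Type*} (s : Finset ι) (c : ι → S) (u : ι → G → S) (l : List G)
    (φ : List G → M) :
    kd (fun g => ∑ j ∈ s, c j * u j g) l φ = ∑ j ∈ s, c j • kd (u j) l φ := by
  induction l generalizing φ with
  | nil => simp
  | cons g l ih =>
    simp only [kd_cons, ih, Finset.sum_smul, smul_sub, Finset.sum_sub_distrib, mul_smul]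

/-- The cochain concentrated in degree zero. -/
def kdelta (m : M) : List G → M
  | [] => m
  | _ :: _ => 0

lemma kD_kdelta (τ : G → S) (m : M) (hm : ∀ g, τ g • m = 0) : kD τ (kdelta m) = 0 := by
  funext l
  change kd τ l (kdelta m) = 0
  cases l with
  | nil => rfl
  | cons g l =>
    have e : (fun l' => kdelta m (g :: l')) = (0 : List G → M) := rfl
    rw [kd_cons, e]
    change _ - kD τ 0 l = 0
    rw [kD_zero]
    cases l with
    | nil => change τ g • m - 0 = 0; rw [hm, sub_zero]
    | cons => change τ g • (0 : M) - 0 = 0; simp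

lemma map_kdelta {F : Type*} [FunLike F M M'] [AddMonoidHomClass F M M'] (f : F) (m : M) :
    f ∘ (kdelta m : List G → M) = kdelta (f m) := by
  funext l
  cases l with
  | nil => rfl
  | cons => exact map_zero f

lemma kdelta_add (m n : M) : (kdelta (m + n) : List G → M) = kdelta m + kdelta n := by
  funext l
  cases l with
  | nil => rfl
  | cons => exact (add_zero (0 : M)).symm

lemma kdelta_smul (s : S) (m : M) : (kdelta (s • m) : List G → M) = s • kdelta m := by
  funext l
  cases l with
  | nil => rfl
  | cons => exact (smul_zero s).symm

/-- The operator on cochains induced by operators on the coefficients and on the index set. -/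
def kl (X : G → G) (h : M → M) : List G → (List G → M) → M
  | [], φ => h (φ [])
  | g :: l, φ => kl X h l (fun l' => φ (g :: l')) - φ (X g :: l)

lemma kl_sub (X : G → G) (h : M →+ M) (l : List G) (φ ψ : List G → M) :
    kl X h l (φ - ψ) = kl X h l φ - kl X h l ψ := by
  induction l generalizing φ ψ with
  | nil => simp [kl]
  | cons g l ih =>
    have := ih (fun l' => φ (g :: l')) (fun l' => ψ (g :: l'))
    have e : (fun l' => (φ - ψ) (g :: l')) =
      (fun l' => φ (g :: l')) - (fun l' => ψ (g :: l')) := rfl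
    change kl X h l (fun l' => (φ - ψ) (g :: l')) - (φ _ - ψ _) = _
    rw [e, this]
    simp only [kl]
    abel

lemma kl_smul (X : G → G) (D : S → S) (h : M →+ M) (hh : ∀ s m, h (s • m) = s • h m + D s • m)
    (l : List G) (s : S) (φ : List G → M) :
    kl X h l (s • φ) = s • kl X h l φ + D s • φ l := by
  induction l generalizing φ with
  | nil => simp [kl, hh]
  | cons g l ih =>
    have := ih (fun l' => φ (g :: l'))
    have e : (fun l' => (s • φ) (g :: l')) = s • (fun l' => φ (g :: l')) := rfl
    change kl X h l (fun l' => (s • φ) (g :: l')) - s • φ _ = _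
    rw [e, this]
    simp only [kl, smul_sub]
    abel

/-- The Lie derivative commutes with the Koszul differential as soon as `τ` intertwines the operator
on indices with the one on scalars; the two extra terms `D (τ g)` and `τ (X g)` cancel. -/
lemma kl_kD (τ : G → S) (X : G → G) (D : S → S) (hX : ∀ g, τ (X g) = D (τ g)) (h : M →+ M)
    (hh : ∀ s m, h (s • m) = s • h m + D s • m) (l : List G) (φ : List G → M) :
    kd τ l (fun l => kl X h l φ) = kl X h l (kD τ φ) := by
  induction l generalizing φ with
  | nil => simp [kl, kD]
  | cons g l ih =>
    have e : (fun l' => kl X h (g :: l') φ) =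
      (fun l' => kl X h l' (fun l' => φ (g :: l'))) - (fun l' => φ (X g :: l')) := rfl
    have e2 : (fun l' => kD τ φ (g :: l')) = τ g • φ - kD τ (fun l' => φ (g :: l')) := rfl
    rw [kd_cons, e]
    change _ - kD τ (_ - _) l = kl X h l (fun l' => kD τ φ (g :: l')) - kD τ φ (X g :: l)
    rw [kD_sub, Pi.sub_apply, e2, kl_sub, kl_smul X D h hh, ← ih]
    change _ - (kd τ l _ - kd τ l _) = _ - (τ (X g) • φ l - kd τ l _)
    rw [hX]
    abel

lemma kl_kdelta (X : G → G) (h : M →+ M) (m : M) :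
    (fun l => kl X h l (kdelta m)) = kdelta (h m) := by
  funext l
  cases l with
  | nil => rfl
  | cons g l =>
    change kl X h l (0 : List G → M) - 0 = 0
    have := kl_sub X h l 0 0
    rw [sub_self, sub_self] at this
    rw [this, sub_zero]

lemma map_kl (X : G → G) (h : M →+ M) (h' : M' →+ M') (f : M →+ M')
    (hf : ∀ m, f (h m) = h' (f m)) (l : List G) (φ : List G → M) :
    f (kl X h l φ) = kl X h' l (fun l => f (φ l)) := by
  induction l generalizing φ with
  | nil => exact hf _
  | cons g l ih => simp only [kl, map_sub, ih]

lemma kd_ofFn (u : G → S) (n : ℕ) (v : Fin (n + 1) → G) (φ : List G → M) :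
    kd u (List.ofFn v) φ =
      ∑ i : Fin (n + 1), (-1 : S) ^ (i : ℕ) • u (v i) • φ (List.ofFn (v ∘ i.succAbove)) := by
  induction n generalizing φ with
  | zero => simp
  | succ n ih =>
    rw [List.ofFn_succ, kd_cons, ih, sub_eq_add_neg, ← Finset.sum_neg_distrib]
    conv_rhs => rw [Fin.sum_univ_succ]
    simp only [Fin.val_zero, pow_zero, one_smul, Fin.succAbove_zero]
    congr 1
    refine Finset.sum_congr rfl fun i _ => ?_
    rw [Fin.val_succ, pow_succ, mul_neg_one, neg_smul]
    congr 4
    rw [List.ofFn_succ]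
    simp [Function.comp_def]

lemma kl_ofFn (X : G → G) (h : M →+ M) (n : ℕ) (v : Fin n → G) (φ : List G → M) :
    kl X h (List.ofFn v) φ = h (φ (List.ofFn v)) -
      ∑ i, φ (List.ofFn (Function.update v i (X (v i)))) := by
  induction n generalizing φ with
  | zero => simp [kl]
  | succ n ih =>
    rw [List.ofFn_succ, kl, ih, Fin.sum_univ_succ, sub_sub, add_comm (∑ i, _)]
    congr 2
    · simp [List.ofFn_succ]
    · refine Finset.sum_congr rfl fun i _ => ?_
      rw [List.ofFn_succ, Function.update_of_ne (Fin.succ_ne_zero i).symm]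
      congr 3
      funext j
      by_cases hj : j = i
      · subst hj; simp
      · rw [Function.update_of_ne hj, Function.update_of_ne (fun e => hj (Fin.succ_injective _ e))]

/-- Iterated products of one-cochains: `kdet u q m` is `u_q ∧ ⋯ ∧ u_{q + m - 1}`. -/
def kdet (u : ℕ → G → S) : ℕ → ℕ → List G → S
  | _, 0 => kdelta 1
  | q, m + 1 => kD (u q) (kdet u (q + 1) m)

/-- Move the factor `u j` to its twin inside the product by anticommutation; there the square is
zero. -/
lemma kD_kdet (u : ℕ → G → S) (j q m : ℕ) (h1 : q ≤ j) (h2 : j < q + m) :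
    kD (u j) (kdet u q m) = 0 := by
  induction m generalizing q with
  | zero => omega
  | succ m ih =>
    rw [kdet]
    by_cases h : j = q
    · subst h; exact kD_kD _ _
    · have := kD_anticomm (u j) (u q) (kdet u (q + 1) m)
      rw [ih (q + 1) (by omega) (by omega), kD_zero, add_zero] at this
      exact this

/-- The recursion defining `kdet` is the Laplace expansion along the first column. -/
lemma kdet_ofFn (u : ℕ → G → S) (q m : ℕ) (v : Fin m → G) :
    kdet u q m (List.ofFn v) = (Matrix.of fun i j : Fin m => u (q + j) (v i)).det := by
  induction m generalizing q with
  | zero => simp [kdet, kdelta]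
  | succ m ih =>
    rw [kdet, Matrix.det_succ_column_zero]
    change kd _ _ _ = _
    rw [kd_ofFn]
    refine Finset.sum_congr rfl fun i _ => ?_
    rw [ih, smul_eq_mul, smul_eq_mul, mul_assoc]
    congr 3
    ext a b
    simp [add_right_comm q 1, add_assoc]

end Cochains

/-! ### Zigzags -/

section Zigzag

variable {S G : Type*} [CommRing S] {N : Type*} [AddCommGroup N] [Module S N]
  {J : ℕ → Type*} [∀ q, AddCommGroup (J q)] [∀ q, Module S (J q)]
  (dJ : ∀ q, J q →ₗ[S] J (q + 1)) (ε : N →ₗ[S] J 0) (τ : G → S)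

/-- The cochain `φ` with values in `J q` is connected to the cochain `ψ` with values in `N` by a
zigzag. -/
def Zig : (q : ℕ) → (List G → J q) → (List G → N) → Prop
  | 0, φ, ψ => φ = ε ∘ ψ
  | q + 1, φ, ψ => ∃ η : List G → J q, dJ q ∘ η = φ ∧ Zig q (kD τ η) ψ

variable {dJ ε τ}

lemma Zig.add {q : ℕ} {φ φ' : List G → J q} {ψ ψ' : List G → N} (h : Zig dJ ε τ q φ ψ)
    (h' : Zig dJ ε τ q φ' ψ') : Zig dJ ε τ q (φ + φ') (ψ + ψ') := by
  induction q with
  | zero => funext l; simp [show φ = _ from h, show φ' = _ from h']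
  | succ q ih =>
    obtain ⟨η, rfl, hη⟩ := h
    obtain ⟨η', rfl, hη'⟩ := h'
    refine ⟨η + η', by funext l; simp, ?_⟩
    rw [kD_add]
    exact ih hη hη'

lemma Zig.smul {q : ℕ} {φ : List G → J q} {ψ : List G → N} (s : S) (h : Zig dJ ε τ q φ ψ) :
    Zig dJ ε τ q (s • φ) (s • ψ) := by
  induction q with
  | zero => funext l; simp [show φ = _ from h]
  | succ q ih =>
    obtain ⟨η, rfl, hη⟩ := h
    refine ⟨s • η, by funext l; simp, ?_⟩
    rw [kD_smul]
    exact ih hη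

lemma Zig.sub {q : ℕ} {φ φ' : List G → J q} {ψ ψ' : List G → N} (h : Zig dJ ε τ q φ ψ)
    (h' : Zig dJ ε τ q φ' ψ') : Zig dJ ε τ q (φ - φ') (ψ - ψ') := by
  have := h.add (h'.smul (-1))
  simpa [sub_eq_add_neg] using this

/-- A diagram chase in a double complex with exact rows. Cochains are arbitrary functions on lists,
so preimages can be chosen list by list. -/
lemma Zig.exists (hε : Function.Exact ε (dJ 0)) (hd : ∀ q, Function.Exact (dJ q) (dJ (q + 1)))
    (q : ℕ) (φ : List G → J q) (h1 : kD τ φ = 0) (h2 : dJ q ∘ φ = 0) :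
    ∃ ψ : List G → N, Zig dJ ε τ q φ ψ := by
  induction q with
  | zero =>
    choose ψ hψ using fun l => (hε (φ l)).1 (congrFun h2 l)
    exact ⟨ψ, funext fun l => (hψ l).symm⟩
  | succ q ih =>
    choose η hη using fun l => (hd q (φ l)).1 (congrFun h2 l)
    have hη' : dJ q ∘ η = φ := funext hη
    obtain ⟨ψ, hψ⟩ := ih (kD τ η) (kD_kD τ η) (by rw [map_kD, hη', h1])
    exact ⟨ψ, η, hη', hψ⟩

/-- The ambiguity of a zigzag: a start that is a Koszul coboundary of a `dJ`-closed cochain ends in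
a Koszul coboundary. -/
lemma Zig.eq_kD (hε : Function.Exact ε (dJ 0)) (hε' : Function.Injective ε)
    (hd : ∀ q, Function.Exact (dJ q) (dJ (q + 1)))
    (q : ℕ) (α : List G → J q) (hα : dJ q ∘ α = 0) {ψ : List G → N}
    (h : Zig dJ ε τ q (kD τ α) ψ) : ∃ θ : List G → N, ψ = kD τ θ := by
  induction q with
  | zero =>
    choose θ hθ using fun l => (hε (α l)).1 (congrFun hα l)
    have : α = ε ∘ θ := funext fun l => (hθ l).symm
    refine ⟨θ, funext fun l => hε' ?_⟩
    have h' : kD τ α = ε ∘ ψ := h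
    rw [this, ← map_kD] at h'
    exact (congrFun h' l).symm
  | succ q ih =>
    obtain ⟨η, hη, h'⟩ := h
    choose β hβ using fun l => (hd q (α l)).1 (congrFun hα l)
    have hβ' : dJ q ∘ β = α := funext hβ
    -- `η` and `kD τ β` have the same image under `dJ`, and subtracting the latter does not change
    -- `kD τ η` because the Koszul differential squares to zero.
    refine ih (η - kD τ β) ?_ ?_
    · have : dJ q ∘ (η - kD τ β) = dJ q ∘ η - dJ q ∘ kD τ β := by funext l; simp
      rw [this, hη, map_kD, hβ', sub_self]
    · rwa [kD_sub, kD_kD, sub_zero]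

lemma Zig.of_zero (hε : Function.Exact ε (dJ 0)) (hε' : Function.Injective ε)
    (hd : ∀ q, Function.Exact (dJ q) (dJ (q + 1))) (q : ℕ) {ψ : List G → N}
    (h : Zig dJ ε τ q 0 ψ) : ∃ θ : List G → N, ψ = kD τ θ := by
  rw [← kD_zero τ] at h
  exact Zig.eq_kD hε hε' hd q 0 (by funext l; simp) h

/-- Two lifts of the same start are compared, the given one and `kdelta ζ`; the latter is Koszul
closed since `τ` kills `ζ`. -/
lemma Zig.of_coboundary (hε : Function.Exact ε (dJ 0)) (hε' : Function.Injective ε)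
    (hd : ∀ q, Function.Exact (dJ q) (dJ (q + 1))) (q : ℕ) (ζ : J q) (hζ : ∀ g, τ g • ζ = 0)
    {ψ : List G → N} (h : Zig dJ ε τ (q + 1) (kdelta (dJ q ζ)) ψ) :
    ∃ θ : List G → N, ψ = kD τ θ := by
  obtain ⟨η, hη, h'⟩ := h
  refine Zig.eq_kD hε hε' hd q (η - kdelta ζ) ?_ ?_
  · have : dJ q ∘ (η - kdelta ζ) = dJ q ∘ η - dJ q ∘ kdelta ζ := by funext l; simp
    rw [this, hη, map_kdelta, sub_self]
  · rwa [kD_sub, kD_kdelta τ ζ hζ, sub_zero]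

lemma Zig.map {S' : Type*} [CommRing S'] {N' : Type*} [AddCommGroup N'] [Module S' N']
    {J' : ℕ → Type*} [∀ q, AddCommGroup (J' q)] [∀ q, Module S' (J' q)]
    {dJ' : ∀ q, J' q →ₗ[S'] J' (q + 1)} {ε' : N' →ₗ[S'] J' 0} (σ : S → S')
    (f : ∀ q, J q →+ J' q) (g : N →+ N') (hf : ∀ q s m, f q (s • m) = σ s • f q m)
    (hd : ∀ q m, f (q + 1) (dJ q m) = dJ' q (f q m)) (hε : ∀ n, f 0 (ε n) = ε' (g n))
    {q : ℕ} {φ : List G → J q} {ψ : List G → N} (h : Zig dJ ε τ q φ ψ) :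
    Zig dJ' ε' (fun x => σ (τ x)) q (f q ∘ φ) (g ∘ ψ) := by
  induction q with
  | zero => funext l; simp [show φ = _ from h, hε]
  | succ q ih =>
    obtain ⟨η, rfl, hη⟩ := h
    refine ⟨f q ∘ η, by funext l; simp [hd], ?_⟩
    have : f q ∘ kD τ η = kD (fun x => σ (τ x)) (f q ∘ η) :=
      funext fun l => kd_map σ (f q) (hf q) τ l η
    rw [← this]
    exact ih hη

/-- Every arrow of the double complex commutes with the Lie operators, so they can be applied to all
the intermediate cochains of a zigzag at once. -/
lemma Zig.lie (X : G → G) (D : S → S) (hX : ∀ g, τ (X g) = D (τ g)) (h : ∀ q, J q →+ J q)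
    (hh : ∀ q s m, h q (s • m) = s • h q m + D s • m) (hd : ∀ q m, dJ q (h q m) = h (q + 1) (dJ q m))
    (h' : N →+ N) (hε : ∀ n, ε (h' n) = h 0 (ε n))
    {q : ℕ} {φ : List G → J q} {ψ : List G → N} (hz : Zig dJ ε τ q φ ψ) :
    Zig dJ ε τ q (fun l => kl X (h q) l φ) (fun l => kl X h' l ψ) := by
  induction q with
  | zero =>
    have e : φ = ε ∘ ψ := hz
    funext l
    exact (by rw [e]; exact (map_kl X h' (h 0) ε.toAddMonoidHom hε l ψ).symm)
  | succ q ih =>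
    obtain ⟨η, rfl, hη⟩ := hz
    refine ⟨fun l => kl X (h q) l η, ?_, ?_⟩
    · funext l
      exact map_kl X (h q) (h (q + 1)) (dJ q).toAddMonoidHom (hd q) l η
    · have : kD τ (fun l => kl X (h q) l η) = fun l => kl X (h q) l (kD τ η) :=
        funext fun l => kl_kD τ X D hX (h q) (hh q) l η
      rw [this]
      exact ih hη

end Zigzag

/-! ### Regular sequences acting on an injective resolution -/

section Chains

variable {S : Type*} [CommRing S] {M : Type*} [AddCommGroup M] [Module S M]
  {J : ℕ → Type*} [∀ q, AddCommGroup (J q)] [∀ q, Module S (J q)]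
  (dJ : ∀ q, J q →ₗ[S] J (q + 1)) (ε : S →ₗ[S] J 0) (t : ℕ → S)

/-- The element `w` is killed by `t 0, …, t (j - 1)`. -/
def Kill (j : ℕ) (w : M) : Prop := ∀ i < j, t i • w = 0

variable {t} in
lemma Kill.sub {j : ℕ} {v w : M} (hv : Kill t j v) (hw : Kill t j w) : Kill t j (v - w) :=
  fun i hi => by rw [smul_sub, hv i hi, hw i hi, sub_zero]

variable {t} in
lemma Kill.add {j : ℕ} {v w : M} (hv : Kill t j v) (hw : Kill t j w) : Kill t j (v + w) :=
  fun i hi => by rw [smul_add, hv i hi, hw i hi, add_zero]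

variable {t} in
lemma Kill.smul {j : ℕ} {w : M} (s : S) (hw : Kill t j w) : Kill t j (s • w) :=
  fun i hi => by rw [smul_comm, hw i hi, smul_zero]

variable {t} in
lemma Kill.map {M' : Type*} [AddCommGroup M'] [Module S M'] (f : M →ₗ[S] M') {j : ℕ} {w : M}
    (hw : Kill t j w) : Kill t j (f w) :=
  fun i hi => by rw [← map_smul, hw i hi, map_zero]

variable {t} in
lemma Kill.succ {j : ℕ} {w : M} (hw : Kill t j w) (h : t j • w = 0) : Kill t (j + 1) w :=
  fun i hi => by
    rcases Nat.lt_succ_iff_lt_or_eq.1 hi with h' | rfl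
    · exact hw i h'
    · exact h

variable {t} in
lemma Kill.pred {j : ℕ} {w : M} (hw : Kill t (j + 1) w) : Kill t j w :=
  fun i hi => hw i (by omega)

/-- Coboundaries in the subcomplex killed by `t 0, …, t (j - 1)`. -/
def Cob (j : ℕ) : (i : ℕ) → J i → Prop
  | 0, y => y = 0
  | i + 1, y => ∃ w : J i, Kill t j w ∧ dJ i w = y

variable {dJ t}

lemma Cob.smul {j i : ℕ} {y : J i} (s : S) (h : Cob dJ t j i y) : Cob dJ t j i (s • y) := by
  cases i with
  | zero => rw [show y = 0 from h, smul_zero]; rfl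
  | succ i =>
    obtain ⟨w, hw, rfl⟩ := h
    exact ⟨s • w, hw.smul s, by simp⟩

lemma Cob.add {j i : ℕ} {y y' : J i} (h : Cob dJ t j i y) (h' : Cob dJ t j i y') :
    Cob dJ t j i (y + y') := by
  cases i with
  | zero => rw [show y = 0 from h, show y' = 0 from h', add_zero]; rfl
  | succ i =>
    obtain ⟨w, hw, rfl⟩ := h
    obtain ⟨w', hw', rfl⟩ := h'
    exact ⟨w + w', hw.add hw', by simp⟩

variable (dJ t)

/-- `Ch j n y`: the class of `y` in degree `j` of the subcomplex killed by `t 0, …, t (j - 1)` is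
the one of `n`, by iterated connecting homomorphisms. -/
def Ch : (j : ℕ) → S → J j → Prop
  | 0, n, y => y = ε n
  | j + 1, n, y => ∃ z : J j, Kill t j z ∧ Ch j n (t j • z) ∧ y = dJ j z

variable {dJ t ε}

lemma Ch.smul {j : ℕ} {n : S} {y : J j} (s : S) (h : Ch dJ ε t j n y) :
    Ch dJ ε t j (s * n) (s • y) := by
  induction j generalizing n with
  | zero => rw [show y = _ from h, ← map_smul]; rfl
  | succ j ih =>
    obtain ⟨z, hz, h, rfl⟩ := h
    refine ⟨s • z, hz.smul s, ?_, by simp⟩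
    rw [smul_comm]
    exact ih h

lemma Ch.sub {j : ℕ} {n n' : S} {y y' : J j} (h : Ch dJ ε t j n y) (h' : Ch dJ ε t j n' y') :
    Ch dJ ε t j (n - n') (y - y') := by
  induction j generalizing n n' with
  | zero => rw [show y = _ from h, show y' = _ from h', ← map_sub]; rfl
  | succ j ih =>
    obtain ⟨z, hz, h, rfl⟩ := h
    obtain ⟨z', hz', h', rfl⟩ := h'
    refine ⟨z - z', hz.sub hz', ?_, by simp⟩
    rw [smul_sub]
    exact ih h h'

lemma Ch.cocycle (hε : Function.Exact ε (dJ 0)) (hd : ∀ q, Function.Exact (dJ q) (dJ (q + 1)))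
    {j : ℕ} {n : S} {y : J j} (h : Ch dJ ε t j n y) : dJ j y = 0 := by
  cases j with
  | zero => rw [show y = _ from h]; exact hε.apply_apply_eq_zero _
  | succ j =>
    obtain ⟨z, _, _, rfl⟩ := h
    exact (hd j).apply_apply_eq_zero _

lemma Ch.kill (hε : Function.Exact ε (dJ 0)) (hd : ∀ q, Function.Exact (dJ q) (dJ (q + 1)))
    {j : ℕ} {n : S} {y : J j} (h : Ch dJ ε t j n y) : Kill t j y := by
  cases j with
  | zero => exact fun i hi => by omega
  | succ j =>
    obtain ⟨z, hz, h, rfl⟩ := h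
    refine (hz.map (dJ j)).succ ?_
    rw [← map_smul]
    exact h.cocycle hε hd

/-- A cochain killed by `t j` modulo coboundaries can be corrected by a coboundary. -/
lemma exists_kill_succ (hd : ∀ q, Function.Exact (dJ q) (dJ (q + 1))) {j : ℕ}
    (hdiv : ∀ q (w : J q), Kill t j w → ∃ z, Kill t j z ∧ t j • z = w) {i : ℕ} {β : J i}
    (hβ : Kill t j β) (h : Cob dJ t j i (t j • β)) :
    ∃ β', Kill t (j + 1) β' ∧ dJ i β' = dJ i β := by
  cases i with
  | zero => exact ⟨β, hβ.succ h, rfl⟩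
  | succ i =>
    obtain ⟨w, hw, e⟩ := h
    obtain ⟨z, hz, rfl⟩ := hdiv i w hw
    refine ⟨β - dJ i z, (hβ.sub (hz.map _)).succ ?_, ?_⟩
    · rw [smul_sub, ← e, map_smul, sub_self]
    · rw [map_sub, (hd i).apply_apply_eq_zero, sub_zero]

/-- The cohomology of the subcomplex killed by a regular sequence. -/
theorem cohomology_kill (hε : Function.Exact ε (dJ 0)) (hε' : Function.Injective ε)
    (hd : ∀ q, Function.Exact (dJ q) (dJ (q + 1))) (ℓ : ℕ)
    (hdiv : ∀ j < ℓ, ∀ q (w : J q), Kill t j w → ∃ z, Kill t j z ∧ t j • z = w)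
    (hreg : ∀ j < ℓ, ∀ s, t j * s ∈ Ideal.span (t '' Set.Iio j) →
      s ∈ Ideal.span (t '' Set.Iio j)) (j : ℕ) (hj : j ≤ ℓ) :
    (∀ i ≠ j, ∀ ξ : J i, Kill t j ξ → dJ i ξ = 0 → Cob dJ t j i ξ) ∧
    (∀ n, ∃ y, Ch dJ ε t j n y) ∧
    (∀ y : J j, Kill t j y → dJ j y = 0 → ∃ n y', Ch dJ ε t j n y' ∧ Cob dJ t j j (y - y')) ∧
    (∀ n y, Ch dJ ε t j n y → (Cob dJ t j j y ↔ n ∈ Ideal.span (t '' Set.Iio j))) := by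
  induction j with
  | zero =>
    refine ⟨?_, fun n => ⟨_, rfl⟩, ?_, ?_⟩
    · intro i hi ξ _ hξ
      obtain ⟨i, rfl⟩ := Nat.exists_eq_succ_of_ne_zero hi
      obtain ⟨w, hw⟩ := (hd i ξ).1 hξ
      exact ⟨w, fun i hi => by omega, hw⟩
    · intro y _ hy
      obtain ⟨n, hn⟩ := (hε y).1 hy
      exact ⟨n, y, hn.symm, sub_self y⟩
    · intro n y h
      change y = 0 ↔ _
      rw [show y = _ from h, map_eq_zero_iff ε hε']
      simp
  | succ j ih =>
    obtain ⟨iha, ihb, ihc, ihd⟩ := ih (by omega)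
    have hdiv' := hdiv j (by omega)
    have hreg' := hreg j (by omega)
    have hspan : t '' Set.Iio (j + 1) = insert (t j) (t '' Set.Iio j) := by
      rw [← Set.image_insert_eq]
      congr 1
      ext i
      simp
    -- By `hdiv'`, multiplication by `t j` is onto on the subcomplex killed by the previous
    -- elements, with kernel the next subcomplex. The four claims are the long exact sequence, in
    -- which `t j` is injective on the only cohomology group, S/(t 0, …, t (j - 1)).
    refine ⟨?_, ?_, ?_, ?_⟩
    · intro i hi ξ hk hξ
      have h1 : Cob dJ t j i ξ := by
        by_cases h : i = j
        · subst h
          obtain ⟨n, y', hy', hc⟩ := ihc ξ hk.pred hξ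
          have h2 : Cob dJ t i i (t i • y') := by
            have := hc.smul (-t i)
            rwa [smul_sub, neg_smul, hk i (by omega), neg_smul, neg_zero, zero_sub,
              neg_neg] at this
          -- The class `n` of `ξ` is killed by the new element of the sequence, so it is zero by
          -- regularity.
          have h3 := hreg' n ((ihd _ _ (hy'.smul (t i))).1 h2)
          simpa using hc.add ((ihd _ _ hy').2 h3)
        · exact iha i h ξ hk.pred hξ
      cases i with
      | zero => exact h1
      | succ i =>
        obtain ⟨ζ, hζ, rfl⟩ := h1
        have h2 : Cob dJ t j i (t j • ζ) :=
          iha i (by omega) _ (hζ.smul _) (by rw [map_smul]; exact hk j (by omega))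
        exact exists_kill_succ hd hdiv' hζ h2
    · intro n
      obtain ⟨y, hy⟩ := ihb n
      obtain ⟨z, hz, rfl⟩ := hdiv' j y (hy.kill hε hd)
      exact ⟨_, z, hz, hy, rfl⟩
    · intro y hk hy
      obtain ⟨ζ, hζ, rfl⟩ : Cob dJ t j (j + 1) y := iha _ (by omega) y hk.pred hy
      obtain ⟨n, y', hy', hc⟩ := ihc (t j • ζ) (hζ.smul _)
        (by rw [map_smul]; exact hk j (by omega))
      obtain ⟨z, hz, rfl⟩ := hdiv' j y' (hy'.kill hε hd)
      rw [← smul_sub] at hc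
      obtain ⟨β, hβ, e⟩ := exists_kill_succ hd hdiv' (hζ.sub hz) hc
      exact ⟨n, dJ j z, ⟨z, hz, hy', rfl⟩, β, hβ, by rw [e, map_sub]⟩
    · rintro n y ⟨z, hz, hc, rfl⟩
      rw [hspan, Ideal.span_insert, Submodule.mem_sup]
      constructor
      · rintro ⟨w, hw, e⟩
        -- `z - w` is a cocycle of the larger subcomplex, say of class `n'`. As `t j` kills `w`, the
        -- class `n` of `t j • z` is `t j * n'` modulo the previous elements.
        obtain ⟨n', y', hy', hc'⟩ := ihc (z - w) (hz.sub hw.pred) (by rw [map_sub, e, sub_self])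
        have h1 := hc'.smul (t j)
        rw [smul_sub, smul_sub, hw j (by omega), sub_zero] at h1
        have h2 := (ihd _ _ (hc.sub (hy'.smul (t j)))).1 h1
        exact ⟨t j * n', Ideal.mem_span_singleton'.2 ⟨n', mul_comm _ _⟩, _, h2, by ring⟩
      · rintro ⟨a, ha, b, hb, rfl⟩
        obtain ⟨s, rfl⟩ := Ideal.mem_span_singleton'.1 ha
        obtain ⟨y, hy⟩ := ihb s
        have h1 := (ihd _ _ (hc.sub (hy.smul (t j)))).2 (by convert hb using 1; ring)
        rw [← smul_sub] at h1
        obtain ⟨β, hβ, e⟩ := exists_kill_succ hd hdiv' (hz.sub (hy.kill hε hd)) h1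
        exact ⟨β, hβ, by rw [e, map_sub, hy.cocycle hε hd, sub_zero]⟩

/-- The zigzag attached to a chain of connecting homomorphisms. -/
lemma Ch.zig {G : Type*} {τ : G → S} {u : ℕ → G → S} {ℓ : ℕ}
    (hτ : ∀ g, τ g = ∑ j ∈ Finset.range ℓ, t j * u j g) {n : S} (q m : ℕ) (hq : q + m = ℓ)
    {y : J q} (h : Ch dJ ε t q n y) :
    Zig dJ ε τ q (fun l => kdet u q m l • y) (fun l => kdet u 0 ℓ l * n) := by
  induction q generalizing m with
  | zero =>
    obtain rfl : m = ℓ := by omega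
    funext l
    rw [show y = _ from h, ← map_smul]; rfl
  | succ q ih =>
    obtain ⟨z, hz, hc, rfl⟩ := h
    refine ⟨fun l => kdet u (q + 1) m l • z, by funext l; simp, ?_⟩
    have key : kD τ (fun l => kdet u (q + 1) m l • z) =
        fun l => kdet u q (m + 1) l • t q • z := by
      funext l
      have h1 (j : ℕ) : kd (u j) l (fun l => kdet u (q + 1) m l • z) =
          (kD (u j) (kdet u (q + 1) m) l) • z :=
        (kd_map id (LinearMap.toSpanSingleton S (J q) z).toAddMonoidHom
          (fun s m => by simp [mul_smul]) (u j) l (kdet u (q + 1) m)).symm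
      -- Of the sum of the `t j * u j`, the terms with `j < q` vanish since `t j` kills `z`, those
      -- with `j > q` since `u j` already occurs in the product. Only `j = q` survives, and it
      -- lengthens the determinant.
      rw [kD, show τ = _ from funext hτ, kd_sum, Finset.sum_eq_single q]
      · rw [h1, smul_comm]; rfl
      · intro j hj hjq
        rw [h1]
        rcases lt_or_gt_of_ne hjq with h | h
        · rw [smul_comm, hz j h, smul_zero]
        · rw [kD_kdet u j _ _ (by omega) (by have := Finset.mem_range.1 hj; omega)]
          simp
      · intro h; exact absurd (Finset.mem_range.2 (by omega)) h
    rw [key]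
    exact ih (m + 1) (by omega) hc

end Chains

/-- Divisibility of injective modules along regular sequences. -/
lemma exists_smul_eq_of_injective {S : Type u} [CommRing S] (t : ℕ → S) (j : ℕ)
    (hreg : ∀ s, t j * s ∈ Ideal.span (t '' Set.Iio j) → s ∈ Ideal.span (t '' Set.Iio j))
    (M : Type u) [AddCommGroup M] [Module S M] [Module.Injective S M] (w : M)
    (hw : Kill t j w) : ∃ z, Kill t j z ∧ t j • z = w := by
  set K := Ideal.span (t '' Set.Iio j) with hK
  have hw' : K ≤ LinearMap.ker (LinearMap.toSpanSingleton S M w) := by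
    rw [hK, Ideal.span, Submodule.span_le]
    rintro _ ⟨i, hi, rfl⟩
    exact hw i hi
  let g : (S ⧸ K) →ₗ[S] M := K.liftQ (LinearMap.toSpanSingleton S M w) hw'
  let f : (S ⧸ K) →ₗ[S] (S ⧸ K) := LinearMap.lsmul S (S ⧸ K) (t j)
  have hf : Function.Injective f := by
    rw [injective_iff_map_eq_zero]
    intro x hx
    obtain ⟨s, rfl⟩ := Ideal.Quotient.mk_surjective x
    have : Ideal.Quotient.mk K (t j * s) = 0 := hx
    rw [Ideal.Quotient.eq_zero_iff_mem] at this ⊢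
    exact hreg s this
  -- The element `w` is a map S/K → M; injectivity extends it along the injective multiplication by
  -- `t j` on S/K, and the value of the extension at 1 is the quotient sought.
  obtain ⟨h, hh⟩ := Module.Injective.out f hf g
  refine ⟨h (Ideal.Quotient.mk K 1), fun i hi => ?_, ?_⟩
  · rw [← map_smul]
    have : t i • (Ideal.Quotient.mk K 1) = Ideal.Quotient.mk K (t i) := by
      change Ideal.Quotient.mk K (t i * 1) = _
      rw [mul_one]
    have h2 : t i ∈ K := Ideal.subset_span ⟨i, hi, rfl⟩
    rw [this, Ideal.Quotient.eq_zero_iff_mem.2 h2, map_zero]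
  · rw [← map_smul]
    refine (hh _).trans ?_
    change (1 : S) • w = w
    exact one_smul _ _

/-! ### Localization of injective resolutions -/

/-- An injective resolution of the module `N`. -/
structure IsInjRes {S : Type u} [CommRing S] {N : Type u} [AddCommGroup N] [Module S N]
    {J : ℕ → Type u} [∀ q, AddCommGroup (J q)] [∀ q, Module S (J q)]
    (dJ : ∀ q, J q →ₗ[S] J (q + 1)) (ε : N →ₗ[S] J 0) : Prop where
  injective (q : ℕ) : Module.Injective S (J q)
  mono : Function.Injective ε
  exact_zero : Function.Exact ε (dJ 0)
  exact (q : ℕ) : Function.Exact (dJ q) (dJ (q + 1))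

/-- The elements killed by an ideal. -/
def KillI {S : Type*} [CommRing S] {M : Type*} [AddCommGroup M] [Module S M] (I : Ideal S)
    (w : M) : Prop := ∀ x ∈ I, x • w = 0

/-- Coboundaries in the subcomplex killed by an ideal. -/
def CobI {S : Type*} [CommRing S] {J : ℕ → Type*} [∀ q, AddCommGroup (J q)]
    [∀ q, Module S (J q)] (dJ : ∀ q, J q →ₗ[S] J (q + 1)) (I : Ideal S) : (i : ℕ) → J i → Prop
  | 0, y => y = 0
  | i + 1, y => ∃ w : J i, KillI I w ∧ dJ i w = y

section Killing

variable {S : Type*} [CommRing S] {M : Type*} [AddCommGroup M] [Module S M]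
  {J : ℕ → Type*} [∀ q, AddCommGroup (J q)] [∀ q, Module S (J q)]
  {dJ : ∀ q, J q →ₗ[S] J (q + 1)}

lemma killI_span_iff (s : Set S) (w : M) : KillI (Ideal.span s) w ↔ ∀ x ∈ s, x • w = 0 := by
  refine ⟨fun h x hx => h x (Ideal.subset_span hx), fun h x hx => ?_⟩
  have : Ideal.span s ≤ LinearMap.ker (LinearMap.toSpanSingleton S M w) := by
    rw [Ideal.span, Submodule.span_le]; exact h
  exact this hx

lemma kill_iff_killI (t : ℕ → S) (j : ℕ) (w : M) :
    Kill t j w ↔ KillI (Ideal.span (t '' Set.Iio j)) w := by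
  rw [killI_span_iff]
  exact ⟨by rintro h _ ⟨i, hi, rfl⟩; exact h i hi, fun h i hi => h _ ⟨i, hi, rfl⟩⟩

lemma cob_iff_cobI (t : ℕ → S) (j i : ℕ) (y : J i) :
    Cob dJ t j i y ↔ CobI dJ (Ideal.span (t '' Set.Iio j)) i y := by
  cases i with
  | zero => rfl
  | succ i => simp only [Cob, CobI, kill_iff_killI]

variable {I : Ideal S}

lemma KillI.smul {w : M} (h : KillI I w) (s : S) : KillI I (s • w) := fun x hx => by
  rw [smul_comm, h x hx, smul_zero]

lemma KillI.add {w w' : M} (h : KillI I w) (h' : KillI I w') : KillI I (w + w') := fun x hx => by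
  rw [smul_add, h x hx, h' x hx, add_zero]

lemma CobI.smul {i : ℕ} {y : J i} (h : CobI dJ I i y) (s : S) : CobI dJ I i (s • y) := by
  cases i with
  | zero => rw [show y = 0 from h, smul_zero]; rfl
  | succ i =>
    obtain ⟨w, hw, rfl⟩ := h
    exact ⟨s • w, hw.smul s, by simp⟩

lemma CobI.add {i : ℕ} {y y' : J i} (h : CobI dJ I i y) (h' : CobI dJ I i y') :
    CobI dJ I i (y + y') := by
  cases i with
  | zero => rw [show y = 0 from h, show y' = 0 from h', add_zero]; rfl
  | succ i =>
    obtain ⟨w, hw, rfl⟩ := h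
    obtain ⟨w', hw', rfl⟩ := h'
    exact ⟨w + w', hw.add hw', by simp⟩

end Killing

section Localization

variable {S : Type u} [CommRing S] (M : Submonoid S)
  {J : ℕ → Type u} [∀ q, AddCommGroup (J q)] [∀ q, Module S (J q)]
  {dJ : ∀ q, J q →ₗ[S] J (q + 1)} {ε : S →ₗ[S] J 0}

variable (J) in
/-- The localization map of a cochain complex. -/
abbrev locMap (q : ℕ) : J q →ₗ[S] LocalizedModule M (J q) :=
  LocalizedModule.mkLinearMap M (J q)

variable (dJ) in
/-- The localized differential. -/
def locD (q : ℕ) : LocalizedModule M (J q) →ₗ[Localization M] LocalizedModule M (J (q + 1)) :=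
  IsLocalizedModule.mapExtendScalars M (locMap M J q) (locMap M J (q + 1)) (Localization M) (dJ q)

variable (ε) in
/-- The localized augmentation. -/
def locAug : Localization M →ₗ[Localization M] LocalizedModule M (J 0) :=
  IsLocalizedModule.mapExtendScalars M (Algebra.linearMap S (Localization M)) (locMap M J 0)
    (Localization M) ε

lemma locD_locMap (q : ℕ) (m : J q) : locD M dJ q (locMap M J q m) = locMap M J (q + 1) (dJ q m) := by
  rw [locD, IsLocalizedModule.mapExtendScalars_apply_apply, IsLocalizedModule.map_apply]

lemma locAug_algebraMap (n : S) :
    locAug M ε (algebraMap S (Localization M) n) = locMap M J 0 (ε n) := by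
  rw [locAug, IsLocalizedModule.mapExtendScalars_apply_apply]
  exact IsLocalizedModule.map_apply M (Algebra.linearMap S (Localization M)) (locMap M J 0) ε n

lemma locMap_smul (q : ℕ) (s : S) (m : J q) :
    locMap M J q (s • m) = algebraMap S (Localization M) s • locMap M J q m := by
  rw [map_smul, algebraMap_smul]

/-- Localization is exact, and over a noetherian ring it preserves injective modules. -/
theorem IsInjRes.localize [IsNoetherianRing S] (h : IsInjRes dJ ε) :
    IsInjRes (locD M dJ) (locAug M ε) where
  injective q :=
    haveI := h.injective q
    Module.injective_of_isLocalizedModule M (locMap M J q)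
  mono := IsLocalizedModule.map_injective M (Algebra.linearMap S (Localization M)) (locMap M J 0)
    ε h.mono
  exact_zero := IsLocalizedModule.map_exact M (Algebra.linearMap S (Localization M))
    (locMap M J 0) (locMap M J 1) ε (dJ 0) h.exact_zero
  exact q := IsLocalizedModule.map_exact M (locMap M J q) (locMap M J (q + 1))
    (locMap M J (q + 1 + 1)) (dJ q) (dJ (q + 1)) (h.exact q)

variable {M} {I : Ideal S}

lemma KillI.locMap {q : ℕ} {w : J q} (h : KillI I w) :
    KillI (I.map (algebraMap S (Localization M))) (locMap M J q w) := by
  rw [Ideal.map, killI_span_iff]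
  rintro _ ⟨x, hx, rfl⟩
  rw [← locMap_smul, h x hx, map_zero]

/-- For each of the finitely many generators of the ideal some denominator kills the product with
the numerator; the product of these denominators serves for all. -/
lemma exists_killI_locMap (hI : I.FG) {q : ℕ} {w : LocalizedModule M (J q)}
    (hw : KillI (I.map (algebraMap S (Localization M))) w) :
    ∃ s : M, ∃ w' : J q, KillI I w' ∧ locMap M J q w' = (s : S) • w := by
  obtain ⟨⟨w₁, s₁⟩, e⟩ := IsLocalizedModule.surj M (locMap M J q) w
  change (s₁ : S) • w = _ at e
  obtain ⟨T, rfl⟩ := hI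
  have key : ∀ x ∈ T, ∃ s : M, (s : S) • x • w₁ = 0 := by
    intro x hx
    have : locMap M J q (x • w₁) = 0 := by
      rw [locMap_smul, ← e, smul_comm, hw _ (Ideal.mem_map_of_mem _ (Ideal.subset_span hx)),
        smul_zero]
    exact (IsLocalizedModule.eq_zero_iff M (locMap M J q)).1 this
  choose! s hs using key
  refine ⟨(∏ x ∈ T, s x) * s₁, ((∏ x ∈ T, s x : M) : S) • w₁, ?_, ?_⟩
  · refine (killI_span_iff _ _).2 fun x hx => ?_
    rw [smul_comm]
    obtain ⟨c, hc⟩ := Finset.dvd_prod_of_mem s hx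
    rw [hc, mul_comm, Submonoid.coe_mul, mul_smul, hs x hx, smul_zero]
  · rw [map_smul, ← e, Submonoid.coe_mul, mul_smul]

lemma exists_cobI_of_locMap (hI : I.FG) {i : ℕ} {ξ : J i}
    (h : CobI (locD M dJ) (I.map (algebraMap S (Localization M))) i (locMap M J i ξ)) :
    ∃ s : M, CobI dJ I i ((s : S) • ξ) := by
  cases i with
  | zero => exact (IsLocalizedModule.eq_zero_iff M (locMap M J 0)).1 h
  | succ i =>
    obtain ⟨w, hw, e⟩ := h
    obtain ⟨s, w', hw', e'⟩ := exists_killI_locMap hI hw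
    have : locMap M J (i + 1) (dJ i w') = locMap M J (i + 1) ((s : S) • ξ) := by
      rw [← locD_locMap, e', (locMap M J (i + 1)).map_smul, ← e]
      exact ((locD M dJ i).restrictScalars S).map_smul _ _
    obtain ⟨s', h'⟩ := (IsLocalizedModule.eq_iff_exists M (locMap M J (i + 1))).1 this
    refine ⟨s' * s, (s' : S) • w', hw'.smul _, ?_⟩
    rw [map_smul, Submonoid.coe_mul, mul_smul]
    exact h'

lemma exists_cocycle_locMap (hI : I.FG) {i : ℕ} {η : LocalizedModule M (J i)}
    (hη : KillI (I.map (algebraMap S (Localization M))) η) (hd : locD M dJ i η = 0) :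
    ∃ s : M, ∃ ξ : J i, KillI I ξ ∧ dJ i ξ = 0 ∧ locMap M J i ξ = (s : S) • η := by
  obtain ⟨s, ξ, hξ, e⟩ := exists_killI_locMap hI hη
  have : locMap M J (i + 1) (dJ i ξ) = 0 := by
    rw [← locD_locMap, e]
    exact (((locD M dJ i).restrictScalars S).map_smul _ _).trans (by
      change (s : S) • locD M dJ i η = 0
      rw [hd, smul_zero])
  obtain ⟨s', h'⟩ := (IsLocalizedModule.eq_zero_iff M (locMap M J (i + 1))).1 this
  refine ⟨s' * s, (s' : S) • ξ, hξ.smul _, ?_, ?_⟩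
  · rw [map_smul]; exact h'
  · rw [map_smul, e, Submonoid.coe_mul, mul_smul]

lemma Zig.localize {G : Type*} {τ : G → S} {q : ℕ} {φ : List G → J q} {ψ : List G → S}
    (h : Zig dJ ε τ q φ ψ) :
    Zig (locD M dJ) (locAug M ε) (fun g => algebraMap S (Localization M) (τ g)) q
      (locMap M J q ∘ φ) (algebraMap S (Localization M) ∘ ψ) :=
  Zig.map (algebraMap S (Localization M)) (fun q => (locMap M J q).toAddMonoidHom)
    (algebraMap S (Localization M)).toAddMonoidHom (fun q s m => locMap_smul M q s m)
    (fun q m => (locD_locMap M q m).symm) (fun n => (locAug_algebraMap M n).symm) h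

end Localization

/-! ### Locally regular ideals -/

/-- `t` is a regular sequence of length `ℓ`. -/
def IsReg {R : Type*} [CommRing R] (t : ℕ → R) (ℓ : ℕ) : Prop :=
  ∀ j < ℓ, ∀ s, t j * s ∈ Ideal.span (t '' Set.Iio j) → s ∈ Ideal.span (t '' Set.Iio j)

/-- The ideal `I` is locally generated by a regular sequence of length `ℓ`. -/
def IsLocallyRegular {S : Type u} [CommRing S] (I : Ideal S) (ℓ : ℕ) : Prop :=
  ∀ (P : Ideal S) [P.IsPrime], I ≤ P → ∃ t : ℕ → Localization.AtPrime P,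
    IsReg t ℓ ∧ Ideal.span (t '' Set.Iio ℓ) = I.map (algebraMap S (Localization.AtPrime P))

lemma mem_span_image_Iio_iff {R : Type*} [CommRing R] (t : ℕ → R) (m : ℕ) (x : R) :
    x ∈ Ideal.span (t '' Set.Iio m) ↔ ∃ c : ℕ → R, x = ∑ j ∈ Finset.range m, t j * c j := by
  rw [← Finset.coe_range, Ideal.span, Submodule.mem_span_image_finset_iff_exists_fun]
  constructor
  · rintro ⟨c, rfl⟩
    refine ⟨fun j => if h : j ∈ Finset.range m then c ⟨j, h⟩ else 0, ?_⟩
    rw [← Finset.sum_coe_sort (Finset.range m)]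
    exact Finset.sum_congr rfl fun j _ => by simp only [dif_pos j.2, smul_eq_mul, mul_comm]
  · rintro ⟨c, rfl⟩
    refine ⟨fun j => c j, ?_⟩
    rw [← Finset.sum_coe_sort (Finset.range m)]
    exact Finset.sum_congr rfl fun j _ => by rw [smul_eq_mul, mul_comm]

/-- The coefficients of a relation between the elements of a regular sequence lie in the ideal. -/
lemma IsReg.mem_of_sum_eq_zero {R : Type*} [CommRing R] {t : ℕ → R} {ℓ : ℕ} (h : IsReg t ℓ)
    (m : ℕ) (hm : m ≤ ℓ) (c : ℕ → R) (hc : ∑ j ∈ Finset.range m, t j * c j = 0) :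
    ∀ j < m, c j ∈ Ideal.span (t '' Set.Iio m) := by
  induction m generalizing c with
  | zero => intro j hj; omega
  | succ m ih =>
    have hle : Ideal.span (t '' Set.Iio m) ≤ Ideal.span (t '' Set.Iio (m + 1)) :=
      Ideal.span_mono (Set.image_mono (Set.Iio_subset_Iio (Nat.le_succ m)))
    rw [Finset.sum_range_succ] at hc
    have h1 : c m ∈ Ideal.span (t '' Set.Iio m) := by
      refine h m hm _ ((mem_span_image_Iio_iff _ _ _).2 ⟨fun j => -c j, ?_⟩)
      simp only [mul_neg, Finset.sum_neg_distrib]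
      linear_combination hc
    -- Substituting `c m = ∑ t j * b j` leaves a relation between `m` elements, with coefficients `c
    -- j + t m * b j`.
    obtain ⟨b, hb⟩ := (mem_span_image_Iio_iff _ _ _).1 h1
    have h2 := ih (by omega) (fun j => c j + t m * b j) (by
      rw [hb, Finset.mul_sum, ← Finset.sum_add_distrib] at hc
      rw [← hc]
      exact Finset.sum_congr rfl fun j _ => by ring)
    intro j hj
    rcases Nat.lt_succ_iff_lt_or_eq.1 hj with hj | rfl
    · have h3 : t m * b j ∈ Ideal.span (t '' Set.Iio (m + 1)) :=
        Ideal.mul_mem_right _ _ (Ideal.subset_span ⟨m, Nat.lt_succ_self m, rfl⟩)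
      simpa using sub_mem (hle (h2 j hj)) h3
    · exact hle h1

/-- An element lies in the ideal `I` if it does so at the primes containing `I`. -/
lemma mem_of_forall_localization {S : Type u} [CommRing S] {I : Ideal S} {s : S}
    (h : ∀ (P : Ideal S) [P.IsPrime], I ≤ P →
      algebraMap S (Localization.AtPrime P) s ∈ I.map (algebraMap S (Localization.AtPrime P))) :
    s ∈ I := by
  rw [← Ideal.span_singleton_le_iff_mem]
  refine Ideal.le_of_localization_maximal fun P hP => ?_
  rw [Ideal.map_span, Set.image_singleton, Ideal.span_singleton_le_iff_mem]
  by_cases hIP : I ≤ P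
  · exact h P hIP
  · obtain ⟨x, hx, hxP⟩ := SetLike.not_le_iff_exists.1 hIP
    have hu := IsLocalization.map_units (Localization.AtPrime P) (⟨x, hxP⟩ : P.primeCompl)
    rw [Ideal.eq_top_of_isUnit_mem _ (Ideal.mem_map_of_mem _ hx) hu]
    trivial

/-- A local-global principle: an ideal is the unit ideal if it is not contained in any prime. -/
lemma ideal_eq_top_of_forall {S : Type*} [CommRing S] {I : Ideal S}
    (h : ∀ P : Ideal S, P.IsPrime → ∃ s ∈ I, s ∉ P) : I = ⊤ := by
  by_contra hI
  obtain ⟨P, hP, hle⟩ := Ideal.exists_le_maximal I hI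
  obtain ⟨s, hs, hsP⟩ := h P hP.isPrime
  exact hsP (hle hs)

/-! ### Local-global principle for cohomology classes, and vanishing outside degree ℓ -/

section Vanishing

variable {S : Type u} [CommRing S] [IsNoetherianRing S]
  {J : ℕ → Type u} [∀ q, AddCommGroup (J q)] [∀ q, Module S (J q)]
  {dJ : ∀ q, J q →ₗ[S] J (q + 1)} {ε : S →ₗ[S] J 0} {I : Ideal S} {ℓ : ℕ}

lemma IsInjRes.cohomology (h : IsInjRes dJ ε) {t : ℕ → S} (ht : IsReg t ℓ) :
    (∀ i ≠ ℓ, ∀ ξ : J i, Kill t ℓ ξ → dJ i ξ = 0 → Cob dJ t ℓ i ξ) ∧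
    (∀ n, ∃ y, Ch dJ ε t ℓ n y) ∧
    (∀ y : J ℓ, Kill t ℓ y → dJ ℓ y = 0 → ∃ n y', Ch dJ ε t ℓ n y' ∧ Cob dJ t ℓ ℓ (y - y')) ∧
    (∀ n y, Ch dJ ε t ℓ n y → (Cob dJ t ℓ ℓ y ↔ n ∈ Ideal.span (t '' Set.Iio ℓ))) :=
  cohomology_kill h.exact_zero h.mono h.exact ℓ (fun j hj q w hw =>
    haveI := h.injective q
    exists_smul_eq_of_injective t j (ht j hj) (J q) w hw) ht ℓ le_rfl

/-- Coboundaries can be recognized locally at the primes containing `I`. -/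
lemma cobI_of_localization {i : ℕ} {ξ : J i} (hξ : KillI I ξ)
    (h : ∀ (P : Ideal S) [P.IsPrime], I ≤ P → CobI (locD P.primeCompl dJ)
      (I.map (algebraMap S (Localization.AtPrime P))) i (locMap P.primeCompl J i ξ)) :
    CobI dJ I i ξ := by
  -- The scalars that make `ξ` a coboundary form an ideal. It contains `I`, and meets the complement
  -- of each prime above `I` by the local hypothesis, so it contains 1.
  let K : Ideal S :=
    { carrier := {s | CobI dJ I i (s • ξ)}
      add_mem' := fun {a b} ha hb => by
        change CobI dJ I i ((a + b) • ξ)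
        rw [add_smul]; exact CobI.add ha hb
      zero_mem' := by
        change CobI dJ I i ((0 : S) • ξ)
        rw [zero_smul]
        cases i with
        | zero => rfl
        | succ i => exact ⟨0, fun x _ => smul_zero x, map_zero _⟩
      smul_mem' := fun c a ha => by
        change CobI dJ I i ((c * a) • ξ)
        rw [mul_smul]; exact CobI.smul ha c }
  have hK : K = ⊤ := by
    refine ideal_eq_top_of_forall fun P hP => ?_
    by_cases hIP : I ≤ P
    · obtain ⟨s, hs⟩ := exists_cobI_of_locMap (IsNoetherian.noetherian I) (h P hIP)
      exact ⟨s, hs, s.2⟩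
    · obtain ⟨x, hx, hxP⟩ := SetLike.not_le_iff_exists.1 hIP
      refine ⟨x, ?_, hxP⟩
      change CobI dJ I i (x • ξ)
      rw [hξ x hx, ← zero_smul S ξ]
      exact K.zero_mem
  have : (1 : S) ∈ K := hK ▸ trivial
  simpa using (show CobI dJ I i ((1 : S) • ξ) from this)

/-- This is the vanishing of Extⁱ(S/I, S) for `i ≠ ℓ`, in terms of elements of the resolution: it
holds locally by `cohomology_kill`. -/
theorem IsInjRes.cobI (h : IsInjRes dJ ε) (hI : IsLocallyRegular I ℓ) {i : ℕ} (hi : i ≠ ℓ)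
    (ξ : J i) (hξ : KillI I ξ) (hd : dJ i ξ = 0) : CobI dJ I i ξ := by
  refine cobI_of_localization hξ fun P _ hP => ?_
  obtain ⟨t, ht, e⟩ := hI P hP
  rw [← e, ← cob_iff_cobI]
  refine ((h.localize P.primeCompl).cohomology ht).1 i hi _ ?_ ?_
  · rw [kill_iff_killI, e]; exact hξ.locMap
  · rw [locD_locMap, hd, map_zero]

end Vanishing

/-! ### Forms attached to classes of top degree -/

/-- The cochain at the end of a zigzag is a determinant up to the ideal generated by the regular
sequence. -/
lemma Zig.sub_det_mem {R : Type*} [CommRing R] {G : Type*} {J : ℕ → Type*}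
    [∀ q, AddCommGroup (J q)] [∀ q, Module R (J q)]
    {dJ : ∀ q, J q →ₗ[R] J (q + 1)} {ε : R →ₗ[R] J 0} (hε : Function.Exact ε (dJ 0))
    (hε' : Function.Injective ε) (hd : ∀ q, Function.Exact (dJ q) (dJ (q + 1)))
    {t : ℕ → R} {ℓ : ℕ} {τ : G → R} {u : ℕ → G → R}
    (hτ : ∀ g, τ g = ∑ j ∈ Finset.range ℓ, t j * u j g) {n : R} {ξ y : J ℓ}
    (hy : Ch dJ ε t ℓ n y) (hξ : Cob dJ t ℓ ℓ (ξ - y)) {ψ : List G → R}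
    (hψ : Zig dJ ε τ ℓ (kdelta ξ) ψ) (v : Fin ℓ → G) :
    ψ (List.ofFn v) - (Matrix.of fun i j : Fin ℓ => u j (v i)).det * n ∈
      Ideal.span (t '' Set.Iio ℓ) := by
  have hτI : ∀ g, τ g ∈ Ideal.span (t '' Set.Iio ℓ) := fun g => by
    rw [hτ]
    exact (mem_span_image_Iio_iff _ _ _).2 ⟨_, rfl⟩
  -- The class `y` has an explicit zigzag ending in the determinant times `n`. As `ξ` and `y` are
  -- cohomologous, the two ends differ by a Koszul coboundary, with values in the ideal.
  have h1 := hy.zig hτ ℓ 0 (add_zero ℓ)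
  have e : (fun l => kdet u ℓ 0 l • y) = (kdelta y : List G → J ℓ) := by
    funext l
    cases l with
    | nil => exact one_smul _ _
    | cons => exact zero_smul _ _
  rw [e] at h1
  have h2 := hψ.sub h1
  have e2 : (kdelta ξ - kdelta y : List G → J ℓ) = kdelta (ξ - y) := by
    funext l
    cases l with
    | nil => rfl
    | cons => exact sub_zero _
  rw [e2] at h2
  have h3 : ∃ θ : List G → R, (ψ - fun l => kdet u 0 ℓ l * n) = kD τ θ := by
    cases ℓ with
    | zero =>
      refine Zig.of_zero hε hε' hd 0 (ψ := ψ - fun l => kdet u 0 0 l * n) ?_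
      rw [show ξ - y = 0 from hξ] at h2
      convert h2 using 1
      funext l
      cases l <;> rfl
    | succ ℓ =>
      obtain ⟨w, hw, e3⟩ := hξ
      rw [← e3] at h2
      refine Zig.of_coboundary hε hε' hd ℓ w (fun g => ?_) h2
      exact (kill_iff_killI _ _ _).1 hw _ (hτI g)
  obtain ⟨θ, hθ⟩ := h3
  have h4 := congrFun hθ (List.ofFn v)
  rw [Pi.sub_apply, kdet_ofFn] at h4
  simp only [zero_add] at h4
  rw [h4]
  have := kd_mem τ _ hτI (List.ofFn v) θ
  rwa [smul_eq_mul, Ideal.mul_top] at this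

section Forms

variable {S A : Type u} [CommRing S] [CommRing A] [Algebra S A]
  {Ω : Type u} [AddCommGroup Ω] [Module A Ω] [Module S Ω] [IsScalarTower S A Ω]
  {J : ℕ → Type u} [∀ q, AddCommGroup (J q)] [∀ q, Module S (J q)]
  {dJ : ∀ q, J q →ₗ[S] J (q + 1)} {ε : S →ₗ[S] J 0} {ℓ : ℕ}

variable (S A) in
/-- The kernel of `S → A`. -/
abbrev kerI : Ideal S := RingHom.ker (algebraMap S A)

/-- `Ω` is the conormal module `I / I²` of the surjection `S → A` with kernel `I`. -/
structure IsConormal (q : kerI S A →ₗ[S] Ω) : Prop where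
  algebraMap_surjective : Function.Surjective (algebraMap S A)
  surjective : Function.Surjective q
  ker (x : kerI S A) : q x = 0 → x ∈ kerI S A • (⊤ : Submodule S (kerI S A))

/-- The local description of classes and forms at a prime containing the kernel. -/
theorem IsInjRes.exists_local [IsNoetherianRing S] (h : IsInjRes dJ ε)
    (hI : IsLocallyRegular (kerI S A) ℓ) (P : Ideal S) [P.IsPrime] (hP : kerI S A ≤ P) :
    ∃ (U : kerI S A →ₗ[S] (Fin ℓ → Localization.AtPrime P ⧸
          (kerI S A).map (algebraMap S (Localization.AtPrime P))))
      (v₀ : Fin ℓ → kerI S A),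
      (∀ ξ : J ℓ, KillI (kerI S A) ξ → dJ ℓ ξ = 0 → ∀ ψ : List (kerI S A) → S,
        Zig dJ ε ((↑) : kerI S A → S) ℓ (kdelta ξ) ψ → ∃ n,
          (∀ v, Ideal.Quotient.mk _ (algebraMap S (Localization.AtPrime P) (ψ (List.ofFn v))) =
            (Matrix.of fun i j => U (v i) j).det * n) ∧
          (n = 0 → CobI (locD P.primeCompl dJ)
            ((kerI S A).map (algebraMap S (Localization.AtPrime P))) ℓ
            (locMap P.primeCompl J ℓ ξ))) ∧
      IsUnit (Matrix.of fun i j => U (v₀ i) j).det ∧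
      (∃ ξ : J ℓ, KillI (kerI S A) ξ ∧ dJ ℓ ξ = 0 ∧ ∀ ψ : List (kerI S A) → S,
        Zig dJ ε ((↑) : kerI S A → S) ℓ (kdelta ξ) ψ → ψ (List.ofFn v₀) ∉ P) ∧
      (∀ x : kerI S A, ∃ s ∉ P, ∃ c : Fin ℓ → S, s • x = ∑ j, c j • v₀ j) := by
  set R := Localization.AtPrime P with hR
  obtain ⟨t, ht, hspan⟩ := hI P hP
  have h' := h.localize P.primeCompl
  obtain ⟨-, hc1, hc2, hc3⟩ := h'.cohomology ht
  have hu : ∀ x : kerI S A, ∃ c : ℕ → R,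
      algebraMap S R x = ∑ j ∈ Finset.range ℓ, t j * c j := fun x => by
    rw [← mem_span_image_Iio_iff, hspan]
    exact Ideal.mem_map_of_mem _ x.2
  choose u hu using hu
  -- Coefficients with respect to a regular sequence are unique modulo the ideal; this makes the
  -- coordinates `U` well defined and linear.
  have hcoef : ∀ c : ℕ → R, ∑ j ∈ Finset.range ℓ, t j * c j = 0 →
      ∀ j : Fin ℓ, Ideal.Quotient.mk ((kerI S A).map (algebraMap S R)) (c j) = 0 := by
    intro c hc j
    rw [Ideal.Quotient.eq_zero_iff_mem, ← hspan]
    exact ht.mem_of_sum_eq_zero ℓ le_rfl c hc j j.2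
  let U : kerI S A →ₗ[S] (Fin ℓ → R ⧸ (kerI S A).map (algebraMap S R)) :=
    { toFun := fun x j => Ideal.Quotient.mk _ (u x j)
      map_add' := fun x y => by
        funext j
        have := hcoef (fun j => u (x + y) j - u x j - u y j) (by
          simp only [mul_sub, Finset.sum_sub_distrib, ← hu]
          simp) j
        rw [map_sub, map_sub, sub_sub, sub_eq_zero] at this
        exact this
      map_smul' := fun s x => by
        funext j
        have := hcoef (fun j => u (s • x) j - algebraMap S R s * u x j) (by
          have : ∀ j, t j * (u (s • x) j - algebraMap S R s * u x j) =
            t j * u (s • x) j - algebraMap S R s * (t j * u x j) := fun j => by ring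
          simp only [this, Finset.sum_sub_distrib, ← hu, ← Finset.mul_sum]
          simp) j
        rw [map_sub, map_mul, sub_eq_zero] at this
        rw [this]
        exact (Algebra.smul_def (A := R ⧸ (kerI S A).map (algebraMap S R)) s _).symm }
  have hmk : ∀ (v : Fin ℓ → kerI S A) (n : R),
      Ideal.Quotient.mk ((kerI S A).map (algebraMap S R))
        ((Matrix.of fun i j : Fin ℓ => u (v i) j).det * n) =
      (Matrix.of fun i j => U (v i) j).det * Ideal.Quotient.mk _ n := by
    intro v n
    rw [map_mul, RingHom.map_det]
    rfl
  have hloc : ∀ ψ : List (kerI S A) → S, ∀ ξ : J ℓ,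
      Zig dJ ε ((↑) : kerI S A → S) ℓ (kdelta ξ) ψ → ∀ n y,
      Ch (locD P.primeCompl dJ) (locAug P.primeCompl ε) t ℓ n y →
      Cob (locD P.primeCompl dJ) t ℓ ℓ (locMap P.primeCompl J ℓ ξ - y) → ∀ v : Fin ℓ → kerI S A,
      Ideal.Quotient.mk _ (algebraMap S R (ψ (List.ofFn v))) =
        (Matrix.of fun i j => U (v i) j).det *
          Ideal.Quotient.mk ((kerI S A).map (algebraMap S R)) n := by
    intro ψ ξ hψ n y hy hξy v
    have h1 := hψ.localize (M := P.primeCompl)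
    rw [map_kdelta] at h1
    have h2 := h1.sub_det_mem h'.exact_zero h'.mono h'.exact (u := fun j x => u x j) hu hy hξy v
    rw [hspan] at h2
    rw [← hmk, Ideal.Quotient.mk_eq_mk_iff_sub_mem]
    exact h2
  -- Clearing the denominators of the regular sequence produces elements `v₀ j` of the ideal itself.
  -- Their coordinate matrix is diagonal, with the denominators on the diagonal, so its determinant
  -- is a unit.
  have hv : ∀ j : Fin ℓ, ∃ (x : kerI S A) (s : P.primeCompl),
      t j * algebraMap S R s = algebraMap S R x := by
    intro j
    have : t j ∈ (kerI S A).map (algebraMap S R) := by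
      rw [← hspan]; exact Ideal.subset_span ⟨j, j.2, rfl⟩
    obtain ⟨⟨x, s⟩, hx⟩ := (IsLocalization.mem_map_algebraMap_iff P.primeCompl R).1 this
    exact ⟨x, s, hx⟩
  choose v₀ w hv₀ using hv
  have hUv : (Matrix.of fun i j => U (v₀ i) j) =
      Matrix.diagonal fun i => algebraMap S (R ⧸ (kerI S A).map (algebraMap S R)) (w i) := by
    ext i j
    have := hcoef (fun j => u (v₀ i) j - if j = i then algebraMap S R (w i) else 0) (by
      simp only [mul_sub, Finset.sum_sub_distrib, ← hu, mul_ite, mul_zero, Finset.sum_ite_eq',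
        Finset.mem_range, i.2, if_true, hv₀, sub_self]) j
    rw [map_sub, sub_eq_zero] at this
    change Ideal.Quotient.mk _ (u (v₀ i) j) = _
    rw [this, Matrix.diagonal_apply]
    by_cases hij : i = j
    · subst hij; simp only [if_true]; rfl
    · have : (j : ℕ) ≠ i := fun hh => hij (Fin.ext hh.symm)
      rw [if_neg hij, if_neg this, map_zero]
  have hunit : ∀ s : P.primeCompl, IsUnit
      (algebraMap S (R ⧸ (kerI S A).map (algebraMap S R)) s) := fun s =>
    (IsLocalization.map_units R s).map (Ideal.Quotient.mk ((kerI S A).map (algebraMap S R)))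
  have hdet : IsUnit (Matrix.of fun i j => U (v₀ i) j).det := by
    rw [hUv, Matrix.det_diagonal]
    exact IsUnit.prod_iff.2 fun i _ => hunit (w i)
  refine ⟨U, v₀, ?_, hdet, ?_, ?_⟩
  · intro ξ hξ hdξ ψ hψ
    obtain ⟨n, y, hy, hξy⟩ := hc2 (locMap P.primeCompl J ℓ ξ)
      (by rw [kill_iff_killI, hspan]; exact hξ.locMap) (by rw [locD_locMap, hdξ, map_zero])
    refine ⟨Ideal.Quotient.mk _ n, hloc ψ ξ hψ n y hy hξy, fun hn => ?_⟩
    rw [Ideal.Quotient.eq_zero_iff_mem, ← hspan, ← hc3 n y hy] at hn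
    rw [← hspan, ← cob_iff_cobI]
    simpa using hξy.add hn
  -- The local generator of the top cohomology, multiplied by a denominator `s`, comes from a global
  -- cocycle. Its cochain takes the value det · s at `v₀`, a unit modulo the ideal.
  · obtain ⟨y, hy⟩ := hc1 1
    have hyk := hy.kill h'.exact_zero h'.exact
    rw [kill_iff_killI, hspan] at hyk
    obtain ⟨s, ξ, hξ, hdξ, e⟩ := exists_cocycle_locMap (IsNoetherian.noetherian _) hyk
      (hy.cocycle h'.exact_zero h'.exact)
    refine ⟨ξ, hξ, hdξ, fun ψ hψ hψP => ?_⟩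
    have h1 := hloc ψ ξ hψ _ _ (hy.smul (algebraMap S R s)) (by
      rw [e, algebraMap_smul, sub_self, cob_iff_cobI]
      cases ℓ with
      | zero => rfl
      | succ ℓ => exact ⟨0, fun x _ => smul_zero x, map_zero _⟩) v₀
    rw [mul_one] at h1
    have h2 : IsUnit (Ideal.Quotient.mk ((kerI S A).map (algebraMap S R))
        (algebraMap S R (ψ (List.ofFn v₀)))) := by
      rw [h1]; exact hdet.mul (hunit s)
    obtain ⟨b, hb⟩ := h2.exists_right_inv
    obtain ⟨b, rfl⟩ := Ideal.Quotient.mk_surjective b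
    rw [← map_mul, ← map_one (Ideal.Quotient.mk _), Ideal.Quotient.mk_eq_mk_iff_sub_mem] at hb
    have hle : (kerI S A).map (algebraMap S R) ≤ P.map (algebraMap S R) := Ideal.map_mono hP
    have h3 : (1 : R) ∈ P.map (algebraMap S R) := by
      have := sub_mem (Ideal.mul_mem_right b _ (Ideal.mem_map_of_mem (algebraMap S R) hψP)) (hle hb)
      simpa using this
    rw [← Ideal.eq_top_iff_one] at h3
    have h4 := Localization.AtPrime.map_eq_maximalIdeal (I := P)
    exact (IsLocalRing.maximalIdeal.isMaximal R).ne_top (h4 ▸ h3)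
  · intro x
    have h1 : algebraMap S R x ∈ (Ideal.span (Set.range fun j => (v₀ j : S))).map
        (algebraMap S R) := by
      rw [hu]
      refine sum_mem fun j hj => Ideal.mul_mem_right _ _ ?_
      have hj' := Finset.mem_range.1 hj
      have := hv₀ ⟨j, hj'⟩
      refine (IsLocalization.mem_map_algebraMap_iff P.primeCompl R).2
        ⟨⟨⟨v₀ ⟨j, hj'⟩, Ideal.subset_span ⟨_, rfl⟩⟩, w ⟨j, hj'⟩⟩, this⟩
    obtain ⟨⟨a, s⟩, ha⟩ := (IsLocalization.mem_map_algebraMap_iff P.primeCompl R).1 h1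
    simp only at ha
    rw [← map_mul, IsLocalization.eq_iff_exists P.primeCompl R] at ha
    obtain ⟨s', hs'⟩ := ha
    obtain ⟨c, hc⟩ := (Ideal.mem_span_range_iff_exists_fun).1 a.2
    refine ⟨s' * s, (s' * s).2, fun j => s' * c j, ?_⟩
    ext
    simp only [Submodule.coe_smul, Submodule.coe_sum, smul_eq_mul, mul_assoc, ← Finset.mul_sum]
    rw [hc, ← hs', mul_comm (x : S)]

end Forms

section Forms

variable {S A : Type u} [CommRing S] [CommRing A] [Algebra S A]
  {Ω : Type u} [AddCommGroup Ω] [Module A Ω] [Module S Ω] [IsScalarTower S A Ω]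
  {J : ℕ → Type u} [∀ q, AddCommGroup (J q)] [∀ q, Module S (J q)]
  {dJ : ∀ q, J q →ₗ[S] J (q + 1)} {ε : S →ₗ[S] J 0} {ℓ : ℕ}

variable (dJ ε) in
/-- The form `g` represents the class of `ξ`. -/
def IsForm (q : kerI S A →ₗ[S] Ω) (ξ : J ℓ) (g : Ω [⋀^Fin ℓ]→ₗ[A] A) : Prop :=
  ∃ ψ : List (kerI S A) → S, Zig dJ ε ((↑) : kerI S A → S) ℓ (kdelta ξ) ψ ∧
    ∀ v : Fin ℓ → kerI S A, g (q ∘ v) = algebraMap S A (ψ (List.ofFn v))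

variable {q : kerI S A →ₗ[S] Ω}

lemma IsForm.add {ξ ξ' : J ℓ} {g g' : Ω [⋀^Fin ℓ]→ₗ[A] A} (h : IsForm dJ ε q ξ g)
    (h' : IsForm dJ ε q ξ' g') : IsForm dJ ε q (ξ + ξ') (g + g') := by
  obtain ⟨ψ, hψ, e⟩ := h
  obtain ⟨ψ', hψ', e'⟩ := h'
  refine ⟨ψ + ψ', ?_, fun v => ?_⟩
  · rw [kdelta_add]; exact hψ.add hψ'
  · simp [e, e']

lemma IsForm.smul {ξ : J ℓ} {g : Ω [⋀^Fin ℓ]→ₗ[A] A} (h : IsForm dJ ε q ξ g) (s : S) :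
    IsForm dJ ε q (s • ξ) (algebraMap S A s • g) := by
  obtain ⟨ψ, hψ, e⟩ := h
  refine ⟨s • ψ, ?_, fun v => ?_⟩
  · rw [kdelta_smul]; exact hψ.smul s
  · simp [e]

lemma IsForm.sub {ξ ξ' : J ℓ} {g g' : Ω [⋀^Fin ℓ]→ₗ[A] A} (h : IsForm dJ ε q ξ g)
    (h' : IsForm dJ ε q ξ' g') : IsForm dJ ε q (ξ - ξ') (g - g') := by
  have := h.add (h'.smul (-1))
  have e : g + algebraMap S A (-1) • g' = g - g' := by
    ext v; simp [sub_eq_add_neg]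
  rw [e] at this
  simpa [sub_eq_add_neg] using this

lemma IsConormal.alternating_ext (hq : IsConormal q) {M : Type*} [AddCommGroup M] [Module A M]
    {g g' : Ω [⋀^Fin ℓ]→ₗ[A] M} (h : ∀ v : Fin ℓ → kerI S A, g (q ∘ v) = g' (q ∘ v)) : g = g' := by
  ext v
  have := h (fun i => Function.surjInv hq.surjective (v i))
  have e : q ∘ (fun i => Function.surjInv hq.surjective (v i)) = v :=
    funext fun i => Function.surjInv_eq hq.surjective (v i)
  rwa [e] at this

/-- The form of a coboundary vanishes. -/
lemma IsForm.eq_zero_of_cobI (hJ : IsInjRes dJ ε) (hq : IsConormal q) {ξ : J ℓ}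
    {g : Ω [⋀^Fin ℓ]→ₗ[A] A} (h : IsForm dJ ε q ξ g) (hξ : CobI dJ (kerI S A) ℓ ξ) : g = 0 := by
  obtain ⟨ψ, hψ, e⟩ := h
  have h3 : ∃ θ : List (kerI S A) → S, ψ = kD ((↑) : kerI S A → S) θ := by
    cases ℓ with
    | zero =>
      refine Zig.of_zero hJ.exact_zero hJ.mono hJ.exact 0 ?_
      rw [show ξ = 0 from hξ] at hψ
      convert hψ using 1
      funext l
      cases l <;> rfl
    | succ ℓ =>
      obtain ⟨w, hw, e3⟩ := hξ
      rw [← e3] at hψ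
      exact Zig.of_coboundary hJ.exact_zero hJ.mono hJ.exact ℓ w (fun g : kerI S A => hw g g.2) hψ
  obtain ⟨θ, rfl⟩ := h3
  refine hq.alternating_ext fun v => ?_
  rw [e, AlternatingMap.zero_apply]
  have := kd_mem (M := S) ((↑) : kerI S A → S) (kerI S A) (fun g : kerI S A => g.2) (List.ofFn v) θ
  rw [smul_eq_mul, Ideal.mul_top] at this
  exact this

lemma IsForm.unique (hJ : IsInjRes dJ ε) (hq : IsConormal q) {ξ : J ℓ}
    {g g' : Ω [⋀^Fin ℓ]→ₗ[A] A} (h : IsForm dJ ε q ξ g) (h' : IsForm dJ ε q ξ g') : g = g' := by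
  have := h.sub h'
  rw [sub_self] at this
  refine sub_eq_zero.1 (this.eq_zero_of_cobI hJ hq ?_)
  cases ℓ with
  | zero => rfl
  | succ ℓ => exact ⟨0, fun x _ => smul_zero x, map_zero _⟩

lemma exists_zig (hJ : IsInjRes dJ ε) {ξ : J ℓ} (hξ : KillI (kerI S A) ξ) (hd : dJ ℓ ξ = 0) :
    ∃ ψ : List (kerI S A) → S, Zig dJ ε ((↑) : kerI S A → S) ℓ (kdelta ξ) ψ := by
  refine Zig.exists hJ.exact_zero hJ.exact ℓ _ (kD_kdelta _ _ fun g => hξ g g.2) ?_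
  rw [map_kdelta, hd]
  funext l
  cases l <;> rfl

/-- Two lifts of the same element of Ω differ by an element of I², and linear maps into modules
killed by I do not see it. -/
lemma IsConormal.eq_of_apply_eq {I' : Type*} [CommRing I'] [Algebra S I']
    (hI' : ∀ x ∈ kerI S A, algebraMap S I' x = 0) (hq : IsConormal q)
    (U : kerI S A →ₗ[S] (Fin ℓ → I')) {x y : kerI S A} (h : q x = q y) : U x = U y := by
  have h1 := hq.ker (x - y) (by rw [map_sub, h, sub_self])
  rw [← sub_eq_zero, ← map_sub]
  refine Submodule.smul_induction_on h1 (fun a ha z _ => ?_) (fun a b ha hb => ?_)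
  · rw [map_smul]
    funext j
    rw [Pi.smul_apply, Algebra.smul_def, hI' a ha, zero_mul]; rfl
  · rw [map_add, ha, hb, add_zero]

variable [IsNoetherianRing S]

/-- Every cocycle killed by the kernel has a form. -/
theorem exists_isForm (hJ : IsInjRes dJ ε) (hI : IsLocallyRegular (kerI S A) ℓ)
    (hq : IsConormal q) {ξ : J ℓ} (hξ : KillI (kerI S A) ξ) (hd : dJ ℓ ξ = 0) :
    ∃ g, IsForm dJ ε q ξ g := by
  obtain ⟨ψ, hψ⟩ := exists_zig hJ hξ hd
  let r : Ω → kerI S A := Function.surjInv hq.surjective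
  have hr : ∀ w, q (r w) = w := Function.surjInv_eq hq.surjective
  -- An identity in A may be checked at the primes containing the kernel, where `ψ` becomes a
  -- determinant in the coordinates `U` times a scalar. All the axioms of an alternating map on Ω
  -- are verified in this way, for an arbitrary set-theoretic section `r` of `q`.
  have key : ∀ s : S, (∀ (P : Ideal S) [P.IsPrime], kerI S A ≤ P →
      ∀ (U : kerI S A →ₗ[S] (Fin ℓ → Localization.AtPrime P ⧸
          (kerI S A).map (algebraMap S (Localization.AtPrime P))))
        (n : Localization.AtPrime P ⧸ (kerI S A).map (algebraMap S (Localization.AtPrime P))),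
        (∀ x y, q x = q y → U x = U y) →
        (∀ v, algebraMap S (Localization.AtPrime P ⧸
          (kerI S A).map (algebraMap S (Localization.AtPrime P))) (ψ (List.ofFn v)) =
            Matrix.detRowAlternating (U ∘ v) * n) →
        algebraMap S (Localization.AtPrime P ⧸
          (kerI S A).map (algebraMap S (Localization.AtPrime P))) s = 0) →
      algebraMap S A s = 0 := by
    intro s hs
    refine (RingHom.mem_ker (f := algebraMap S A)).1 (mem_of_forall_localization fun P _ hP => ?_)
    obtain ⟨U, v₀, h1, -⟩ := hJ.exists_local hI P hP
    obtain ⟨n, hn, -⟩ := h1 ξ hξ hd ψ hψ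
    rw [← Ideal.Quotient.eq_zero_iff_mem]
    refine hs P hP U n (fun x y h => hq.eq_of_apply_eq (fun a ha => ?_) U h) hn
    exact Ideal.Quotient.eq_zero_iff_mem.2 (Ideal.mem_map_of_mem _ ha)
  let g : Ω [⋀^Fin ℓ]→ₗ[A] A :=
    { toFun := fun v => algebraMap S A (ψ (List.ofFn (r ∘ v)))
      map_update_add' := fun {inst} v i x y => by
        obtain rfl : inst = instDecidableEqFin ℓ := Subsingleton.elim _ _
        rw [← sub_eq_zero, ← map_add, ← map_sub]
        refine key _ fun P _ hP U n hU hn => ?_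
        rw [map_sub, map_add, hn, hn, hn]
        simp only [Function.comp_update]
        rw [hU (r (x + y)) (r x + r y) (by simp [hr]), map_add,
          AlternatingMap.map_update_add, add_mul, sub_self]
      map_update_smul' := fun {inst} v i a x => by
        obtain rfl : inst = instDecidableEqFin ℓ := Subsingleton.elim _ _
        obtain ⟨s, rfl⟩ := hq.algebraMap_surjective a
        rw [smul_eq_mul, ← sub_eq_zero, ← map_mul, ← map_sub]
        refine key _ fun P _ hP U n hU hn => ?_
        rw [map_sub, map_mul, hn, hn]
        simp only [Function.comp_update]
        rw [hU (r (algebraMap S A s • x)) (s • r x) (by simp [hr]), map_smul,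
          ← algebraMap_smul (Localization.AtPrime P ⧸
            (kerI S A).map (algebraMap S (Localization.AtPrime P))) s (U (r x)),
          AlternatingMap.map_update_smul, smul_eq_mul, mul_assoc, sub_self]
      map_eq_zero_of_eq' := fun v i j hv hij => by
        refine key _ fun P _ hP U n hU hn => ?_
        rw [hn, AlternatingMap.map_eq_zero_of_eq _ _ (i := i) (j := j) (by simp [hv]) hij,
          zero_mul] }
  refine ⟨g, ψ, hψ, fun v => ?_⟩
  change algebraMap S A (ψ (List.ofFn (r ∘ q ∘ v))) = _
  rw [← sub_eq_zero, ← map_sub]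
  refine key _ fun P _ hP U n hU hn => ?_
  have : U ∘ r ∘ q ∘ v = U ∘ v := funext fun i => hU _ _ (hr _)
  rw [map_sub, hn, hn, this, sub_self]

/-- A cocycle whose form vanishes is a coboundary. -/
theorem IsForm.cobI (hJ : IsInjRes dJ ε) (hI : IsLocallyRegular (kerI S A) ℓ)
    {ξ : J ℓ} (hξ : KillI (kerI S A) ξ) (hd : dJ ℓ ξ = 0)
    (h : IsForm dJ ε q ξ 0) : CobI dJ (kerI S A) ℓ ξ := by
  obtain ⟨ψ, hψ, e⟩ := h
  refine cobI_of_localization hξ fun P _ hP => ?_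
  obtain ⟨U, v₀, h1, hu, -⟩ := hJ.exists_local hI P hP
  obtain ⟨n, hn, hn'⟩ := h1 ξ hξ hd ψ hψ
  -- At `v₀` the determinant is a unit while the form vanishes, so the local scalar `n` is zero.
  refine hn' (hu.mul_right_eq_zero.1 ?_)
  rw [← hn, Ideal.Quotient.eq_zero_iff_mem]
  exact Ideal.mem_map_of_mem _ ((RingHom.mem_ker (f := algebraMap S A)).2 (e v₀).symm)

/-- Over a finite family, the denominators can be cleared simultaneously. -/
lemma exists_common_denominator {P : Ideal S} [P.IsPrime] {v₀ : Fin ℓ → kerI S A}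
    (h : ∀ x : kerI S A, ∃ s ∉ P, ∃ c : Fin ℓ → S, s • x = ∑ j, c j • v₀ j)
    (v : Fin ℓ → kerI S A) :
    ∃ s ∉ P, ∃ c : Fin ℓ → Fin ℓ → S, ∀ i, s • v i = ∑ j, c i j • v₀ j := by
  choose s hs c hc using fun i => h (v i)
  refine ⟨∏ i, s i, fun hP => ?_, fun i j => (∏ l ∈ Finset.univ.erase i, s l) * c i j, fun i => ?_⟩
  · obtain ⟨i, -, hi⟩ := (Ideal.IsPrime.prod_mem_iff (hp := inferInstance)).1 hP
    exact hs i hi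
  · rw [← Finset.mul_prod_erase _ _ (Finset.mem_univ i), mul_comm, mul_smul, hc, Finset.smul_sum]
    simp only [mul_smul]

/-- Alternating maps on linear combinations of a family. -/
lemma alternating_apply_sum {R N M : Type*} [CommRing R] [AddCommGroup N] [Module R N]
    [AddCommGroup M] [Module R M] (g : N [⋀^Fin ℓ]→ₗ[R] M) (v₀ : Fin ℓ → N)
    (c : Fin ℓ → Fin ℓ → R) :
    g (fun i => ∑ j, c i j • v₀ j) = (Matrix.of c).det • g v₀ := by
  let L : (Fin ℓ → R) →ₗ[R] N := Fintype.linearCombination R v₀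
  have hL : ∀ c, L c = ∑ j, c j • v₀ j := fun c => rfl
  have : g.compLinearMap L =
      (LinearMap.toSpanSingleton R M (g v₀)).compAlternatingMap
        (Pi.basisFun R (Fin ℓ)).det := by
    refine Module.Basis.ext_alternating (Pi.basisFun R (Fin ℓ)) fun v hv => ?_
    let σ : Equiv.Perm (Fin ℓ) := Equiv.ofBijective v (Finite.injective_iff_bijective.1 hv)
    have e1 : (fun i => Pi.basisFun R (Fin ℓ) (v i)) = (fun i => Pi.basisFun R (Fin ℓ) i) ∘ σ := rfl
    rw [e1, AlternatingMap.map_perm, AlternatingMap.map_perm]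
    congr 1
    have e2 : (Pi.basisFun R (Fin ℓ)).det (fun i => Pi.basisFun R (Fin ℓ) i) = 1 :=
      Module.Basis.det_self _
    simp only [LinearMap.compAlternatingMap_apply, e2, LinearMap.toSpanSingleton_apply, one_smul,
      AlternatingMap.compLinearMap_apply]
    congr 1
    funext i
    rw [hL]
    simp [Pi.single_apply]
  have h2 := congrArg (fun f => f c) this
  simp only [AlternatingMap.compLinearMap_apply, LinearMap.compAlternatingMap_apply,
    LinearMap.toSpanSingleton_apply, Pi.basisFun_det] at h2
  exact h2

/-- Two alternating maps of top degree are proportional. -/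
theorem alternating_smul_comm (hJ : IsInjRes dJ ε) (hI : IsLocallyRegular (kerI S A) ℓ)
    (hq : IsConormal q) {M : Type u} [AddCommGroup M] [Module A M]
    (g : Ω [⋀^Fin ℓ]→ₗ[A] A) (Θ : Ω [⋀^Fin ℓ]→ₗ[A] M) (v v' : Fin ℓ → Ω) :
    g v • Θ v' = g v' • Θ v := by
  let _ : Module S M := Module.compHom M (algebraMap S A)
  have hM : ∀ (s : S) (m : M), algebraMap S A s • m = s • m := fun _ _ => rfl
  choose w hw using fun i => hq.surjective (v i)
  choose w' hw' using fun i => hq.surjective (v' i)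
  rw [← sub_eq_zero]
  set m := g v • Θ v' - g v' • Θ v with hm
  suffices LinearMap.ker (LinearMap.toSpanSingleton S M m) = ⊤ by
    have h1 : (1 : S) ∈ LinearMap.ker (LinearMap.toSpanSingleton S M m) := this ▸ trivial
    simpa using h1
  refine ideal_eq_top_of_forall (S := S) fun P hP => ?_
  by_cases hIP : kerI S A ≤ P
  · obtain ⟨U, v₀, -, -, -, hgen⟩ := hJ.exists_local hI P hIP
    obtain ⟨s, hs, c, hc⟩ := exists_common_denominator hgen w
    obtain ⟨s', hs', c', hc'⟩ := exists_common_denominator hgen w'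
    -- After multiplication by a power of the denominator, the value at any family is a determinant
    -- times the value at `v₀`. Both sides of the claim then become the same product of two
    -- determinants with `g (q ∘ v₀)` and `Θ (q ∘ v₀)`.
    have key : ∀ {N : Type u} [AddCommGroup N] [Module A N] (F : Ω [⋀^Fin ℓ]→ₗ[A] N)
        (s : S) (w : Fin ℓ → kerI S A) (v : Fin ℓ → Ω) (hw : ∀ i, q (w i) = v i)
        (c : Fin ℓ → Fin ℓ → S) (hc : ∀ i, s • w i = ∑ j, c i j • v₀ j),
        algebraMap S A s ^ ℓ • F v =
          (Matrix.of fun i j => algebraMap S A (c i j)).det • F (q ∘ v₀) := by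
      intro N _ _ F s w v hw c hc
      rw [← alternating_apply_sum]
      have : (fun i => ∑ j, algebraMap S A (c i j) • (q ∘ v₀) j) =
          fun i => algebraMap S A s • v i := by
        funext i
        have := congrArg q (hc i)
        rw [map_smul, hw, map_sum] at this
        simp only [map_smul] at this
        simp only [algebraMap_smul, Function.comp_apply]
        exact this.symm
      rw [this]
      have h3 := F.toMultilinearMap.map_smul_univ (fun _ => algebraMap S A s) v
      simpa using h3.symm
    refine ⟨(s * s') ^ ℓ, ?_, fun h => ?_⟩
    · change (s * s') ^ ℓ • m = 0
      have h1 := key g s w v hw c hc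
      have h2 := key g s' w' v' hw' c' hc'
      have h3 := key Θ s w v hw c hc
      have h4 := key Θ s' w' v' hw' c' hc'
      rw [← hM, hm, map_pow, map_mul, mul_pow, smul_sub]
      have e1 : (algebraMap S A s ^ ℓ * algebraMap S A s' ^ ℓ) • g v • Θ v' =
          (algebraMap S A s ^ ℓ • g v) • (algebraMap S A s' ^ ℓ • Θ v') := by
        simp only [smul_smul, smul_eq_mul]; congr 1; ring
      have e2 : (algebraMap S A s ^ ℓ * algebraMap S A s' ^ ℓ) • g v' • Θ v =
          (algebraMap S A s' ^ ℓ • g v') • (algebraMap S A s ^ ℓ • Θ v) := by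
        simp only [smul_smul, smul_eq_mul]; congr 1; ring
      rw [e1, e2, h1, h2, h3, h4]
      simp only [smul_smul, smul_eq_mul]
      rw [sub_eq_zero]; congr 1; ring
    · rcases hP.mem_or_mem (hP.mem_of_pow_mem _ h) with h | h
      exacts [hs h, hs' h]
  · obtain ⟨x, hx, hxP⟩ := SetLike.not_le_iff_exists.1 hIP
    refine ⟨x, ?_, hxP⟩
    change x • m = 0
    rw [← hM, (RingHom.mem_ker).1 hx, zero_smul]

/-- Every alternating map of top degree is the form of a cocycle. -/
theorem exists_isForm_eq (hJ : IsInjRes dJ ε) (hI : IsLocallyRegular (kerI S A) ℓ)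
    (hq : IsConormal q) (g : Ω [⋀^Fin ℓ]→ₗ[A] A) :
    ∃ ξ : J ℓ, KillI (kerI S A) ξ ∧ dJ ℓ ξ = 0 ∧ IsForm dJ ε q ξ g := by
  -- The scalars whose multiple of `g` is the form of a cocycle form an ideal, to be shown to be the
  -- unit ideal prime by prime.
  let K : Ideal S :=
    { carrier := {s | ∃ ξ : J ℓ, KillI (kerI S A) ξ ∧ dJ ℓ ξ = 0 ∧
        IsForm dJ ε q ξ (algebraMap S A s • g)}
      add_mem' := by
        rintro a b ⟨ξ, h1, h2, h3⟩ ⟨ξ', h1', h2', h3'⟩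
        refine ⟨ξ + ξ', h1.add h1', by rw [map_add, h2, h2', add_zero], ?_⟩
        rw [map_add, add_smul]
        exact h3.add h3'
      zero_mem' := by
        obtain ⟨g', hg'⟩ := exists_isForm hJ hI hq (ξ := (0 : J ℓ)) (fun x _ => smul_zero x)
          (map_zero _)
        refine ⟨0, fun x _ => smul_zero x, map_zero _, ?_⟩
        simpa using hg'.smul 0
      smul_mem' := by
        rintro c a ⟨ξ, h1, h2, h3⟩
        refine ⟨c • ξ, h1.smul c, by rw [map_smul, h2, smul_zero], ?_⟩
        rw [smul_eq_mul, map_mul, mul_smul]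
        exact h3.smul c }
  have hK : K = ⊤ := by
    refine ideal_eq_top_of_forall fun P hP => ?_
    by_cases hIP : kerI S A ≤ P
    · obtain ⟨U, v₀, -, -, ⟨ξ, h1, h2, h3⟩, -⟩ := hJ.exists_local hI P hIP
      obtain ⟨g', hg'⟩ := exists_isForm hJ hI hq h1 h2
      obtain ⟨ψ, hψ, e⟩ := id hg'
      refine ⟨ψ (List.ofFn v₀), ?_, h3 ψ hψ⟩
      obtain ⟨s, hs⟩ := hq.algebraMap_surjective (g (q ∘ v₀))
      refine ⟨s • ξ, h1.smul s, by rw [map_smul, h2, smul_zero], ?_⟩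
      -- Proportionality of top forms: `ψ (List.ofFn v₀)` represents the value of `g'` at `q ∘ v₀`,
      -- and `s` the value of `g` there.
      have : algebraMap S A (ψ (List.ofFn v₀)) • g = algebraMap S A s • g' := by
        ext v
        rw [← e, hs]
        exact (alternating_smul_comm hJ hI hq g' g _ _).trans (mul_comm _ _)
      rw [this]
      exact hg'.smul s
    · obtain ⟨x, hx, hxP⟩ := SetLike.not_le_iff_exists.1 hIP
      refine ⟨x, ?_, hxP⟩
      obtain ⟨ξ, h⟩ := K.zero_mem
      refine ⟨ξ, ?_⟩
      rw [(RingHom.mem_ker).1 hx]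
      simpa using h
  have h1 : (1 : S) ∈ K := hK ▸ trivial
  obtain ⟨ξ, h⟩ := h1
  exact ⟨ξ, by simpa using h⟩

/-- If every alternating map of top degree is a multiple of `g`, then the linear map on the top
exterior power defined by `g` is bijective. -/
theorem bijective_of_forall_eq_smul (hJ : IsInjRes dJ ε) (hI : IsLocallyRegular (kerI S A) ℓ)
    (hq : IsConormal q) (g : Ω [⋀^Fin ℓ]→ₗ[A] A) (hg : ∀ g' : Ω [⋀^Fin ℓ]→ₗ[A] A, ∃ a : A, g' = a • g) :
    Function.Bijective (exteriorPower.alternatingMapLinearEquiv (R := A) g) := by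
  set G := exteriorPower.alternatingMapLinearEquiv (R := A) g with hG
  have hGv : ∀ v, G (exteriorPower.ιMulti A ℓ v) = g v := fun v =>
    exteriorPower.alternatingMapLinearEquiv_apply_ιMulti _ _
  have hsurj : Function.Surjective G := by
    rw [← LinearMap.range_eq_top]
    -- At each prime some form `g'` takes a value outside the prime, and `g'` is a multiple of `g`;
    -- so the range of `G` is contained in no prime.
    have : Ideal.comap (algebraMap S A) (LinearMap.range G : Ideal A) = ⊤ := by
      refine ideal_eq_top_of_forall fun P hP => ?_
      by_cases hIP : kerI S A ≤ P
      · obtain ⟨U, v₀, -, -, ⟨ξ, h1, h2, h3⟩, -⟩ := hJ.exists_local hI P hIP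
        obtain ⟨g', hg'⟩ := exists_isForm hJ hI hq h1 h2
        obtain ⟨ψ, hψ, e⟩ := hg'
        refine ⟨ψ (List.ofFn v₀), ?_, h3 ψ hψ⟩
        obtain ⟨a, rfl⟩ := hg g'
        refine ⟨a • exteriorPower.ιMulti A ℓ (q ∘ v₀), ?_⟩
        rw [map_smul, hGv, ← e]; rfl
      · obtain ⟨x, hx, hxP⟩ := SetLike.not_le_iff_exists.1 hIP
        refine ⟨x, ?_, hxP⟩
        rw [Ideal.mem_comap, (RingHom.mem_ker).1 hx]
        exact zero_mem _
    exact Ideal.comap_eq_top_iff.1 this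
  refine ⟨?_, hsurj⟩
  -- In rank one `G w • w'` is symmetric in `w` and `w'`. Taking `w'` with `G w' = 1` shows that `G
  -- w = 0` forces `w = 0`.
  have hcomm : ∀ w w', G w • w' = G w' • w := by
    have h1 : ∀ w v, G w • exteriorPower.ιMulti A ℓ v = g v • w := by
      intro w v
      have : G.smulRight (exteriorPower.ιMulti A ℓ v) = g v • LinearMap.id := by
        apply exteriorPower.linearMap_ext
        ext v' : 1
        change G (exteriorPower.ιMulti A ℓ v') • exteriorPower.ιMulti A ℓ v =
          g v • exteriorPower.ιMulti A ℓ v'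
        rw [hGv]
        exact alternating_smul_comm hJ hI hq g (exteriorPower.ιMulti A ℓ) v' v
      exact LinearMap.congr_fun this w
    intro w w'
    have : G w • LinearMap.id = G.smulRight w := by
      apply exteriorPower.linearMap_ext
      ext v' : 1
      change G w • exteriorPower.ιMulti A ℓ v' = G (exteriorPower.ιMulti A ℓ v') • w
      rw [hGv]
      exact h1 w v'
    exact LinearMap.congr_fun this w'
  rw [injective_iff_map_eq_zero]
  intro w hw
  obtain ⟨w', hw'⟩ := hsurj 1
  have := hcomm w w'
  rw [hw, hw', zero_smul, one_smul] at this
  exact this.symm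

omit [IsNoetherianRing S] in
/-- The behaviour of forms under operators compatible with a derivation of `S`. -/
theorem IsForm.lie {ξ : J ℓ} {g : Ω [⋀^Fin ℓ]→ₗ[A] A} (hg : IsForm dJ ε q ξ g)
    (X : S →+ S)  (XI : kerI S A → kerI S A) (hXI : ∀ x, (XI x : S) = X x) (h : ∀ q, J q →+ J q)
    (hh : ∀ q s m, h q (s • m) = s • h q m + X s • m) (hd : ∀ q m, dJ q (h q m) = h (q + 1) (dJ q m))
    (hε : ∀ n, ε (X n) = h 0 (ε n)) (Y : A → A) (hY : ∀ s, Y (algebraMap S A s) = algebraMap S A (X s))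
    (g' : Ω [⋀^Fin ℓ]→ₗ[A] A) (hg' : ∀ v : Fin ℓ → kerI S A, g' (q ∘ v) = Y (g (q ∘ v)) -
      ∑ i, g (q ∘ Function.update v i (XI (v i)))) :
    IsForm dJ ε q (h ℓ ξ) g' := by
  obtain ⟨ψ, hψ, e⟩ := hg
  refine ⟨fun l => kl XI X l ψ, ?_, fun v => ?_⟩
  · have := hψ.lie XI X hXI h hh hd X hε
    rwa [kl_kdelta] at this
  · change _ = algebraMap S A (kl XI X (List.ofFn v) ψ)
    rw [hg', kl_ofFn, e, hY, map_sub, map_sum]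
    simp only [e]

end Forms

/-! ### The Poincaré-Birkhoff-Witt theorem for `U(A)` in local coordinates -/

section Monomials

variable {n : ℕ}

/-- `i` is at most every element of the multiset `m`. -/
def LeM (i : Fin n) (m : Multiset (Fin n)) : Prop := ∀ l ∈ m, i ≤ l

/-- Splitting off the smallest index; the result is a single pair so that one choice provides both
parts in `Coord.val`. -/
lemma exists_min_cons {m : Multiset (Fin n)} (hm : m ≠ 0) : ∃ p : Fin n × Multiset (Fin n),
    m = p.1 ::ₘ p.2 ∧ LeM p.1 p.2 := by
  obtain ⟨a, ha⟩ := Multiset.exists_mem_of_ne_zero hm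
  have hne : m.toFinset.Nonempty := ⟨a, by simpa using ha⟩
  refine ⟨⟨m.toFinset.min' hne, m.erase (m.toFinset.min' hne)⟩, ?_, fun l hl => ?_⟩
  · exact (Multiset.cons_erase (by simpa using m.toFinset.min'_mem hne)).symm
  · exact Finset.min'_le _ _ (by simpa using Multiset.mem_of_mem_erase hl)

/-- Uniqueness of this splitting, by which the choice made in `Coord.val` is harmless. -/
lemma LeM.cons_inj {i j : Fin n} {m m' : Multiset (Fin n)} (h : LeM i m) (h' : LeM j m')
    (e : i ::ₘ m = j ::ₘ m') : i = j ∧ m = m' := by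
  have hij : i = j := by
    apply le_antisymm
    · have : j ∈ i ::ₘ m := e ▸ Multiset.mem_cons_self j m'
      rcases Multiset.mem_cons.1 this with rfl | h1
      exacts [le_rfl, h j h1]
    · have : i ∈ j ::ₘ m' := e ▸ Multiset.mem_cons_self i m
      rcases Multiset.mem_cons.1 this with rfl | h1
      exacts [le_rfl, h' i h1]
  subst hij
  exact ⟨rfl, (Multiset.cons_inj_right i).1 e⟩

end Monomials

section PBW

variable {k A B : Type u} [Field k] [CommRing A] [Algebra k A] [PoissonAlgebra k A]
  [CommRing B] [Algebra k B] [Algebra A B] [IsScalarTower k A B] {n : ℕ}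

variable (k A B n) in
/-- Coordinates of a Poisson algebra `A` over an `A`-algebra `B` to which the Hamiltonian
derivations extend. -/
structure Coord where
  x : Fin n → A
  dl : Fin n → Derivation k A B
  X : A →ₗ[k] Derivation k B B
  X_algebraMap (a b : A) : X a (algebraMap A B b) = algebraMap A B (pb k A a b)
  X_mul (a b : A) (c : B) : X (a * b) c = algebraMap A B a * X b c + algebraMap A B b * X a c
  X_pb (a b : A) (c : B) : X (pb k A a b) c = X a (X b c) - X b (X a c)
  dl_x (i j : Fin n) : dl i (x j) = if i = j then 1 else 0
  ext (W : Type u) [AddCommGroup W] [Module k W] [Module A W] [Module B W] [IsScalarTower A B W]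
    [IsScalarTower k A W] (δ : Derivation k A W) (a : A) : δ a = ∑ i, dl i a • δ (x i)

/-- The free `B`-module on monomials. -/
abbrev Mon (B : Type u) [CommRing B] (n : ℕ) : Type u := Multiset (Fin n) →₀ B

/-- The elements of degree at most `d`. -/
abbrev Mon.deg (B : Type u) [CommRing B] (n d : ℕ) : Submodule B (Mon B n) :=
  Finsupp.supported B B {m | m.card ≤ d}

lemma Mon.single_mem_deg {m : Multiset (Fin n)} {d : ℕ} (h : m.card ≤ d) (b : B) :
    Finsupp.single m b ∈ Mon.deg B n d :=
  Finsupp.single_mem_supported B b h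

lemma Mon.deg_mono {d e : ℕ} (h : d ≤ e) : Mon.deg B n d ≤ Mon.deg B n e :=
  Finsupp.supported_mono fun m (hm : m.card ≤ d) => le_trans hm h

/-- Induction on elements of bounded degree. -/
lemma Mon.deg_induction {d : ℕ} {P : Mon B n → Prop} (h0 : P 0)
    (hadd : ∀ v w, P v → P w → P (v + w))
    (hs : ∀ m : Multiset (Fin n), m.card ≤ d → ∀ b : B, P (Finsupp.single m b))
    {v : Mon B n} (hv : v ∈ Mon.deg B n d) : P v := by
  rw [← Finsupp.sum_single v]
  refine Finset.sum_induction _ P hadd h0 fun m hm => hs m ?_ _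
  exact (Finsupp.mem_supported B v).1 hv hm

namespace Coord

variable (C : Coord k A B n)

/-- The operator with values `F i m` on monomials, that satisfies the Leibniz rule. -/
def op (F : Fin n → Multiset (Fin n) → Mon B n) (i : Fin n) : Mon B n →+ Mon B n :=
  Finsupp.liftAddHom fun m =>
    { toFun := fun b => b • F i m + Finsupp.single m (C.X (C.x i) b)
      map_zero' := by simp
      map_add' := fun b c => by
        rw [add_smul, map_add, Finsupp.single_add]; abel }

lemma op_single (F : Fin n → Multiset (Fin n) → Mon B n) (i : Fin n) (m : Multiset (Fin n))
    (b : B) : C.op F i (Finsupp.single m b) =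
      b • F i m + Finsupp.single m (C.X (C.x i) b) := by
  simp [op]

lemma op_smul (F : Fin n → Multiset (Fin n) → Mon B n) (i : Fin n) (b : B) (v : Mon B n) :
    C.op F i (b • v) = b • C.op F i v + C.X (C.x i) b • v := by
  induction v using Finsupp.induction_linear with
  | zero => simp
  | add v w hv hw => rw [smul_add, map_add, hv, hw, map_add, smul_add, smul_add]; abel
  | single m c =>
    rw [Finsupp.smul_single, op_single, op_single, smul_eq_mul, Derivation.leibniz,
      Finsupp.single_add, smul_add, mul_smul, Finsupp.smul_single, Finsupp.smul_single, smul_eq_mul,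
      smul_eq_mul, smul_eq_mul, mul_comm c]
    abel

open Classical in
/-- The values of the operators on monomials, by recursion on the degree `d`. -/
def val : ℕ → Fin n → Multiset (Fin n) → Mon B n
  | 0, i, m => Finsupp.single (i ::ₘ m) 1
  | d + 1, i, m =>
    if h : LeM i m then Finsupp.single (i ::ₘ m) 1 else
      let p := (exists_min_cons (m := m) fun h0 => h (by simp [h0, LeM])).choose
      -- The straightening rule H_i H_j = H_j H_i + H_{{x_i, x_j}} for j = `p.1` minimal and below
      -- `i`. The leading term of H_i on `p.2` gives the first monomial; H_j is applied recursively
      -- to the rest only, whose degree is smaller.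
      Finsupp.single (i ::ₘ m) 1 + C.op (val d) p.1 (val d i p.2 - Finsupp.single (i ::ₘ p.2) 1)
        + ∑ l, C.dl l (pb k A (C.x i) (C.x p.1)) • val d l p.2

lemma val_of_le (d : ℕ) {i : Fin n} {m : Multiset (Fin n)} (h : LeM i m) :
    C.val d i m = Finsupp.single (i ::ₘ m) 1 := by
  cases d with
  | zero => rfl
  | succ d => rw [val, dif_pos h]

lemma val_cons (d : ℕ) {i j : Fin n} {m : Multiset (Fin n)} (h : LeM j m) (hij : j < i) :
    C.val (d + 1) i (j ::ₘ m) = Finsupp.single (i ::ₘ j ::ₘ m) 1 +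
      C.op (C.val d) j (C.val d i m - Finsupp.single (i ::ₘ m) 1)
        + ∑ l, C.dl l (pb k A (C.x i) (C.x j)) • C.val d l m := by
  have h' : ¬ LeM i (j ::ₘ m) := fun hh => not_lt_of_ge (hh j (Multiset.mem_cons_self j m)) hij
  have hne : j ::ₘ m ≠ 0 := Multiset.cons_ne_zero
  rw [val, dif_neg h']
  obtain ⟨e, he⟩ := (exists_min_cons hne).choose_spec
  obtain ⟨h1, h2⟩ := h.cons_inj he e
  simp only
  rw [← h1, ← h2]

lemma op_mem_deg {F : Fin n → Multiset (Fin n) → Mon B n} {d : ℕ} (i : Fin n)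
    (hF : ∀ m, m.card ≤ d → F i m ∈ Mon.deg B n (d + 1)) {v : Mon B n} (hv : v ∈ Mon.deg B n d) :
    C.op F i v ∈ Mon.deg B n (d + 1) := by
  refine Mon.deg_induction (P := fun v => C.op F i v ∈ Mon.deg B n (d + 1)) ?_ ?_ ?_ hv
  · rw [map_zero]; exact zero_mem _
  · intro v w hv hw
    rw [map_add]; exact add_mem hv hw
  · intro m hm b
    rw [op_single]
    exact add_mem (Submodule.smul_mem _ _ (hF m hm)) (Mon.single_mem_deg (by omega) _)

lemma op_congr {F F' : Fin n → Multiset (Fin n) → Mon B n} {d : ℕ} (i : Fin n)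
    (hF : ∀ m, m.card ≤ d → F i m = F' i m) {v : Mon B n} (hv : v ∈ Mon.deg B n d) :
    C.op F i v = C.op F' i v := by
  refine Mon.deg_induction (P := fun v => C.op F i v = C.op F' i v) ?_ ?_ ?_ hv
  · rw [map_zero, map_zero]
  · intro v w hv hw
    rw [map_add, map_add, hv, hw]
  · intro m hm b
    rw [op_single, op_single, hF m hm]

/-- The leading term of H_i on a monomial is the product monomial. This keeps the straightening
recursion within its degree bound. -/
lemma val_sub_mem (d : ℕ) (i : Fin n) (m : Multiset (Fin n)) (h : m.card ≤ d) :
    C.val d i m - Finsupp.single (i ::ₘ m) 1 ∈ Mon.deg B n m.card := by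
  induction d generalizing i m with
  | zero => rw [val, sub_self]; exact zero_mem _
  | succ d ih =>
    by_cases hi : LeM i m
    · rw [C.val_of_le _ hi, sub_self]; exact zero_mem _
    · obtain ⟨⟨j, m'⟩, rfl, hj⟩ := exists_min_cons (m := m) fun h0 => hi (by simp [h0, LeM])
      simp only at hj hi h ⊢
      have hij : j < i := by
        by_contra hji
        refine hi fun l hl => ?_
        rcases Multiset.mem_cons.1 hl with rfl | hl
        · exact not_lt.1 hji
        · exact (not_lt.1 hji).trans (hj l hl)
      rw [C.val_cons d hj hij, add_assoc, add_sub_cancel_left]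
      rw [Multiset.card_cons] at h ⊢
      have hm' : m'.card ≤ d := by omega
      have key : ∀ l m'', m''.card ≤ m'.card → C.val d l m'' ∈ Mon.deg B n (m'.card + 1) := by
        intro l m'' hm''
        have := add_mem (Mon.deg_mono (by omega : m''.card ≤ m'.card + 1)
          (ih l m'' (by omega)))
          (Mon.single_mem_deg (m := l ::ₘ m'') (d := m'.card + 1) (by simp; omega) (1 : B))
        simpa using this
      refine add_mem (C.op_mem_deg j (key j) (ih i m' hm')) ?_
      exact sum_mem fun l _ => Submodule.smul_mem _ _ (key l m' le_rfl)

/-- The parameter `d` of `val` is only a recursion depth: beyond the degree of the monomial the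
value is stable. -/
lemma val_succ (d : ℕ) (i : Fin n) (m : Multiset (Fin n)) (h : m.card ≤ d) :
    C.val (d + 1) i m = C.val d i m := by
  induction d generalizing i m with
  | zero =>
    obtain rfl : m = 0 := Multiset.card_eq_zero.1 (by omega)
    have : LeM i 0 := by simp [LeM]
    rw [C.val_of_le _ this, C.val_of_le _ this]
  | succ d ih =>
    by_cases hi : LeM i m
    · rw [C.val_of_le _ hi, C.val_of_le _ hi]
    · obtain ⟨⟨j, m'⟩, rfl, hj⟩ := exists_min_cons (m := m) fun h0 => hi (by simp [h0, LeM])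
      simp only at hj hi h ⊢
      have hij : j < i := by
        by_contra hji
        refine hi fun l hl => ?_
        rcases Multiset.mem_cons.1 hl with rfl | hl
        · exact not_lt.1 hji
        · exact (not_lt.1 hji).trans (hj l hl)
      rw [Multiset.card_cons] at h
      have hm' : m'.card ≤ d := by omega
      rw [C.val_cons _ hj hij, C.val_cons _ hj hij, ih i m' hm']
      rw [C.op_congr j (F := C.val (d + 1)) (F' := C.val d) (fun m'' hm'' => ih j m'' hm'')
        (Mon.deg_mono hm' (C.val_sub_mem d i m' hm'))]
      simp only [ih _ m' hm']

lemma val_eq (d : ℕ) (i : Fin n) (m : Multiset (Fin n)) (h : m.card ≤ d) :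
    C.val d i m = C.val m.card i m := by
  induction d, h using Nat.le_induction with
  | base => rfl
  | succ d hd ih => rw [C.val_succ d i m hd, ih]

/-- The operator by which `H_x` acts on monomials, for a coordinate `x`. -/
def E (i : Fin n) : Mon B n →+ Mon B n := C.op (fun i m => C.val m.card i m) i

lemma E_single_one (i : Fin n) (m : Multiset (Fin n)) :
    C.E i (Finsupp.single m 1) = C.val m.card i m := by
  rw [E, op_single, one_smul, Derivation.map_one_eq_zero, Finsupp.single_zero, add_zero]

lemma E_smul (i : Fin n) (b : B) (v : Mon B n) :
    C.E i (b • v) = b • C.E i v + C.X (C.x i) b • v := C.op_smul _ i b v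

lemma E_of_le {i : Fin n} {m : Multiset (Fin n)} (h : LeM i m) :
    C.E i (Finsupp.single m 1) = Finsupp.single (i ::ₘ m) 1 := by
  rw [E_single_one, C.val_of_le _ h]

lemma E_sub_mem (i : Fin n) (m : Multiset (Fin n)) :
    C.E i (Finsupp.single m 1) - Finsupp.single (i ::ₘ m) 1 ∈ Mon.deg B n m.card := by
  rw [E_single_one]
  exact C.val_sub_mem _ i m le_rfl

/-- The operator by which `H_a` acts on monomials. -/
def T (a : A) (v : Mon B n) : Mon B n := ∑ l, C.dl l a • C.E l v

/-- The recursion for `val`, with the recursion depth eliminated, is the commutation relation on a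
monomial whose smallest index is the second one. -/
lemma E_cons {i j : Fin n} {m : Multiset (Fin n)} (h : LeM j m) (hij : j < i) :
    C.E i (Finsupp.single (j ::ₘ m) 1) = C.E j (C.E i (Finsupp.single m 1)) +
      C.T (pb k A (C.x i) (C.x j)) (Finsupp.single m 1) := by
  have h' : LeM j (i ::ₘ m) := fun l hl => by
    rcases Multiset.mem_cons.1 hl with rfl | hl
    exacts [hij.le, h l hl]
  have e : C.E j (C.E i (Finsupp.single m 1)) =
      C.E j (C.E i (Finsupp.single m 1) - Finsupp.single (i ::ₘ m) 1) +
        Finsupp.single (i ::ₘ j ::ₘ m) 1 := by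
    rw [map_sub, C.E_of_le h', Multiset.cons_swap, sub_add_cancel]
  rw [e, E_single_one, E_single_one, Multiset.card_cons, C.val_cons _ h hij]
  have e2 : C.E j (C.val m.card i m - Finsupp.single (i ::ₘ m) 1) =
      C.op (C.val m.card) j (C.val m.card i m - Finsupp.single (i ::ₘ m) 1) := by
    refine C.op_congr j (d := m.card) (fun m'' hm'' => (C.val_eq _ j m'' hm'').symm) ?_
    exact C.val_sub_mem _ i m le_rfl
  rw [e2, T]
  simp only [E_single_one]
  abel

lemma T_x (i : Fin n) (v : Mon B n) : C.T (C.x i) v = C.E i v := by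
  rw [T, Finset.sum_eq_single i]
  · rw [C.dl_x, if_pos rfl, one_smul]
  · intro l _ hl
    rw [C.dl_x, if_neg hl, zero_smul]
  · intro h; exact absurd (Finset.mem_univ i) h

lemma T_add (a : A) (v w : Mon B n) : C.T a (v + w) = C.T a v + C.T a w := by
  simp only [T, map_add, smul_add, Finset.sum_add_distrib]

lemma T_zero (a : A) : C.T a 0 = 0 := by
  simp [T]

lemma T_add_left (a b : A) (v : Mon B n) : C.T (a + b) v = C.T a v + C.T b v := by
  simp only [T, map_add, add_smul, Finset.sum_add_distrib]

lemma T_neg_left (a : A) (v : Mon B n) : C.T (-a) v = -C.T a v := by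
  simp only [T, map_neg, neg_smul, Finset.sum_neg_distrib]

lemma T_smul_left (c : k) (a : A) (v : Mon B n) : C.T (c • a) v = c • C.T a v := by
  simp only [T, Finset.smul_sum]
  exact Finset.sum_congr rfl fun l _ => by rw [(C.dl l).map_smul, smul_assoc]

lemma T_mul (a b : A) (v : Mon B n) :
    C.T (a * b) v = a • C.T b v + b • C.T a v := by
  simp only [T, Finset.smul_sum, ← Finset.sum_add_distrib]
  exact Finset.sum_congr rfl fun l _ => by
    rw [Derivation.leibniz, add_smul, smul_assoc, smul_assoc]

/-- Both sides are derivations in `a`, and the coordinates determine derivations out of A. -/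
lemma X_eq (a : A) (b : B) : C.X a b = ∑ i, C.dl i a * C.X (C.x i) b := by
  let δ : Derivation k A B := Derivation.mk'
    { toFun := fun a => C.X a b
      map_add' := fun a a' => by rw [map_add]; rfl
      map_smul' := fun c a => by rw [map_smul]; rfl }
    fun a a' => by
      change C.X (a * a') b = a • C.X a' b + a' • C.X a b
      rw [C.X_mul, Algebra.smul_def, Algebra.smul_def]
  exact C.ext B δ a

lemma T_smul (a : A) (b : B) (v : Mon B n) : C.T a (b • v) = b • C.T a v + C.X a b • v := by
  simp only [T, E_smul, smul_add, Finset.sum_add_distrib]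
  rw [C.X_eq a b, Finset.sum_smul, Finset.smul_sum]
  congr 1
  · exact Finset.sum_congr rfl fun l _ => smul_comm _ _ _
  · exact Finset.sum_congr rfl fun l _ => (mul_smul _ _ _).symm

lemma T_smul' (a b : A) (v : Mon B n) :
    C.T a (b • v) = b • C.T a v + pb k A a b • v := by
  rw [← algebraMap_smul B b v, T_smul, C.X_algebraMap, algebraMap_smul, algebraMap_smul]

/-- The defect of the commutation relations. -/
def defect (a b : A) (v : Mon B n) : Mon B n :=
  C.T a (C.T b v) - C.T b (C.T a v) - C.T (pb k A a b) v

lemma defect_swap (a b : A) (v : Mon B n) : C.defect b a v = -C.defect a b v := by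
  rw [defect, defect, pb_skew k b a, T_neg_left]
  abel

lemma defect_smul (a b : A) (c : B) (v : Mon B n) :
    C.defect a b (c • v) = c • C.defect a b v := by
  simp only [defect, T_smul, T_add, C.X_pb, smul_sub, sub_smul]
  abel

lemma defect_add (a b : A) (v w : Mon B n) :
    C.defect a b (v + w) = C.defect a b v + C.defect a b w := by
  simp only [defect, T_add]
  abel

/-- The second-order terms cancel, so the defect is a derivation in `a`. Being also skew, and
B-linear in `v`, it needs to be computed only for pairs of coordinates and monomials. -/
lemma defect_eq_sum (a b : A) (v : Mon B n) :
    C.defect a b v = ∑ i, C.dl i a • C.defect (C.x i) b v := by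
  let δ : Derivation k A (Mon B n) := Derivation.mk'
    { toFun := fun a => C.defect a b v
      map_add' := fun a a' => by
        have : pb k A (a + a') b = pb k A a b + pb k A a' b := by simp [pb]
        simp only [defect, T_add_left, T_add, this]
        abel
      map_smul' := fun c a => by
        have : pb k A (c • a) b = c • pb k A a b := by simp [pb]
        have h2 : C.T b (c • C.T a v) = c • C.T b (C.T a v) := by
          rw [← algebraMap_smul B c (C.T a v), T_smul, Derivation.map_algebraMap, zero_smul,
            add_zero, algebraMap_smul]
        simp only [defect, T_smul_left, this, h2, smul_sub, RingHom.id_apply] }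
    fun a a' => by
      change C.defect (a * a') b v = a • C.defect a' b v + a' • C.defect a b v
      simp only [defect, T_mul, T_add, T_smul', pb_mul_left, T_add_left, smul_sub]
      rw [pb_skew k b a, pb_skew k b a', neg_smul, neg_smul]
      abel
  exact C.ext (Mon B n) δ a

lemma defect_eq_zero_of_x {v : Mon B n} (h : ∀ i j, C.defect (C.x i) (C.x j) v = 0) (a b : A) :
    C.defect a b v = 0 := by
  have h1 : ∀ i a, C.defect (C.x i) a v = 0 := fun i a => by
    rw [defect_swap, defect_eq_sum, Finset.sum_eq_zero, neg_zero]
    intro j _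
    rw [h, smul_zero]
  rw [defect_eq_sum]
  exact Finset.sum_eq_zero fun i _ => by rw [h1, smul_zero]

lemma defect_eq_zero_of_deg {d : ℕ}
    (h : ∀ (m : Multiset (Fin n)) i j, m.card ≤ d →
      C.defect (C.x i) (C.x j) (Finsupp.single m 1) = 0) {v : Mon B n} (hv : v ∈ Mon.deg B n d)
    (a b : A) : C.defect a b v = 0 := by
  refine Mon.deg_induction (P := fun v => C.defect a b v = 0) ?_ ?_ ?_ hv
  · simp [defect, T_zero]
  · intro v w hv hw
    rw [defect_add, hv, hw, add_zero]
  · intro m hm b'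
    rw [← mul_one b', ← smul_eq_mul, ← Finsupp.smul_single, defect_smul,
      C.defect_eq_zero_of_x (fun i j => h m i j hm), smul_zero]

variable [CharZero k]

lemma pb_self (a : A) : pb k A a a = 0 := by
  have h := pb_skew k a a
  have h2 : (2 : k) • pb k A a a = 0 := by
    rw [two_smul]
    nth_rewrite 1 [h]
    exact neg_add_cancel _
  exact (smul_eq_zero.1 h2).resolve_left two_ne_zero

lemma T_zero_left (v : Mon B n) : C.T 0 v = 0 := by
  simp [T]

/-- The commutation relation for a pair of coordinates, one of which is minimal. -/
lemma defect_of_le {i j : Fin n} {m : Multiset (Fin n)} (h : LeM j m) (hij : j ≤ i) :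
    C.defect (C.x i) (C.x j) (Finsupp.single m 1) = 0 := by
  rcases hij.eq_or_lt with rfl | hij
  · rw [defect, sub_self, pb_self, T_zero_left, sub_zero]
  · rw [defect, T_x, T_x, T_x, T_x, C.E_of_le h, C.E_cons h hij]
    abel

/-- The consistency check of the straightening rule. If an index r of the monomial lies below both
`i` and `j`, pull H_r out in front: the commutator of H_i and H_j applied to H_r u then reduces, by
the Jacobi identity and induction on the degree, to the commutator on u. -/
lemma defect_single_one (d : ℕ) (m : Multiset (Fin n)) (i j : Fin n) (hm : m.card ≤ d) :
    C.defect (C.x i) (C.x j) (Finsupp.single m 1) = 0 := by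
  induction d generalizing m i j with
  | zero =>
    obtain rfl : m = 0 := Multiset.card_eq_zero.1 (by omega)
    have h0 : ∀ l : Fin n, LeM l 0 := by simp [LeM]
    rcases le_total i j with h | h
    · rw [defect_swap, C.defect_of_le (h0 _) h, neg_zero]
    · exact C.defect_of_le (h0 _) h
  | succ d ih =>
    wlog hij : j ≤ i generalizing i j
    · rw [defect_swap, this j i (not_le.1 hij).le, neg_zero]
    by_cases hj : LeM j m
    · exact C.defect_of_le hj hij
    obtain ⟨⟨r, m'⟩, rfl, hr⟩ := exists_min_cons (m := m) fun h0 => hj (by simp [h0, LeM])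
    simp only at hr hj hm ⊢
    have hrj : r < j := by
      by_contra hjr
      refine hj fun l hl => ?_
      rcases Multiset.mem_cons.1 hl with rfl | hl
      · exact not_lt.1 hjr
      · exact (not_lt.1 hjr).trans (hr l hl)
    rw [Multiset.card_cons] at hm
    have hm' : m'.card ≤ d := by omega
    have IH : ∀ a b : A, ∀ v ∈ Mon.deg B n d, C.T a (C.T b v) = C.T b (C.T a v) +
        C.T (pb k A a b) v := fun a b v hv => by
      have := C.defect_eq_zero_of_deg (fun m i j hm => ih m i j hm) hv a b
      rw [defect, sub_sub, sub_eq_zero] at this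
      exact this
    set u : Mon B n := Finsupp.single m' 1 with hu
    have hud : u ∈ Mon.deg B n d := Mon.single_mem_deg hm' 1
    have e : Finsupp.single (r ::ₘ m') (1 : B) = C.T (C.x r) u := by
      rw [T_x, C.E_of_le hr]
    -- H_j u is the monomial `j ::ₘ m'` plus terms of degree at most that of `m'`. The former has no
    -- index below `r`, so `defect_of_le` applies; the latter is covered by induction.
    have h1 : ∀ i j, r < i → r < j → C.T (C.x i) (C.T (C.x r) (C.T (C.x j) u)) =
        C.T (C.x r) (C.T (C.x i) (C.T (C.x j) u)) +
          C.T (pb k A (C.x i) (C.x r)) (C.T (C.x j) u) := by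
      intro i j hi hj
      have h2 : C.defect (C.x i) (C.x r) (C.T (C.x j) u) = 0 := by
        rw [T_x, ← sub_add_cancel (C.E j u) (Finsupp.single (j ::ₘ m') 1), defect_add,
          C.defect_of_le _ hi.le, add_zero]
        · exact C.defect_eq_zero_of_deg (fun m i j hm => ih m i j (hm.trans hm'))
            (C.E_sub_mem j m') _ _
        · intro l hl
          rcases Multiset.mem_cons.1 hl with rfl | hl
          exacts [hj.le, hr l hl]
      rw [defect, sub_sub, sub_eq_zero] at h2
      exact h2
    have key : ∀ i j, r < i → r < j → C.T (C.x i) (C.T (C.x j) (C.T (C.x r) u)) =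
        C.T (C.x r) (C.T (C.x i) (C.T (C.x j) u)) +
          C.T (pb k A (C.x i) (C.x r)) (C.T (C.x j) u) +
          (C.T (pb k A (C.x j) (C.x r)) (C.T (C.x i) u) +
            C.T (pb k A (C.x i) (pb k A (C.x j) (C.x r))) u) := by
      intro i j hi hj
      rw [IH _ (C.x r) u hud, T_add, h1 i j hi hj,
        IH (C.x i) (pb k A (C.x j) (C.x r)) u hud]
    have hri := hrj.trans_le hij
    rw [e, defect, key i j hri hrj, key j i hrj hri, IH _ (C.x r) u hud, pb_pb, sub_eq_add_neg
      (pb k A _ _) (pb k A _ _), T_add_left, T_neg_left, IH (C.x i) (C.x j) u hud, T_add]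
    abel

theorem T_pb (a b : A) (v : Mon B n) :
    C.T (pb k A a b) v = C.T a (C.T b v) - C.T b (C.T a v) := by
  have hv : v ∈ Mon.deg B n (v.support.sup Multiset.card) :=
    (Finsupp.mem_supported B v).2 fun m hm => Finset.le_sup (f := Multiset.card) hm
  have := C.defect_eq_zero_of_deg (fun m i j hm => C.defect_single_one _ m i j hm) hv a b
  rw [defect, sub_eq_zero] at this
  exact this.symm

/-- The operators `C.T a`, as a linear map. -/
def TL : A →ₗ[k] Module.End k (Mon B n) where
  toFun a :=
    { toFun := C.T a
      map_add' := C.T_add a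
      map_smul' := fun c v => by
        rw [← algebraMap_smul B c v, T_smul, Derivation.map_algebraMap, zero_smul,
          add_zero, algebraMap_smul]; rfl }
  map_add' a b := LinearMap.ext fun v => C.T_add_left a b v
  map_smul' c a := LinearMap.ext fun v => C.T_smul_left c a v

/-- The representation of `U(A)` on monomials. -/
def rep : UEnv k A →ₐ[k] Module.End k (Mon B n) :=
  UEnv.lift (B := Module.End k (Mon B n))
    (Algebra.lsmul (A := A) k k (Mon B n)).toLinearMap C.TL
    (fun a b => map_mul (Algebra.lsmul (A := A) k k (Mon B n)) a b)
    (fun a b => LinearMap.ext fun v => C.T_pb a b v)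
    (fun a b => LinearMap.ext fun v => C.T_mul a b v)
    (fun a b => LinearMap.ext fun v => by
      change pb k A a b • v = C.T a (b • v) - b • C.T a v
      rw [T_smul', add_sub_cancel_left])
    (map_one (Algebra.lsmul (A := A) k k (Mon B n)))

lemma rep_M (a : A) (v : Mon B n) : C.rep (UEnv.M k A a) v = a • v := by
  exact LinearMap.congr_fun (UEnv.lift_M (B := Module.End k (Mon B n)) _ _ _ _ _ _ _ a) v

lemma rep_H (a : A) (v : Mon B n) : C.rep (UEnv.H k A a) v = C.T a v := by
  exact LinearMap.congr_fun (UEnv.lift_H (B := Module.End k (Mon B n)) _ _ _ _ _ _ _ a) v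

end Coord
end PBW

/-! ### Flatness of `U(A)` -/

section

variable (k A : Type u) [Field k] [CommRing A] [Algebra k A] [PoissonAlgebra k A]

/-- `a ↦ M_a` as an algebra homomorphism. -/
def UEnv.MA : A →ₐ[k] UEnv k A where
  toFun := UEnv.M k A
  map_one' := UEnv.M_one k A
  map_mul' := UEnv.M_mul k A
  map_zero' := by
    have h : preM k A (0 : A) = 0 := map_zero (TensorAlgebra.ι k)
    rw [UEnv.M, h, map_zero]
  map_add' a b := by rw [UEnv.M, preM_add, map_add]; rfl
  commutes' c := by
    rw [Algebra.algebraMap_eq_smul_one, UEnv.M, preM_smul, map_smul]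
    change c • UEnv.M k A 1 = _
    rw [UEnv.M_one, Algebra.algebraMap_eq_smul_one]

/-- `U(A)` as an `A`-module by left multiplication. -/
@[reducible] def UEnv.moduleLeft : Module A (UEnv k A) :=
  Module.compHom (UEnv k A) (UEnv.MA k A).toRingHom

variable {k A} in
lemma UEnv.H_add (a b : A) : UEnv.H k A (a + b) = UEnv.H k A a + UEnv.H k A b := by
  rw [UEnv.H, preH_add, map_add]; rfl

variable {k A} in
lemma UEnv.H_smul (c : k) (a : A) : UEnv.H k A (c • a) = c • UEnv.H k A a := by
  rw [UEnv.H, preH_smul, map_smul]; rfl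

end

namespace Coord

variable {k A B : Type u} [Field k] [CommRing A] [Algebra k A] [PoissonAlgebra k A]
  [CommRing B] [Algebra k B] [Algebra A B] [IsScalarTower k A B] {n : ℕ}

attribute [local instance] UEnv.moduleLeft

lemma M_smul_eq (a : A) (u : UEnv k A) : a • u = UEnv.M k A a * u := rfl

variable (C : Coord k A B n)

/-- The operator `H_a` on `B ⊗ U(A)`. -/
def HW (a : A) : B ⊗[A] UEnv k A →+ B ⊗[A] UEnv k A :=
  TensorProduct.liftAddHom
    { toFun := fun b =>
        { toFun := fun u => C.X a b ⊗ₜ u + b ⊗ₜ (UEnv.H k A a * u)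
          map_zero' := by simp
          map_add' := fun u u' => by rw [mul_add, tmul_add, tmul_add]; abel }
      map_zero' := by ext; simp
      map_add' := fun b b' => by
        ext u
        change C.X a (b + b') ⊗ₜ u + (b + b') ⊗ₜ (UEnv.H k A a * u) =
          (C.X a b ⊗ₜ u + b ⊗ₜ (UEnv.H k A a * u)) + (C.X a b' ⊗ₜ u + b' ⊗ₜ (UEnv.H k A a * u))
        rw [map_add, add_tmul, add_tmul]; abel }
    fun r b u => by
      change C.X a (r • b) ⊗ₜ u + (r • b) ⊗ₜ (UEnv.H k A a * u) =
        C.X a b ⊗ₜ (r • u) + b ⊗ₜ (UEnv.H k A a * (r • u))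
      have h1 : UEnv.H k A a * (r • u) = r • (UEnv.H k A a * u) + pb k A a r • u := by
        simp only [M_smul_eq, ← mul_assoc, UEnv.M_pb, sub_mul]
        abel
      rw [h1, tmul_add, ← smul_tmul, ← smul_tmul, ← smul_tmul, Algebra.smul_def r b,
        Derivation.leibniz, C.X_algebraMap, add_tmul, smul_eq_mul, smul_eq_mul, Algebra.smul_def,
        Algebra.smul_def, mul_comm b]
      abel

lemma HW_tmul (a : A) (b : B) (u : UEnv k A) :
    C.HW a (b ⊗ₜ u) = C.X a b ⊗ₜ u + b ⊗ₜ (UEnv.H k A a * u) := rfl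

lemma HW_smul (a : A) (b : B) (w : B ⊗[A] UEnv k A) :
    C.HW a (b • w) = b • C.HW a w + C.X a b • w := by
  induction w with
  | zero => simp
  | add w w' h h' => rw [smul_add, map_add, h, h', map_add, smul_add, smul_add]; abel
  | tmul c u =>
    rw [TensorProduct.smul_tmul', HW_tmul, HW_tmul, smul_eq_mul, Derivation.leibniz, add_tmul,
      smul_add, TensorProduct.smul_tmul', TensorProduct.smul_tmul', TensorProduct.smul_tmul',
      smul_eq_mul, smul_eq_mul, smul_eq_mul, smul_eq_mul, mul_comm c]
    abel

lemma HW_pb (a b : A) (w : B ⊗[A] UEnv k A) :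
    C.HW (pb k A a b) w = C.HW a (C.HW b w) - C.HW b (C.HW a w) := by
  induction w with
  | zero => simp
  | add w w' h h' => simp only [map_add, h, h']; abel
  | tmul c u =>
    simp only [HW_tmul, map_add, C.X_pb, UEnv.H_pb, sub_tmul, sub_mul, tmul_sub, mul_assoc]
    abel

/-- The operator on B ⊗ U(A) is again a derivation in `a`, hence determined by the coordinates just
like `T`. -/
lemma HW_eq_sum (a : A) (w : B ⊗[A] UEnv k A) : C.HW a w = ∑ i, C.dl i a • C.HW (C.x i) w := by
  let δ : Derivation k A (B ⊗[A] UEnv k A) := Derivation.mk'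
    { toFun := fun a => C.HW a w
      map_add' := fun a a' => by
        induction w with
        | zero => simp
        | add w w' h h' => simp only [map_add, h, h']; abel
        | tmul c u =>
          simp only [HW_tmul, map_add, Derivation.add_apply, UEnv.H_add, add_mul, add_tmul,
            tmul_add]
          abel
      map_smul' := fun c a => by
        induction w with
        | zero => simp
        | add w w' h h' => simp only [map_add, h, h', smul_add]
        | tmul b u =>
          have e : b ⊗ₜ[A] (c • (UEnv.H k A a * u)) = c • (b ⊗ₜ[A] (UEnv.H k A a * u)) := by
            have h1 : c • (UEnv.H k A a * u) = algebraMap k A c • (UEnv.H k A a * u) := by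
              rw [M_smul_eq]
              change _ = UEnv.MA k A (algebraMap k A c) * _
              rw [AlgHom.commutes, Algebra.smul_def]
            rw [h1, ← smul_tmul, algebraMap_smul, TensorProduct.smul_tmul']
          rw [HW_tmul, map_smul, UEnv.H_smul, smul_mul_assoc, e, HW_tmul, smul_add]; rfl }
    fun a a' => by
      change C.HW (a * a') w = a • C.HW a' w + a' • C.HW a w
      induction w with
      | zero => simp
      | add w w' h h' => simp only [map_add, h, h', smul_add]; abel
      | tmul b u =>
        rw [HW_tmul, HW_tmul, HW_tmul, C.X_mul, UEnv.H_mul, add_mul, tmul_add, add_tmul, mul_assoc,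
          mul_assoc, ← M_smul_eq, ← M_smul_eq, smul_add, smul_add, TensorProduct.smul_tmul',
          TensorProduct.smul_tmul', ← Algebra.smul_def, ← Algebra.smul_def, ← smul_tmul,
          ← smul_tmul, TensorProduct.smul_tmul', TensorProduct.smul_tmul']
        abel
  exact C.ext _ δ a

/-- Ordered monomials in `U(A)`. -/
def mono (m : Multiset (Fin n)) : UEnv k A :=
  ((m.sort (· ≤ ·)).map fun i => UEnv.H k A (C.x i)).prod

lemma mono_zero : C.mono 0 = 1 := by simp [mono]

lemma mono_cons {i : Fin n} {m : Multiset (Fin n)} (h : LeM i m) :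
    C.mono (i ::ₘ m) = UEnv.H k A (C.x i) * C.mono m := by
  rw [mono, Multiset.sort_cons _ _ _ h, List.map_cons, List.prod_cons]; rfl

/-- Monomials as elements of `B ⊗ U(A)`. -/
def γ : Mon B n →ₗ[B] B ⊗[A] UEnv k A :=
  Finsupp.linearCombination B fun m => (1 : B) ⊗ₜ[A] C.mono m

lemma γ_single_one (m : Multiset (Fin n)) :
    C.γ (Finsupp.single m 1) = (1 : B) ⊗ₜ[A] C.mono m := by
  rw [γ, Finsupp.linearCombination_single, one_smul]

lemma γ_E_of_le {i : Fin n} {m : Multiset (Fin n)} (h : LeM i m) :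
    C.γ (C.E i (Finsupp.single m 1)) = C.HW (C.x i) (C.γ (Finsupp.single m 1)) := by
  rw [C.E_of_le h, γ_single_one, γ_single_one, HW_tmul, Derivation.map_one_eq_zero, zero_tmul,
    zero_add, mono_cons C h]

lemma γ_E_deg {d : ℕ} {i : Fin n}
    (h : ∀ m : Multiset (Fin n), m.card ≤ d →
      C.γ (C.E i (Finsupp.single m 1)) = C.HW (C.x i) (C.γ (Finsupp.single m 1))) {v : Mon B n}
    (hv : v ∈ Mon.deg B n d) : C.γ (C.E i v) = C.HW (C.x i) (C.γ v) := by
  refine Mon.deg_induction (P := fun v => C.γ (C.E i v) = C.HW (C.x i) (C.γ v)) ?_ ?_ ?_ hv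
  · simp
  · intro v w hv hw
    simp only [map_add, hv, hw]
  · intro m hm b
    rw [← mul_one b, ← smul_eq_mul, ← Finsupp.smul_single, E_smul, map_add, map_smul, map_smul,
      h m hm, map_smul, HW_smul]

lemma γ_T {v : Mon B n} (h : ∀ i, C.γ (C.E i v) = C.HW (C.x i) (C.γ v)) (a : A) :
    C.γ (C.T a v) = C.HW a (C.γ v) := by
  rw [T, map_sum, HW_eq_sum]
  exact Finset.sum_congr rfl fun i _ => by rw [map_smul, h]

/-- Straightening is a consequence of the relations of U(A): moving H_i past the smallest index uses
on both sides the same commutation rule, available on B ⊗ U(A) by `HW_pb`. -/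
lemma γ_E_single (d : ℕ) (m : Multiset (Fin n)) (i : Fin n) (hm : m.card ≤ d) :
    C.γ (C.E i (Finsupp.single m 1)) = C.HW (C.x i) (C.γ (Finsupp.single m 1)) := by
  induction d generalizing m i with
  | zero =>
    obtain rfl : m = 0 := Multiset.card_eq_zero.1 (by omega)
    exact C.γ_E_of_le (by simp [LeM])
  | succ d ih =>
    by_cases hi : LeM i m
    · exact C.γ_E_of_le hi
    obtain ⟨⟨j, m'⟩, rfl, hj⟩ := exists_min_cons (m := m) fun h0 => hi (by simp [h0, LeM])
    simp only at hi hj hm ⊢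
    have hij : j < i := by
      by_contra hji
      refine hi fun l hl => ?_
      rcases Multiset.mem_cons.1 hl with rfl | hl
      · exact not_lt.1 hji
      · exact (not_lt.1 hji).trans (hj l hl)
    have hj' : LeM j (i ::ₘ m') := fun l hl => by
      rcases Multiset.mem_cons.1 hl with rfl | hl
      exacts [hij.le, hj l hl]
    rw [Multiset.card_cons] at hm
    have hm' : m'.card ≤ d := by omega
    have h1 : C.γ (C.E j (C.E i (Finsupp.single m' 1))) =
        C.HW (C.x j) (C.γ (C.E i (Finsupp.single m' 1))) := by
      rw [← sub_add_cancel (C.E i (Finsupp.single m' 1)) (Finsupp.single (i ::ₘ m') 1), map_add,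
        map_add, map_add, map_add, C.γ_E_of_le hj',
        C.γ_E_deg (fun m hm => ih m j (hm.trans hm')) (C.E_sub_mem i m')]
    rw [C.E_cons hj hij, map_add, h1, C.γ_T (fun l => ih m' l hm'), ih m' i hm', HW_pb,
      ← C.E_of_le hj, ih m' j hm']
    abel

lemma γ_T' (a : A) (v : Mon B n) : C.γ (C.T a v) = C.HW a (C.γ v) := by
  have hv : v ∈ Mon.deg B n (v.support.sup Multiset.card) :=
    (Finsupp.mem_supported B v).2 fun m hm => Finset.le_sup (f := Multiset.card) hm
  exact C.γ_T (fun i => C.γ_E_deg (fun m hm => C.γ_E_single _ m i hm) hv) a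

variable [CharZero k]

/-- Applied to the empty monomial, this gives γ ∘ β = id. The general `u'` is what makes the
induction pass through products. -/
lemma γ_rep (u : UEnv k A) : ∀ (v : Mon B n) (u' : UEnv k A), C.γ v = (1 : B) ⊗ₜ[A] u' →
    C.γ (C.rep u v) = (1 : B) ⊗ₜ[A] (u * u') := by
  induction u using UEnv.induction with
  | hk c =>
    intro v u' h
    have h1 : algebraMap k (UEnv k A) c * u' = algebraMap k A c • u' := by
      rw [M_smul_eq]
      change _ = UEnv.MA k A (algebraMap k A c) * _
      rw [AlgHom.commutes]
    rw [AlgHom.commutes, Module.algebraMap_end_apply, h1, ← algebraMap_smul B c v, map_smul, h,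
      ← smul_tmul, algebraMap_smul, algebraMap_smul, TensorProduct.smul_tmul']
  | hM a =>
    intro v u' h
    rw [rep_M, ← algebraMap_smul B a v, map_smul, h, ← M_smul_eq, ← smul_tmul, algebraMap_smul,
      TensorProduct.smul_tmul']
  | hH a =>
    intro v u' h
    rw [rep_H, γ_T', h, HW_tmul, Derivation.map_one_eq_zero, zero_tmul, zero_add]
  | hadd x y hx hy =>
    intro v u' h
    rw [map_add, LinearMap.add_apply, map_add, hx v u' h, hy v u' h, add_mul, tmul_add]
  | hmul x y hx hy =>
    intro v u' h
    rw [map_mul, Module.End.mul_apply, hx _ _ (hy v u' h), mul_assoc]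

/-- `b ⊗ u ↦ b u · 1`. -/
def β : B ⊗[A] UEnv k A →ₗ[B] Mon B n :=
  TensorProduct.AlgebraTensorModule.lift
    { toFun := fun b =>
        { toFun := fun u => b • C.rep u (Finsupp.single 0 1)
          map_add' := fun u u' => by rw [map_add, LinearMap.add_apply, smul_add]
          map_smul' := fun a u => by
            rw [M_smul_eq, map_mul, Module.End.mul_apply, rep_M, smul_comm]; rfl }
      map_add' := fun b b' => LinearMap.ext fun u => add_smul _ _ _
      map_smul' := fun c b => LinearMap.ext fun u => mul_smul _ _ _ }

lemma β_tmul (b : B) (u : UEnv k A) : C.β (b ⊗ₜ u) = b • C.rep u (Finsupp.single 0 1) := rfl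

/-- An ordered monomial of U(A) acts on the empty monomial without any straightening. This gives β ∘
γ = id, that is, linear independence in the Poincaré-Birkhoff-Witt theorem. -/
lemma rep_mono (d : ℕ) (m : Multiset (Fin n)) (hm : m.card ≤ d) :
    C.rep (C.mono m) (Finsupp.single 0 1) = Finsupp.single m 1 := by
  induction d generalizing m with
  | zero =>
    obtain rfl : m = 0 := Multiset.card_eq_zero.1 (by omega)
    rw [mono_zero, map_one]; rfl
  | succ d ih =>
    by_cases h0 : m = 0
    · subst h0
      rw [mono_zero, map_one]; rfl
    obtain ⟨⟨j, m'⟩, rfl, hj⟩ := exists_min_cons h0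
    simp only at hj hm ⊢
    rw [Multiset.card_cons] at hm
    rw [mono_cons C hj, map_mul, Module.End.mul_apply, ih m' (by omega), rep_H, T_x,
      C.E_of_le hj]

/-- The Poincaré-Birkhoff-Witt theorem: `B ⊗ U(A)` is a free `B`-module. -/
def pbw : B ⊗[A] UEnv k A ≃ₗ[B] Mon B n :=
  LinearEquiv.ofLinearMap C.β C.γ
    (by
      ext m : 2
      change C.β (C.γ (Finsupp.single m 1)) = Finsupp.single m 1
      rw [γ_single_one, β_tmul, one_smul, C.rep_mono _ m le_rfl])
    (by
      ext u
      change C.γ (C.β (1 ⊗ₜ u)) = 1 ⊗ₜ u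
      rw [β_tmul, one_smul, C.γ_rep u _ 1 (by rw [γ_single_one, mono_zero]), mul_one])

end Coord

/-! ### Local coordinates on a smooth Poisson algebra -/

section Existence

variable {k A : Type u} [Field k] [CommRing A] [Algebra k A] [PoissonAlgebra k A]

lemma Derivation_eq_of_localization {B : Type u} [CommRing B] [Algebra k B] [Algebra A B]
    (M : Submonoid A) [IsLocalization M B] {δ δ' : Derivation k B B}
    (h : ∀ a, δ (algebraMap A B a) = δ' (algebraMap A B a)) : δ = δ' := by
  ext b
  obtain ⟨⟨a, s⟩, e⟩ := IsLocalization.surj M b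
  simp only at e
  have h1 := congrArg (fun x => δ x - δ' x) e
  simp only [Derivation.leibniz, h, smul_eq_mul] at h1
  have h2 : algebraMap A B s * (δ b - δ' b) = 0 := by linear_combination h1
  exact sub_eq_zero.1 ((IsLocalization.map_units B s).mul_right_eq_zero.1 h2)

/-- The extension of the Hamiltonian derivations to a localization. -/
lemma exists_ham_extension (B : Type u) [CommRing B] [Algebra k B] [Algebra A B]
    [IsScalarTower k A B] (M : Submonoid A) [IsLocalization M B] (a : A) :
    ∃ X : Derivation k B B, ∀ b, X (algebraMap A B b) = algebraMap A B (pb k A a b) := by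
  have : Algebra.FormallyEtale A B := Algebra.FormallyEtale.of_isLocalization M
  let δ : Derivation k A B := (Algebra.linearMap A B).compDer (ham k A a)
  let L : B ⊗[A] Ω[A⁄k] →ₗ[B] B := δ.liftKaehlerDifferential.liftBaseChange B
  let e := KaehlerDifferential.tensorKaehlerEquivOfFormallyEtale k A B
  refine ⟨(L.comp e.symm.toLinearMap).compDer (KaehlerDifferential.D k B), fun b => ?_⟩
  have h1 : e.symm (KaehlerDifferential.D k B (algebraMap A B b)) =
      1 ⊗ₜ KaehlerDifferential.D k A b := by
    rw [LinearEquiv.symm_apply_eq]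
    change _ = KaehlerDifferential.mapBaseChange k A B (1 ⊗ₜ KaehlerDifferential.D k A b)
    rw [KaehlerDifferential.mapBaseChange_tmul, KaehlerDifferential.map_D, one_smul]
  change L (e.symm (KaehlerDifferential.D k B (algebraMap A B b))) = _
  rw [h1]
  simp [L, δ, ham]

open KaehlerDifferential in
/-- Coordinates exist at every prime of a smooth algebra. -/
theorem exists_coord [Algebra.Smooth k A] (P : Ideal A) [P.IsPrime] :
    ∃ n, Nonempty (Coord k A (Localization.AtPrime P) n) := by
  let B := Localization.AtPrime P
  have hspan : Submodule.span B (Set.range fun a : A => (1 : B) ⊗ₜ[A] D k A a) = ⊤ := by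
    rw [eq_top_iff]
    rintro w -
    induction w with
    | zero => exact zero_mem _
    | add w w' h h' => exact add_mem h h'
    | tmul b ω =>
      have hω : ω ∈ Submodule.span A (Set.range (D k A)) := by
        rw [span_range_derivation]; trivial
      rw [← mul_one b, ← smul_eq_mul, ← TensorProduct.smul_tmul']
      refine Submodule.smul_mem _ _ ?_
      induction hω using Submodule.span_induction with
      | mem x hx => obtain ⟨a, rfl⟩ := hx; exact Submodule.subset_span ⟨a, rfl⟩
      | zero => rw [tmul_zero]; exact zero_mem _
      | add x y _ _ hx hy => rw [tmul_add]; exact add_mem hx hy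
      | smul a x _ hx =>
        rw [tmul_smul, ← algebraMap_smul B a]
        exact Submodule.smul_mem _ _ hx
  have : Module.FinitePresentation B (B ⊗[A] Ω[A⁄k]) :=
    Module.finitePresentation_of_projective B _
  -- Over a local ring a basis of a finitely presented flat module can be extracted from any
  -- spanning family; here from the differentials of elements of A, so the coordinates lie in A
  -- itself.
  obtain ⟨κ, x₀, b₀, hb₀⟩ := Module.exists_basis_of_span_of_flat _ hspan
  have : Finite κ := Module.Finite.finite_basis b₀
  let n := Nat.card κ
  let f : κ ≃ Fin n := Finite.equivFin κ
  let b := b₀.reindex f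
  let x : Fin n → A := fun i => x₀ (f.symm i)
  have hb : ∀ i, b i = 1 ⊗ₜ D k A (x i) := fun i => by
    rw [Module.Basis.reindex_apply, hb₀]
  choose X hX using exists_ham_extension (k := k) (A := A) B P.primeCompl
  have hext : ∀ δ δ' : Derivation k B B,
      (∀ a, δ (algebraMap A B a) = δ' (algebraMap A B a)) → δ = δ' := fun δ δ' h =>
    Derivation_eq_of_localization P.primeCompl h
  let dl : Fin n → Derivation k A B := fun i =>
    Derivation.mk' ((b.coord i).restrictScalars k ∘ₗ
        (((TensorProduct.mk A B Ω[A⁄k] 1).restrictScalars k) ∘ₗ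
          (D k A : A →ₗ[k] Ω[A⁄k]))) fun a a' => by
      change b.coord i (1 ⊗ₜ D k A (a * a')) = a • b.coord i (1 ⊗ₜ D k A a') +
        a' • b.coord i (1 ⊗ₜ D k A a)
      rw [Derivation.leibniz, tmul_add, tmul_smul, tmul_smul, map_add, ← algebraMap_smul B a,
        ← algebraMap_smul B a', map_smul, map_smul, algebraMap_smul, algebraMap_smul]
  have hdl : ∀ i a, dl i a = b.repr (1 ⊗ₜ D k A a) i := fun i a => rfl
  refine ⟨n, ⟨⟨x, dl, ⟨⟨X, fun a a' => ?_⟩, fun c a => ?_⟩, hX, fun a a' c => ?_,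
    fun a a' c => ?_, fun i j => ?_, ?_⟩⟩⟩
  · refine hext _ _ fun c => ?_
    rw [Derivation.add_apply, hX, hX, hX, ← map_add]; simp [pb]
  · refine hext _ _ fun c' => ?_
    rw [RingHom.id_apply, Derivation.smul_apply, hX, hX]
    have h1 : pb k A (c • a) c' = c • pb k A a c' := by simp [pb]
    rw [h1]
    exact map_smul (IsScalarTower.toAlgHom k A B) c _
  · have : X (a * a') = algebraMap A B a • X a' + algebraMap A B a' • X a := hext _ _ fun c => by
      rw [Derivation.add_apply, Derivation.smul_apply, Derivation.smul_apply, hX, hX, hX,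
        pb_mul_left, map_add, map_mul, map_mul]; rfl
    exact congrArg (· c) this
  · have : X (pb k A a a') = ⁅X a, X a'⁆ := hext _ _ fun c => by
      rw [Derivation.commutator_apply, hX, hX, hX, hX, hX, pb_pb, map_sub]
    change X (pb k A a a') c = _
    rw [this, Derivation.commutator_apply]; rfl
  · rw [hdl, ← hb, Module.Basis.repr_self, Finsupp.single_apply]
    simp only [eq_comm]
  · intro W _ _ _ _ _ _ δ a
    let L : B ⊗[A] Ω[A⁄k] →ₗ[B] W := δ.liftKaehlerDifferential.liftBaseChange B
    have hL : ∀ a, L (1 ⊗ₜ D k A a) = δ a := fun a => by simp [L]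
    rw [← hL, ← b.sum_repr (1 ⊗ₜ D k A a), map_sum]
    exact Finset.sum_congr rfl fun i _ => by rw [map_smul, hb, hL, hdl]

attribute [local instance] UEnv.moduleLeft in
/-- The enveloping algebra of a smooth Poisson algebra is flat. -/
theorem flat_UEnv [CharZero k] [Algebra.Smooth k A] : Module.Flat A (UEnv k A) := by
  refine Module.flat_of_localized_maximal _ fun P _ => ?_
  obtain ⟨n, ⟨C⟩⟩ := exists_coord (k := k) P
  let B := Localization.AtPrime P
  -- The localization of U(A) at the prime is B ⊗ U(A), free over B on the monomials.
  have : Module.Free B (B ⊗[A] UEnv k A) := Module.Free.of_equiv C.pbw.symm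
  have : Module.Flat A (B ⊗[A] UEnv k A) := Module.Flat.trans A B _
  exact Module.Flat.of_linearEquiv ((IsLocalizedModule.isBaseChange P.primeCompl B
    (LocalizedModule.mkLinearMap P.primeCompl (UEnv k A))).equiv.restrictScalars A).symm

end Existence

/-! ### Restriction of injective Poisson bimodules -/

/-- The exterior tensor product of flat modules is flat. -/
theorem flat_of_exterior_tensor {k A B M N Z : Type u} [CommRing k] [CommRing A] [Algebra k A]
    [CommRing B] [Algebra k B] [AddCommGroup M] [Module k M] [Module A M] [IsScalarTower k A M]
    [AddCommGroup N] [Module k N] [Module B N] [IsScalarTower k B N]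
    [AddCommGroup Z] [Module k Z] [Module (A ⊗[k] B) Z] [IsScalarTower k (A ⊗[k] B) Z]
    (e : M ⊗[k] N ≃ₗ[k] Z)
    (he : ∀ a b m n, e ((a • m) ⊗ₜ (b • n)) = (a ⊗ₜ[k] b : A ⊗[k] B) • e (m ⊗ₜ n))
    [Module.Flat A M] [Module.Flat B N] : Module.Flat (A ⊗[k] B) Z := by
  let S := A ⊗[k] B
  let _ : Algebra B S := Algebra.TensorProduct.rightAlgebra
  let _ : Module A Z := Module.compHom Z (algebraMap A S)
  let _ : Module B Z := Module.compHom Z (algebraMap B S)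
  have hA : ∀ (a : A) (z : Z), a • z = (a ⊗ₜ[k] (1 : B) : S) • z := fun _ _ => rfl
  have hB : ∀ (b : B) (z : Z), b • z = ((1 : A) ⊗ₜ[k] b : S) • z := fun _ _ => rfl
  have hBS : ∀ (b : B) (s : S), b • s = ((1 : A) ⊗ₜ[k] b : S) * s := fun b s =>
    Algebra.smul_def b s
  have : IsScalarTower A S Z := ⟨fun a s z => by
    rw [Algebra.smul_def, mul_smul]; rfl⟩
  have : IsScalarTower B S Z := ⟨fun b s z => by
    rw [hBS, mul_smul]; rfl⟩
  have : SMulCommClass A S Z := ⟨fun a s z => by rw [hA, hA, smul_comm]⟩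
  have : SMulCommClass A B Z := ⟨fun a b z => by rw [hA, hA, smul_comm]⟩
  have : SMulCommClass B S Z := ⟨fun b s z => by rw [hB, hB, smul_comm]⟩
  let φ₁ : N →ₗ[B] M →ₗ[A] Z :=
    { toFun := fun n =>
        { toFun := fun m => e (m ⊗ₜ n)
          map_add' := fun m m' => by rw [add_tmul, map_add]
          map_smul' := fun a m => by
            have := he a 1 m n
            rw [one_smul] at this
            exact this }
      map_add' := fun n n' => LinearMap.ext fun m => by
        change e (m ⊗ₜ (n + n')) = e (m ⊗ₜ n) + e (m ⊗ₜ n')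
        rw [tmul_add, map_add]
      map_smul' := fun b n => LinearMap.ext fun m => by
        have := he 1 b m n
        rw [one_smul] at this
        exact this }
  let φ₂ : S →ₗ[S] N →ₗ[B] M →ₗ[A] Z :=
    { toFun := fun s =>
        { toFun := fun n => s • φ₁ n
          map_add' := fun n n' => by rw [map_add, smul_add]
          map_smul' := fun b n => by rw [map_smul, smul_comm]; rfl }
      map_add' := fun s s' => LinearMap.ext fun n => add_smul _ _ _
      map_smul' := fun s s' => LinearMap.ext fun n => mul_smul _ _ _ }
  -- M ⊗ N is obtained from S by the base changes S ⊗_B N and (S ⊗_B N) ⊗_A M, each of which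
  -- preserves flatness.
  let φ : (S ⊗[B] N) ⊗[A] M →ₗ[S] Z :=
    TensorProduct.AlgebraTensorModule.lift (TensorProduct.AlgebraTensorModule.lift φ₂)
  have hφ : ∀ s n m, φ ((s ⊗ₜ n) ⊗ₜ m) = s • e (m ⊗ₜ n) := fun _ _ _ => rfl
  let _ : Module k (S ⊗[B] N) := Module.compHom _ (algebraMap k S)
  let ψ₀ : M ⊗[k] N →+ (S ⊗[B] N) ⊗[A] M := TensorProduct.liftAddHom
    { toFun := fun m =>
        { toFun := fun n => ((1 : S) ⊗ₜ[B] n) ⊗ₜ[A] m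
          map_zero' := by simp
          map_add' := fun n n' => by rw [tmul_add, add_tmul] }
      map_zero' := by ext; simp
      map_add' := fun m m' => by ext n; exact tmul_add _ _ _ }
    fun c m n => by
      change ((1 : S) ⊗ₜ[B] n) ⊗ₜ[A] (c • m) = ((1 : S) ⊗ₜ[B] (c • n)) ⊗ₜ[A] m
      rw [← algebraMap_smul A c m, ← algebraMap_smul B c n, ← smul_tmul, ← smul_tmul,
        TensorProduct.smul_tmul', hBS, Algebra.smul_def]
      rw [mul_one, mul_one]
      congr 2
      exact Algebra.TensorProduct.tmul_one_eq_one_tmul c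
  have hψ : ∀ m n, ψ₀ (m ⊗ₜ n) = ((1 : S) ⊗ₜ[B] n) ⊗ₜ[A] m := fun _ _ => rfl
  have h1 : ∀ x, ψ₀ (e.symm (φ x)) = x := by
    intro x
    induction x with
    | zero => simp
    | add x y hx hy => rw [map_add, map_add, map_add, hx, hy]
    | tmul y m =>
      induction y with
      | zero => simp
      | add x y hx hy => rw [add_tmul, map_add, map_add, map_add, hx, hy]
      | tmul s n =>
        rw [hφ]
        induction s using TensorProduct.induction_on with
        | zero => rw [zero_smul, map_zero, map_zero, zero_tmul, zero_tmul]
        | add s s' h h' => rw [add_smul, map_add, map_add, h, h', add_tmul, add_tmul]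
        | tmul a b =>
          rw [← he, LinearEquiv.symm_apply_apply, hψ, ← smul_tmul, ← smul_tmul,
            TensorProduct.smul_tmul', hBS, Algebra.smul_def, mul_one]
          congr 2
          exact (Algebra.TensorProduct.tmul_mul_tmul a 1 (1 : B) b).trans (by rw [mul_one, one_mul])
  have h2 : ∀ z, φ (ψ₀ (e.symm z)) = z := by
    intro z
    obtain ⟨y, rfl⟩ := e.surjective z
    rw [LinearEquiv.symm_apply_apply]
    induction y with
    | zero => simp
    | add x y hx hy => rw [map_add, map_add, map_add, hx, hy]
    | tmul m n => rw [hψ, hφ, one_smul]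
  let Φ : (S ⊗[B] N) ⊗[A] M ≃ₗ[S] Z :=
    { φ with
      invFun := fun z => ψ₀ (e.symm z)
      left_inv := h1
      right_inv := h2 }
  exact Module.Flat.of_linearEquiv Φ.symm

/-- Flatness can be transported along isomorphisms of rings. -/
lemma flat_of_ringEquiv {A B N N' : Type u} [CommRing A] [CommRing B] [AddCommGroup N] [Module A N]
    [AddCommGroup N'] [Module B N'] (f : A ≃+* B) (e : N ≃+ N')
    (h : ∀ (a : A) (n : N), e (a • n) = f a • e n) [Module.Flat A N] : Module.Flat B N' := by
  let _ : Algebra A B := f.toRingHom.toAlgebra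
  let _ : Module A N' := Module.compHom N' f.toRingHom
  have : IsScalarTower A B N' := ⟨fun a b n => by rw [Algebra.smul_def, mul_smul]; rfl⟩
  let e' : N →ₗ[A] N' := { e with map_smul' := h }
  refine Module.Flat.isBaseChange A B N N' (f := e')
    (IsBaseChange.iff_lift_unique.2 fun Q _ _ _ _ g => ?_)
  refine ⟨{ toFun := fun n => g (e.symm n), map_add' := fun n n' => by simp,
            map_smul' := fun b n => ?_ },
    by ext n; exact congrArg g (e.symm_apply_apply n), fun g' hg' => ?_⟩
  · obtain ⟨a, rfl⟩ := f.surjective b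
    obtain ⟨n, rfl⟩ := e.surjective n
    rw [← h, e.symm_apply_apply, e.symm_apply_apply, map_smul, RingHom.id_apply]
    exact (algebraMap_smul B a (g n)).symm
  · ext n
    obtain ⟨n, rfl⟩ := e.surjective n
    exact (LinearMap.congr_fun hg' n).trans (congrArg g (e.symm_apply_apply n)).symm

/-- Injective modules remain injective under restriction along `S → R` if `R` is a flat
right `S`-module. -/
theorem injective_restrict {R S N : Type u} [Ring R] [CommRing S] (φ : S →+* R) [AddCommGroup N]
    [Module R N] [Module S N] (hN : ∀ (s : S) (n : N), s • n = φ s • n) [Module S R]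
    (hR : ∀ (s : S) (r : R), s • r = r * φ s) [Module.Flat S R] [Module.Injective R N] :
    Module.Injective S N where
  out X Y _ _ _ _ f hf g := by
    have : SMulCommClass S R R := ⟨fun s r z => by
      rw [hR, hR, smul_eq_mul, smul_eq_mul, mul_assoc]⟩
    have : SMulCommClass R S R := SMulCommClass.symm _ _ _
    -- By adjunction, extending `g` from `X` to `Y` amounts to extending the induced R-linear map
    -- along `R ⊗ f`, which is injective by flatness.
    let f' : R ⊗[S] X →ₗ[R] R ⊗[S] Y :=
      { toFun := LinearMap.lTensor R f
        map_add' := map_add _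
        map_smul' := fun r w => by
          induction w with
          | zero => simp
          | add x y hx hy => simp only [smul_add, map_add, hx, hy]
          | tmul a x => rfl }
    let g' : R ⊗[S] X →ₗ[R] N :=
      { toFun := TensorProduct.liftAddHom
          { toFun := fun r => { toFun := fun x => r • g x, map_zero' := by simp,
                                map_add' := fun x y => by rw [map_add, smul_add] }
            map_zero' := by ext; simp
            map_add' := fun r r' => by ext; simp [add_smul] }
          fun s r x => by
            change (s • r) • g x = r • g (s • x)
            rw [hR, map_smul, hN, mul_smul]
        map_add' := map_add _
        map_smul' := fun r w => by
          induction w with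
          | zero => simp
          | add x y hx hy => simp only [smul_add, map_add, hx, hy]
          | tmul a x => exact mul_smul r a (g x) }
    obtain ⟨h, hh⟩ := Module.Injective.out f'
      (Module.Flat.lTensor_preserves_injective_linearMap f hf) g'
    refine ⟨{ toFun := fun y => h (1 ⊗ₜ y), map_add' := fun y y' => by rw [tmul_add, map_add],
              map_smul' := fun s y => ?_ }, fun x => ?_⟩
    · rw [← smul_tmul, hR, one_mul, RingHom.id_apply, hN, ← map_smul, TensorProduct.smul_tmul',
        smul_eq_mul, mul_one]
    · exact (hh (1 ⊗ₜ x)).trans (one_smul _ _)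

section

variable (k A : Type u) [Field k] [CommRing A] [Algebra k A] [PoissonAlgebra k A]

/-- The anti-automorphism of `U(A)` with `M_a ↦ M_a` and `H_a ↦ -H_a`. -/
def UEnv.anti : UEnv k A →ₐ[k] (UEnv k A)ᵐᵒᵖ :=
  UEnv.lift (B := (UEnv k A)ᵐᵒᵖ)
    ((opLinearEquiv k).toLinearMap ∘ₗ (UEnv.MA k A).toLinearMap)
    (-((opLinearEquiv k).toLinearMap ∘ₗ
      { toFun := UEnv.H k A, map_add' := UEnv.H_add, map_smul' := UEnv.H_smul }))
    (fun a b => by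
      apply unop_injective
      change UEnv.M k A (a * b) = UEnv.M k A b * UEnv.M k A a
      rw [mul_comm, UEnv.M_mul])
    (fun a b => by
      apply unop_injective
      change -UEnv.H k A (pb k A a b) = -UEnv.H k A b * -UEnv.H k A a - -UEnv.H k A a * -UEnv.H k A b
      rw [UEnv.H_pb]
      noncomm_ring)
    (fun a b => by
      apply unop_injective
      change -UEnv.H k A (a * b) = -UEnv.H k A b * UEnv.M k A a + -UEnv.H k A a * UEnv.M k A b
      have h1 := UEnv.M_pb k A a b
      have h2 := UEnv.M_pb k A b a
      rw [pb_skew k b a, UEnv.M_neg, h1] at h2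
      rw [UEnv.H_mul, neg_mul, neg_mul]
      have h3 : UEnv.H k A b * UEnv.M k A a = UEnv.M k A a * UEnv.H k A b -
        (UEnv.H k A a * UEnv.M k A b - UEnv.M k A b * UEnv.H k A a) := by
        rw [sub_eq_add_neg _ (_ - _), h2]; abel
      rw [h3]
      abel)
    (fun a b => by
      apply unop_injective
      change UEnv.M k A (pb k A a b) = UEnv.M k A b * -UEnv.H k A a - -UEnv.H k A a * UEnv.M k A b
      rw [UEnv.M_pb]
      noncomm_ring)
    (by
      apply unop_injective
      exact UEnv.M_one k A)

lemma UEnv.anti_M (a : A) : UEnv.anti k A (UEnv.M k A a) = op (UEnv.M k A a) :=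
  UEnv.lift_M (B := (UEnv k A)ᵐᵒᵖ) _ _ _ _ _ _ _ a

lemma UEnv.anti_H (a : A) : UEnv.anti k A (UEnv.H k A a) = -op (UEnv.H k A a) :=
  UEnv.lift_H (B := (UEnv k A)ᵐᵒᵖ) _ _ _ _ _ _ _ a

lemma UEnv.anti_anti (x : UEnv k A) : (UEnv.anti k A (UEnv.anti k A x).unop).unop = x := by
  induction x using UEnv.induction with
  | hk c =>
    rw [AlgHom.commutes]
    change (UEnv.anti k A (algebraMap k _ c)).unop = _
    rw [AlgHom.commutes]; rfl
  | hM a => rw [anti_M]; change (UEnv.anti k A (UEnv.M k A a)).unop = _; rw [anti_M]; rfl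
  | hH a =>
    rw [anti_H]
    change (UEnv.anti k A (-(UEnv.H k A a))).unop = _
    rw [map_neg, anti_H, neg_neg]; rfl
  | hadd x y hx hy => simp only [map_add, MulOpposite.unop_add, hx, hy]
  | hmul x y hx hy => simp only [map_mul, MulOpposite.unop_mul, hx, hy]

/-- The commutative algebra `Aᵉ`. -/
abbrev SA : Type u := A ⊗[k] Aᵐᵒᵖ

/-- The homomorphism `Aᵉ → U(A)ᵉ`. -/
def SA.toUEnvE : SA k A →ₐ[k] UEnvE k A :=
  Algebra.TensorProduct.map (UEnv.MA k A) (UEnv.MA k A).op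

lemma SA.toUEnvE_tmul (a b : A) : SA.toUEnvE k A (a ⊗ₜ op b) =
    UEnv.M k A a ⊗ₜ op (UEnv.M k A b) := rfl

/-- A ring as a right module over a commutative ring. -/
@[reducible] def rightMod {B R : Type u} [CommRing B] [Ring R] (f : B →+* R) : Module B R where
  smul s z := z * f s
  one_smul z := by change z * f 1 = z; rw [map_one, mul_one]
  mul_smul s s' z := by
    change z * f (s * s') = z * f s' * f s
    rw [mul_comm, map_mul, mul_assoc]
  smul_zero s := zero_mul _
  smul_add s z z' := add_mul _ _ _
  add_smul s s' z := by
    change z * f (s + s') = _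
    rw [map_add, mul_add]; rfl
  zero_smul z := by
    change z * f 0 = 0
    rw [map_zero, mul_zero]

/-- `U(A)ᵉ` as a right module over `Aᵉ`. -/
@[reducible] def SA.moduleRight : Module (SA k A) (UEnvE k A) :=
  rightMod (SA.toUEnvE k A).toRingHom

attribute [local instance] SA.moduleRight

/-- `U(A)ᵉ` is a flat right module over `Aᵉ`. -/
theorem flat_UEnvE [CharZero k] [Algebra.Smooth k A] : Module.Flat (SA k A) (UEnvE k A) := by
  let l₁ : Module A (UEnv k A) := rightMod (UEnv.MA k A).toRingHom
  let l₂ : Module Aᵐᵒᵖ (UEnv k A)ᵐᵒᵖ := rightMod (UEnv.MA k A).op.toRingHom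
  have t₁ : IsScalarTower k A (UEnv k A) := ⟨fun c a u => by
    change u * UEnv.MA k A (c • a) = c • (u * UEnv.MA k A a)
    rw [map_smul, mul_smul_comm]⟩
  have t₂ : IsScalarTower k Aᵐᵒᵖ (UEnv k A)ᵐᵒᵖ := ⟨fun c a u => by
    change u * (UEnv.MA k A).op (c • a) = c • (u * (UEnv.MA k A).op a)
    rw [map_smul, mul_smul_comm]⟩
  -- The anti-automorphism fixes every M_a, so it exchanges the left and right A-module structures
  -- of U(A) and transports flatness from the one to the other.
  have f₁ : @Module.Flat A (UEnv k A) _ _ l₁ := by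
    let e : UEnv k A ≃+ UEnv k A :=
      { toFun := fun x => (UEnv.anti k A x).unop
        invFun := fun x => (UEnv.anti k A x).unop
        left_inv := UEnv.anti_anti k A
        right_inv := UEnv.anti_anti k A
        map_add' := fun x y => by rw [map_add]; rfl }
    refine @flat_of_ringEquiv A A (UEnv k A) (UEnv k A) _ _ _ (UEnv.moduleLeft k A) _ l₁
      (RingEquiv.refl A) e (fun a u => ?_) flat_UEnv
    change (UEnv.anti k A (UEnv.M k A a * u)).unop = (UEnv.anti k A u).unop * UEnv.M k A a
    rw [map_mul, UEnv.anti_M]; rfl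
  have f₂ : Module.Flat Aᵐᵒᵖ (UEnv k A)ᵐᵒᵖ :=
    @flat_of_ringEquiv A Aᵐᵒᵖ (UEnv k A) (UEnv k A)ᵐᵒᵖ _ _ _ (UEnv.moduleLeft k A) _ l₂
      (RingEquiv.toOpposite A) opAddEquiv (fun a u => rfl) flat_UEnv
  have t₃ : IsScalarTower k (SA k A) (UEnvE k A) := ⟨fun c s z => by
    change z * SA.toUEnvE k A (c • s) = c • (z * SA.toUEnvE k A s)
    rw [map_smul, mul_smul_comm]⟩
  refine @flat_of_exterior_tensor k A Aᵐᵒᵖ (UEnv k A) (UEnv k A)ᵐᵒᵖ (UEnvE k A) _ _ _ _ _ _ _ l₁ t₁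
    _ _ l₂ t₂ _ _ _ t₃ (LinearEquiv.refl k _) (fun a b m n => ?_) f₁ f₂
  exact (Algebra.TensorProduct.tmul_mul_tmul m (UEnv.MA k A a) n ((UEnv.MA k A).op b)).symm

/-- Injective Poisson bimodules are injective `Aᵉ`-modules. -/
theorem injective_bimod [CharZero k] [Algebra.Smooth k A] {N : Type u} [AddCommGroup N]
    [Module (UEnvE k A) N] [Module (SA k A) N]
    (hN : ∀ (s : SA k A) (n : N), s • n = SA.toUEnvE k A s • n) [Module.Injective (UEnvE k A) N] :
    Module.Injective (SA k A) N :=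
  have := flat_UEnvE k A
  injective_restrict (SA.toUEnvE k A).toRingHom hN (fun _ _ => rfl)

end

/-! ### The diagonal of a smooth algebra is locally a complete intersection -/

/-- The equational criterion of flatness: a relation `t j * s = ∑ t i * c i` over R' is a
combination of relations over R, and in each of these the coefficient of `t j` lies in the ideal of
the previous elements. -/
lemma IsReg.of_flat {R R' : Type*} [CommRing R] [CommRing R'] [Algebra R R'] [Module.Flat R R']
    {t : ℕ → R} {ℓ : ℕ} (h : IsReg t ℓ) : IsReg (fun j => algebraMap R R' (t j)) ℓ := by
  intro j hj s hs
  obtain ⟨c, hc⟩ := (mem_span_image_Iio_iff _ _ _).1 hs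
  have hrel : ∑ i : Fin (j + 1), t i • (if (i : ℕ) = j then s else -c i) = 0 := by
    rw [Fin.sum_univ_castSucc]
    simp only [Fin.val_castSucc, Fin.val_last, if_true, Algebra.smul_def]
    rw [hc, Finset.sum_range, ← Finset.sum_add_distrib]
    refine Finset.sum_eq_zero fun i _ => ?_
    rw [if_neg (by have := i.2; omega)]
    ring
  obtain ⟨κ, a, y, hy, ha⟩ := Module.Flat.isTrivialRelation_of_sum_smul_eq_zero (R := R) (M := R')
    (f := fun i : Fin (j + 1) => t i)
    (x := fun i : Fin (j + 1) => if (i : ℕ) = j then s else -c i) hrel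
  have h1 := hy (Fin.last j)
  simp only [Fin.val_last, if_true] at h1
  rw [h1]
  refine sum_mem fun l _ => ?_
  rw [Algebra.smul_def]
  refine Ideal.mul_mem_right _ _ ?_
  have h2 : a (Fin.last j) l ∈ Ideal.span (t '' Set.Iio j) := by
    refine h j hj _ ((mem_span_image_Iio_iff _ _ _).2
      ⟨fun i => if hi : i < j + 1 then -a ⟨i, hi⟩ l else 0, ?_⟩)
    have := ha l
    rw [Fin.sum_univ_castSucc] at this
    rw [Finset.sum_range]
    simp only [Fin.val_castSucc, Fin.val_last] at this
    have e : ∀ i : Fin j, t i * (if hi : (i : ℕ) < j + 1 then -a ⟨i, hi⟩ l else 0) =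
        -(t i * a i.castSucc l) := fun i => by
      rw [dif_pos (by have := i.2; omega), mul_neg]; rfl
    simp only [e, Finset.sum_neg_distrib]
    linear_combination this
  have h3 := Ideal.mem_map_of_mem (algebraMap R R') h2
  rwa [Ideal.map_span, ← Set.image_comp] at h3

lemma IsReg.of_ringEquiv {R R' : Type*} [CommRing R] [CommRing R'] (e : R ≃+* R')
    {t : ℕ → R} {ℓ : ℕ} (h : IsReg t ℓ) : IsReg (fun j => e (t j)) ℓ := by
  let _ : Algebra R R' := e.toRingHom.toAlgebra
  let f : R ≃ₗ[R] R' := LinearEquiv.ofBijective (Algebra.linearMap R R') e.bijective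
  have : Module.Flat R R' := Module.Flat.of_linearEquiv f.symm
  exact h.of_flat (R' := R')

/-- An ideal generated by variables is monomial, and multiplying a monomial by a further variable
does not bring in any of the generating ones. -/
lemma isReg_X (n : ℕ) (R : Type*) [CommRing R] :
    IsReg (fun j => if h : j < n then (MvPolynomial.X ⟨j, h⟩ : MvPolynomial (Fin n) R) else 0) n := by
  intro j hj s hs
  have e : ((fun j => if h : j < n then (MvPolynomial.X ⟨j, h⟩ : MvPolynomial (Fin n) R) else 0) ''
      Set.Iio j) = MvPolynomial.X '' {i : Fin n | (i : ℕ) < j} := by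
    ext x
    constructor
    · rintro ⟨i, hi, rfl⟩
      exact ⟨⟨i, lt_trans hi hj⟩, hi, by simp [lt_trans (Set.mem_Iio.1 hi) hj]⟩
    · rintro ⟨i, hi, rfl⟩
      exact ⟨i, hi, by simp⟩
  rw [e] at hs ⊢
  simp only [dif_pos hj] at hs
  rw [MvPolynomial.mem_ideal_span_X_image] at hs ⊢
  intro m hm
  obtain ⟨i, hi, h⟩ := hs (Finsupp.single ⟨j, hj⟩ 1 + m) (by
    rw [MvPolynomial.mem_support_iff, MvPolynomial.coeff_X_mul]
    exact MvPolynomial.mem_support_iff.1 hm)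
  refine ⟨i, hi, ?_⟩
  have : (⟨j, hj⟩ : Fin n) ≠ i := fun h' => by
    rw [← h'] at hi; exact lt_irrefl j hi
  simpa [Finsupp.single_apply, this] using h

/-- The diagonal of the affine space is cut out by a regular sequence. -/
lemma isReg_X_sub (n : ℕ) (k : Type*) [CommRing k] :
    IsReg (fun j => if h : j < n then
      ((MvPolynomial.X ⟨j, h⟩ : MvPolynomial (Fin n) k) ⊗ₜ[k] (1 : MvPolynomial (Fin n) k) -
        1 ⊗ₜ MvPolynomial.X ⟨j, h⟩) else 0) n := by
  let R := MvPolynomial (Fin n) k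
  -- The involution X_i ↦ C(X_i) - X_i over R = k[X]. After identifying R[X] with R ⊗ k[X], it turns
  -- the variables into X_i ⊗ 1 - 1 ⊗ X_i.
  let φ : MvPolynomial (Fin n) R →ₐ[R] MvPolynomial (Fin n) R :=
    MvPolynomial.aeval fun i => MvPolynomial.C (MvPolynomial.X i) - MvPolynomial.X i
  have hφ : φ.comp φ = AlgHom.id R _ := by
    ext i : 1
    simp [φ, MvPolynomial.algebraMap_eq]
  let e : MvPolynomial (Fin n) R ≃ₐ[R] MvPolynomial (Fin n) R := AlgEquiv.ofAlgHom φ φ hφ hφ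
  let e' := e.trans (MvPolynomial.algebraTensorAlgEquiv k R).symm
  convert (isReg_X n R).of_ringEquiv e'.toRingEquiv using 1
  funext j
  split_ifs with h
  · change _ = (MvPolynomial.algebraTensorAlgEquiv k R).symm (φ (MvPolynomial.X ⟨j, h⟩))
    rw [AlgEquiv.eq_symm_apply]
    simp [φ, R, MvPolynomial.algebraTensorAlgEquiv_tmul, Algebra.smul_def, MvPolynomial.algebraMap_eq]
  · exact (map_zero e').symm

section Diagonal

variable {k A B T : Type u} [Field k] [CommRing A] [Algebra k A] [CommRing B] [Algebra A B]
  [Algebra k B] [IsScalarTower k A B] [CommRing T] [Algebra (A ⊗[k] A) T] (f : A)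
  [IsLocalization.Away f B]

/-- An algebra over `A ⊗ A` in which `f ⊗ 1` and `1 ⊗ f` are invertible is an algebra over
`A_f ⊗ A_f`, flat if it is so over `A ⊗ A`. -/
lemma exists_hom_tensor_localization (hf : IsUnit (algebraMap (A ⊗[k] A) T (f ⊗ₜ 1)))
    (hf' : IsUnit (algebraMap (A ⊗[k] A) T (1 ⊗ₜ f))) [Module.Flat (A ⊗[k] A) T] :
    ∃ χ : B ⊗[k] B →+* T, χ.Flat ∧
      ∀ a b : A, χ (algebraMap A B a ⊗ₜ algebraMap A B b) = algebraMap (A ⊗[k] A) T (a ⊗ₜ b) := by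
  let _ : Algebra k T := Algebra.compHom T (algebraMap k (A ⊗[k] A))
  have : IsScalarTower k (A ⊗[k] A) T := IsScalarTower.of_algebraMap_eq fun _ => rfl
  let la : A →ₐ[k] T := (IsScalarTower.toAlgHom k (A ⊗[k] A) T).comp
    Algebra.TensorProduct.includeLeft
  let ra : A →ₐ[k] T := (IsScalarTower.toAlgHom k (A ⊗[k] A) T).comp
    Algebra.TensorProduct.includeRight
  have key : ∀ g : A →ₐ[k] T, IsUnit (g f) → ∃ g' : B →ₐ[k] T, ∀ a, g' (algebraMap A B a) = g a := by
    intro g hg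
    have hg' : ∀ a, IsLocalization.Away.lift f (S := B) (g := g.toRingHom) hg (algebraMap A B a) = g a :=
      fun a => IsLocalization.Away.lift_eq f hg a
    exact ⟨{ IsLocalization.Away.lift f (S := B) (g := g.toRingHom) hg with
      commutes' := fun c => by
        change IsLocalization.Away.lift f (S := B) (g := g.toRingHom) hg _ = _
        rw [IsScalarTower.algebraMap_apply k A B, hg', AlgHom.commutes] }, hg'⟩
  obtain ⟨l, hl⟩ := key la hf
  obtain ⟨r, hr⟩ := key ra hf'
  let χ : B ⊗[k] B →ₐ[k] T := Algebra.TensorProduct.lift l r fun _ _ => Commute.all _ _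
  have hχ : ∀ a b : A, χ (algebraMap A B a ⊗ₜ algebraMap A B b) = algebraMap (A ⊗[k] A) T (a ⊗ₜ b) := by
    intro a b
    rw [Algebra.TensorProduct.lift_tmul, hl, hr]
    change algebraMap _ T (a ⊗ₜ 1) * algebraMap _ T (1 ⊗ₜ b) = _
    rw [← map_mul, Algebra.TensorProduct.tmul_mul_tmul, one_mul, mul_one]
  refine ⟨χ.toRingHom, ?_, hχ⟩
  let j : A →ₐ[k] B := IsScalarTower.toAlgHom k A B
  let φ₁ : A ⊗[k] A →ₐ[k] B ⊗[k] A := Algebra.TensorProduct.map j (.id k A)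
  let φ₂ : B ⊗[k] A →ₐ[k] B ⊗[k] B := Algebra.TensorProduct.map (.id k B) j
  let _ : Algebra (A ⊗[k] A) (B ⊗[k] A) := φ₁.toRingHom.toAlgebra
  let _ : Algebra (B ⊗[k] A) (B ⊗[k] B) := φ₂.toRingHom.toAlgebra
  let _ : Algebra (B ⊗[k] B) T := χ.toRingHom.toAlgebra
  let _ : Algebra (B ⊗[k] A) T := (χ.comp φ₂).toRingHom.toAlgebra
  have e₁ : (χ.comp φ₂).comp φ₁ = IsScalarTower.toAlgHom k (A ⊗[k] A) T := by
    apply Algebra.TensorProduct.ext'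
    intro a b
    exact hχ a b
  have t₁ : IsScalarTower (A ⊗[k] A) (B ⊗[k] A) T :=
    IsScalarTower.of_algebraMap_eq fun x => (AlgHom.congr_fun e₁ x).symm
  have t₂ : IsScalarTower (B ⊗[k] A) (B ⊗[k] B) T := IsScalarTower.of_algebraMap_eq fun _ => rfl
  have s₁ : IsScalarTower A (A ⊗[k] A) (B ⊗[k] A) := IsScalarTower.of_algebraMap_eq fun a => by
    change algebraMap A B a ⊗ₜ (1 : A) = φ₁ (a ⊗ₜ 1)
    simp [φ₁, j]
  have s₂ : IsScalarTower B (B ⊗[k] A) (B ⊗[k] B) := IsScalarTower.of_algebraMap_eq fun a => by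
    change a ⊗ₜ (1 : B) = φ₂ (a ⊗ₜ 1)
    simp [φ₂]
  have i₁ : IsLocalization (Algebra.algebraMapSubmonoid (A ⊗[k] A) (.powers f)) (B ⊗[k] A) :=
    IsLocalization.tensorProduct_tensorProduct k A (.powers f) B (by
      ext a
      change φ₁ (1 ⊗ₜ a) = 1 ⊗ₜ a
      simp [φ₁])
  have i₂ : IsLocalization ((Submonoid.powers f).map
      (Algebra.TensorProduct.includeRight (R := k) (A := B))) (B ⊗[k] B) :=
    IsLocalization.tensorProduct_tensorProduct_right k B (.powers f) B (by
      ext a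
      change φ₂ (1 ⊗ₜ a) = 1 ⊗ₜ algebraMap A B a
      simp [φ₂, j])
  have f₁ : Module.Flat (B ⊗[k] A) T := (Module.flat_iff_of_isLocalization (B ⊗[k] A)
    (Algebra.algebraMapSubmonoid (A ⊗[k] A) (.powers f)) T).2 inferInstance
  exact (Module.flat_iff_of_isLocalization (B ⊗[k] B) ((Submonoid.powers f).map
      (Algebra.TensorProduct.includeRight (R := k) (A := B))) T).2 f₁

lemma flat_tensor {R R' B B' : Type u} [CommRing R] [CommRing R'] [Algebra k R] [Algebra k R']
    [CommRing B] [CommRing B'] [Algebra k B] [Algebra k B'] (φ : R →ₐ[k] B) (ψ : R' →ₐ[k] B')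
    (hφ : φ.toRingHom.Flat) (hψ : ψ.toRingHom.Flat) :
    (Algebra.TensorProduct.map φ ψ).toRingHom.Flat := by
  let _ : Algebra R B := φ.toRingHom.toAlgebra
  let _ : Algebra R' B' := ψ.toRingHom.toAlgebra
  let _ : Algebra (R ⊗[k] R') (B ⊗[k] B') := (Algebra.TensorProduct.map φ ψ).toRingHom.toAlgebra
  have : IsScalarTower k R B := IsScalarTower.of_algebraMap_eq fun c => (φ.commutes c).symm
  have : IsScalarTower k R' B' := IsScalarTower.of_algebraMap_eq fun c => (ψ.commutes c).symm
  have : IsScalarTower k (R ⊗[k] R') (B ⊗[k] B') :=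
    IsScalarTower.of_algebraMap_eq fun c => ((Algebra.TensorProduct.map φ ψ).commutes c).symm
  have h1 : Module.Flat R B := hφ
  have h2 : Module.Flat R' B' := hψ
  refine flat_of_exterior_tensor (M := B) (N := B') (LinearEquiv.refl k _) fun a b m n => ?_
  rw [Algebra.smul_def, Algebra.smul_def, Algebra.smul_def]
  exact (Algebra.TensorProduct.tmul_mul_tmul _ _ _ _).symm

/-- The diagonal of affine space is cut out by the regular sequence X_i ⊗ 1 - 1 ⊗ X_i, which stays
regular under flat maps. Étaleness of the coordinates makes it generate the diagonal ideal of A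
locally, by Nakayama's lemma. -/
theorem exists_isReg_span_eq {n : ℕ} [Algebra (MvPolynomial (Fin n) k) B]
    [IsScalarTower k (MvPolynomial (Fin n) k) B] [Algebra.Etale (MvPolynomial (Fin n) k) B]
    [IsLocalRing T] [IsNoetherianRing T] [Module.Flat (A ⊗[k] A) T] {I : Ideal T}
    (hI : I = (KaehlerDifferential.ideal k A).map (algebraMap (A ⊗[k] A) T)) (hI' : I ≠ ⊤)
    (hf : IsUnit (algebraMap (A ⊗[k] A) T (f ⊗ₜ 1)))
    (hf' : IsUnit (algebraMap (A ⊗[k] A) T (1 ⊗ₜ f))) :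
    ∃ t : ℕ → T, IsReg t n ∧ Ideal.span (t '' Set.Iio n) = I := by
  obtain ⟨χ, hχ, hχ'⟩ := exists_hom_tensor_localization (B := B) f hf hf'
  let R := MvPolynomial (Fin n) k
  let j : R →ₐ[k] B := IsScalarTower.toAlgHom k R B
  have hj : j.toRingHom.Flat := RingHom.flat_algebraMap_iff.2 (Algebra.Smooth.flat R B)
  let ρ := χ.comp (Algebra.TensorProduct.map j j).toRingHom
  have hρ : ρ.Flat := (flat_tensor j j hj hj).comp hχ
  let _ : Algebra (R ⊗[k] R) T := ρ.toAlgebra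
  have : Module.Flat (R ⊗[k] R) T := hρ
  have hreg := (isReg_X_sub n k).of_flat (R' := T)
  refine ⟨_, hreg, ?_⟩
  set t : ℕ → T := fun j => algebraMap (R ⊗[k] R) T (if h : j < n then
      ((MvPolynomial.X ⟨j, h⟩ : MvPolynomial (Fin n) k) ⊗ₜ[k] (1 : MvPolynomial (Fin n) k) -
        1 ⊗ₜ MvPolynomial.X ⟨j, h⟩) else 0) with ht
  let l : B →+* T := χ.comp (Algebra.TensorProduct.includeLeft : B →ₐ[k] B ⊗[k] B).toRingHom
  let r : B →+* T := χ.comp (Algebra.TensorProduct.includeRight : B →ₐ[k] B ⊗[k] B).toRingHom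
  have hl : ∀ a, l (algebraMap A B a) = algebraMap _ T (a ⊗ₜ[k] (1 : A)) := fun a => by
    rw [← hχ', map_one]; rfl
  have hr : ∀ a, r (algebraMap A B a) = algebraMap _ T ((1 : A) ⊗ₜ[k] a) := fun a => by
    rw [← hχ', map_one]; rfl
  have hlr : ∀ b, l b - r b ∈ I := by
    intro b
    have : (Ideal.Quotient.mk I).comp l = (Ideal.Quotient.mk I).comp r := by
      apply IsLocalization.ringHom_ext (Submonoid.powers f)
      ext a
      refine Ideal.Quotient.eq.2 ?_
      change l (algebraMap A B a) - r (algebraMap A B a) ∈ I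
      rw [hl, hr, ← map_sub, ← neg_mem_iff, ← map_neg, neg_sub, hI]
      exact Ideal.mem_map_of_mem _ (KaehlerDifferential.one_smul_sub_smul_one_mem_ideal k a)
    exact Ideal.Quotient.eq.1 (RingHom.congr_fun this b)
  have htX : ∀ i : Fin n, t i = l (algebraMap R B (MvPolynomial.X i)) -
      r (algebraMap R B (MvPolynomial.X i)) := by
    intro i
    simp only [ht, dif_pos i.2, Fin.eta]
    change χ (Algebra.TensorProduct.map j j _) = χ _ - χ _
    rw [← map_sub]
    simp [j]
  have hkl : ∀ c : k, l (algebraMap k B c) = r (algebraMap k B c) := by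
    intro c
    change χ (_ ⊗ₜ 1) = χ (1 ⊗ₜ _)
    rw [Algebra.algebraMap_eq_smul_one, smul_tmul]
  apply le_antisymm
  · rw [Ideal.span_le]
    rintro _ ⟨i, hi, rfl⟩
    rw [htX ⟨i, hi⟩]
    exact hlr _
  · have hfg : I.FG := IsNoetherian.noetherian I
    refine Submodule.le_of_le_smul_of_le_jacobson_bot hfg
      (IsLocalRing.jacobson_eq_maximalIdeal (⊥ : Ideal T) bot_ne_top ▸
        IsLocalRing.le_maximalIdeal hI') ?_
    let K : Ideal T := Ideal.span (t '' Set.Iio n) ⊔ I • I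
    change I ≤ K
    let q := Ideal.Quotient.mk K
    let _ : Algebra R (T ⧸ K) := ((q.comp l).comp (algebraMap R B)).toAlgebra
    have hR : (q.comp l).comp (algebraMap R B) = (q.comp r).comp (algebraMap R B) := by
      apply MvPolynomial.ringHom_ext
      · intro c
        change q (l (algebraMap R B (algebraMap k R c))) = q (r (algebraMap R B (algebraMap k R c)))
        rw [← IsScalarTower.algebraMap_apply, hkl]
      · intro i
        refine Ideal.Quotient.eq.2 (Ideal.mem_sup_left ?_)
        rw [← htX]
        exact Ideal.subset_span ⟨i, i.2, rfl⟩
    let g₁ : B →ₐ[R] T ⧸ K := { q.comp l with commutes' := fun _ => rfl }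
    let g₂ : B →ₐ[R] T ⧸ K := { q.comp r with commutes' := fun x => (RingHom.congr_fun hR x).symm }
    -- The two maps B → T/K agree on the polynomial ring and modulo the square-zero ideal I/K. Since
    -- B is unramified over the polynomials they coincide, so I ≤ K = (t) + I².
    have hg : g₁ = g₂ := by
      refine Algebra.FormallyUnramified.ext (I.map q) ⟨2, ?_⟩ fun b => ?_
      · rw [pow_two, ← Ideal.map_mul, Ideal.zero_eq_bot, Ideal.map_eq_bot_iff_le_ker,
          Ideal.mk_ker]
        exact le_sup_right
      · refine Ideal.Quotient.eq.2 ?_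
        change q (l b) - q (r b) ∈ _
        rw [← map_sub]
        exact Ideal.mem_map_of_mem _ (hlr b)
    rw [hI, ← KaehlerDifferential.span_range_eq_ideal, Ideal.map_span, Ideal.span_le]
    rintro _ ⟨_, ⟨a, rfl⟩, rfl⟩
    rw [SetLike.mem_coe, ← neg_mem_iff, ← map_neg, neg_sub, map_sub, ← hl, ← hr]
    exact Ideal.Quotient.eq.1 (AlgHom.congr_fun hg (algebraMap A B a))

end Diagonal

/-! ### The dimension of a smooth algebra -/

/-- Lying over and going up lift chains of primes, while incomparability keeps contracted chains
strict. -/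
lemma ringKrullDim_eq_of_isIntegral {R S : Type*} [CommRing R] [CommRing S] [Algebra R S]
    [Algebra.IsIntegral R S] [FaithfulSMul R S] : ringKrullDim R = ringKrullDim S := by
  apply le_antisymm
  · refine iSup_le fun l => ?_
    obtain ⟨Q, -, hQ, hQl⟩ := Ideal.exists_ideal_over_prime_of_isIntegral
      l.head.asIdeal (⊥ : Ideal S) (by
        rw [← RingHom.ker_eq_comap_bot, (RingHom.injective_iff_ker_eq_bot _).1 (FaithfulSMul.algebraMap_injective R S)]
        exact bot_le)
    have : Q.LiesOver l.head.asIdeal := ⟨hQl.symm⟩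
    obtain ⟨L, hL, -⟩ := Ideal.exists_ltSeries_of_hasGoingUp l Q
    rw [← hL]
    exact le_iSup (fun L : LTSeries (PrimeSpectrum S) => (L.length : WithBot ℕ∞)) L
  · exact Order.krullDim_le_of_strictMono (PrimeSpectrum.comap (algebraMap R S)) fun I J h =>
      Ideal.IsIntegral.comap_lt_comap h

/-- `L` is quasi-finite over the fraction field of `D`, hence finite over it. -/
lemma isAlgebraic_of_quasiFinite (D L : Type*) [CommRing D] [IsDomain D] [Field L] [Algebra D L]
    [FaithfulSMul D L] [Algebra.QuasiFinite D L] : Algebra.IsAlgebraic D L := by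
  let K := FractionRing D
  let _ : Algebra K L := FractionRing.liftAlgebra D L
  have := Algebra.QuasiFinite.of_restrictScalars D K L
  have : Module.Finite K L := Module.Finite.of_quasiFinite
  exact (IsFractionRing.comap_isAlgebraic_iff (A := D) (K := K) (C := L)).2 inferInstance

lemma trdeg_eq_of_isAlgebraic (k D L : Type u) [Field k] [CommRing D] [IsDomain D] [Field L]
    [Algebra k D] [Algebra D L] [Algebra k L] [IsScalarTower k D L] [FaithfulSMul D L]
    [Algebra.IsAlgebraic D L] : Algebra.trdeg k D = Algebra.trdeg k L := by
  rw [← trdeg_add_eq (R := k) (S := D) (A := L), trdeg_eq_zero (R := D), add_zero]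

/-- By Noether normalization both invariants equal the number of variables of a polynomial ring over
which `D` is integral. -/
lemma trdeg_eq_of_ringKrullDim {k D : Type u} [Field k] [CommRing D] [IsDomain D] [Algebra k D]
    [Algebra.FiniteType k D] {ℓ : ℕ} (h : ringKrullDim D = ℓ) : Algebra.trdeg k D = ℓ := by
  obtain ⟨s, g, hg, hg'⟩ := exists_integral_inj_algHom_of_fg k D
  let R := MvPolynomial (Fin s) k
  let _ : Algebra R D := g.toRingHom.toAlgebra
  have : IsScalarTower k R D := IsScalarTower.of_algebraMap_eq fun c => (g.commutes c).symm
  have : Algebra.IsIntegral R D := ⟨hg'⟩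
  have : FaithfulSMul R D := (faithfulSMul_iff_algebraMap_injective R D).2 hg
  have h1 : Algebra.trdeg k D = s := by
    rw [← trdeg_add_eq (R := k) (S := R) (A := D), trdeg_eq_zero (R := R),
      add_zero, MvPolynomial.trdeg_of_isDomain]
    simp
  rw [← ringKrullDim_eq_of_isIntegral (R := R), MvPolynomial.ringKrullDim_of_isNoetherianRing,
    ringKrullDim_eq_zero_of_field, zero_add, Nat.card_eq_fintype_card, Fintype.card_fin] at h
  rw [h1]
  exact_mod_cast h

/-- The relative dimension of étale coordinates on a smooth algebra of pure dimension. -/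
theorem eq_of_etale {k A B : Type u} [Field k] [CommRing A] [Algebra k A] [CommRing B] [Algebra A B]
    [Algebra k B] [IsScalarTower k A B] [Algebra.FiniteType k A] {f : A} [IsLocalization.Away f B]
    {n ℓ : ℕ} [Algebra (MvPolynomial (Fin n) k) B] [IsScalarTower k (MvPolynomial (Fin n) k) B]
    [Algebra.Etale (MvPolynomial (Fin n) k) B]
    (hℓ : ∀ p ∈ minimalPrimes A, ringKrullDim (A ⧸ p) = ℓ) {p : Ideal A} [p.IsPrime] (hf : f ∉ p) :
    n = ℓ := by
  let R := MvPolynomial (Fin n) k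
  obtain ⟨q, hq, hqp⟩ := Ideal.exists_minimalPrimes_le (bot_le : (⊥ : Ideal A) ≤ p)
  have hqP : q.IsPrime := hq.1.1
  have hdisj : Disjoint (Submonoid.powers f : Set A) q :=
    (Ideal.disjoint_powers_iff_notMem_of_isPrime _).2 fun h => hf (hqp h)
  let Q : Ideal B := q.map (algebraMap A B)
  have hQ : Q.IsPrime := IsLocalization.isPrime_of_isPrime_disjoint (.powers f) _ _ hqP hdisj
  have hQq : Q.comap (algebraMap A B) = q :=
    IsLocalization.under_map_of_isPrime_disjoint (.powers f) B hqP hdisj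
  have hflat : Module.Flat R B := Algebra.Smooth.flat R B
  -- `Q` is minimal, and by going down for the flat map R → B a prime inside `Q` lies over zero; so
  -- `Q` itself does.
  have hR : Q.comap (algebraMap R B) = ⊥ := by
    have : Q.LiesOver (Q.under R) := ⟨rfl⟩
    obtain ⟨P, hPQ, hP, hP0⟩ := Ideal.exists_ideal_le_liesOver_of_le (p := (⊥ : Ideal R))
      (q := Q.under R) Q bot_le
    have h1 : P.under A = q := by
      refine le_antisymm ((Ideal.comap_mono hPQ).trans hQq.le) ?_
      exact hq.2 ⟨hP.comap _, bot_le⟩ ((Ideal.comap_mono hPQ).trans hQq.le)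
    have h2 : P = Q := by
      rw [← IsLocalization.map_under (.powers f) B P, h1]
    rw [← h2]
    exact hP0.over.symm
  -- The residue field at `Q` is algebraic both over A/q and over the polynomial ring R, whose
  -- transcendence degrees ℓ and n therefore agree.
  let L := Q.ResidueField
  let _ : Algebra (A ⧸ q) L := (Ideal.Quotient.lift q (algebraMap A L) fun a ha => by
    rw [IsScalarTower.algebraMap_apply A B L]
    exact (Ideal.algebraMap_residueField_eq_zero).2 (Ideal.mem_map_of_mem _ ha)).toAlgebra
  have : IsScalarTower A (A ⧸ q) L := IsScalarTower.of_algebraMap_eq fun _ => rfl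
  have : IsScalarTower k (A ⧸ q) L := IsScalarTower.of_algebraMap_eq fun c => by
    rw [IsScalarTower.algebraMap_apply k A (A ⧸ q), ← IsScalarTower.algebraMap_apply A (A ⧸ q) L,
      ← IsScalarTower.algebraMap_apply k A L]
  have : FaithfulSMul (A ⧸ q) L := (faithfulSMul_iff_algebraMap_injective _ _).2 <| by
    rw [injective_iff_map_eq_zero]
    intro x hx
    obtain ⟨a, rfl⟩ := Ideal.Quotient.mk_surjective x
    rw [Ideal.Quotient.eq_zero_iff_mem, ← hQq, Ideal.mem_comap,
      ← Ideal.algebraMap_residueField_eq_zero, ← IsScalarTower.algebraMap_apply A B L]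
    exact hx
  have : FaithfulSMul R L := (faithfulSMul_iff_algebraMap_injective _ _).2 <| by
    rw [injective_iff_map_eq_zero]
    intro x hx
    rw [← Ideal.mem_bot, ← hR, Ideal.mem_comap, ← Ideal.algebraMap_residueField_eq_zero,
      ← IsScalarTower.algebraMap_apply R B L]
    exact hx
  have : Algebra.QuasiFinite R B := inferInstance
  have : Algebra.QuasiFinite A B := Algebra.QuasiFinite.of_isLocalization (S := A) (.powers f)
  have : Algebra.QuasiFinite R L := .trans R B L
  have : Algebra.QuasiFinite A L := .trans A B L
  have : Algebra.QuasiFinite (A ⧸ q) L := .of_restrictScalars A (A ⧸ q) L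
  have := isAlgebraic_of_quasiFinite (A ⧸ q) L
  have := isAlgebraic_of_quasiFinite R L
  have h1 := trdeg_eq_of_isAlgebraic k (A ⧸ q) L
  have h2 := trdeg_eq_of_isAlgebraic k R L
  rw [← h2, trdeg_eq_of_ringKrullDim (hℓ q hq), MvPolynomial.trdeg_of_isDomain] at h1
  simpa using h1.symm

/-! ### The algebra `Aᵉ` and its diagonal ideal -/

lemma flat_of_algebraMap_eq {R R' T : Type u} [CommRing R] [CommRing R'] [CommRing T] [Algebra R T]
    [Algebra R' T] [Module.Flat R T] (e : R ≃+* R')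
    (h : ∀ r, algebraMap R' T (e r) = algebraMap R T r) : Module.Flat R' T :=
  flat_of_ringEquiv e (AddEquiv.refl T) fun r x => by
    rw [Algebra.smul_def, Algebra.smul_def, h]
    rfl

section SA

variable (k A : Type u) [Field k] [CommRing A] [Algebra k A]

/-- The isomorphism `A ⊗ Aᵒᵖ ≅ A ⊗ A`. -/
def SA.equiv : SA k A ≃ₐ[k] A ⊗[k] A :=
  Algebra.TensorProduct.congr AlgEquiv.refl (AlgEquiv.toOpposite k A).symm

variable {A} in
lemma SA.equiv_tmul (a b : A) : SA.equiv k A (a ⊗ₜ op b) = a ⊗ₜ b := rfl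

/-- `A` as an algebra over `Aᵉ`, via the multiplication. -/
@[reducible] def SA.algebra : Algebra (SA k A) A :=
  ((Algebra.TensorProduct.lmul' k : A ⊗[k] A →ₐ[k] A).comp (SA.equiv k A).toAlgHom).toRingHom.toAlgebra

attribute [local instance] SA.algebra

lemma SA.algebraMap_tmul (a b : A) : algebraMap (SA k A) A (a ⊗ₜ op b) = a * b := rfl

/-- The Kähler differentials as a module over `Aᵉ`. -/
@[reducible] def SA.moduleΩ : Module (SA k A) Ω[A⁄k] := Module.compHom _ (algebraMap (SA k A) A)

attribute [local instance] SA.moduleΩ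

lemma SA.isScalarTowerΩ : IsScalarTower (SA k A) A Ω[A⁄k] :=
  ⟨fun s a w => by rw [Algebra.smul_def, mul_smul]; rfl⟩

lemma SA.equiv_mem (x : SA k A) :
    SA.equiv k A x ∈ KaehlerDifferential.ideal k A ↔ x ∈ kerI (SA k A) A := Iff.rfl

lemma SA.map_kerI : (kerI (SA k A) A).map (SA.equiv k A).toRingEquiv =
    KaehlerDifferential.ideal k A := by
  ext y
  rw [Ideal.mem_map_of_equiv]
  constructor
  · rintro ⟨x, hx, rfl⟩
    exact hx
  · exact fun hy => ⟨(SA.equiv k A).symm y, by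
      rw [← SA.equiv_mem, AlgEquiv.apply_symm_apply]; exact hy, (SA.equiv k A).apply_symm_apply y⟩

/-- The conormal map `∑ aᵢ ⊗ bᵢ ↦ ∑ aᵢ dbᵢ`. -/
def SA.conormal : kerI (SA k A) A →ₗ[SA k A] Ω[A⁄k] where
  toFun x := (KaehlerDifferential.D k A).tensorProductTo (SA.equiv k A x)
  map_add' x y := by rw [Submodule.coe_add, map_add, map_add]
  map_smul' s x := by
    have hx : Algebra.TensorProduct.lmul' k (SA.equiv k A (x : SA k A)) = 0 := x.2
    rw [Submodule.coe_smul, smul_eq_mul, map_mul, Derivation.tensorProductTo_mul, hx, zero_smul,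
      add_zero]
    rfl

/-- Ω is by construction the cotangent module of the diagonal ideal; only the passage from A ⊗ A to
A ⊗ Aᵒᵖ has to be made. -/
lemma SA.isConormal : IsConormal (SA.conormal k A) := by
  have h0 : ∀ x : kerI (SA k A) A, SA.conormal k A x =
      (KaehlerDifferential.ideal k A).toCotangent ⟨SA.equiv k A x, x.2⟩ := fun x =>
    KaehlerDifferential.D_tensorProductTo ⟨SA.equiv k A x, x.2⟩
  have := SA.isScalarTowerΩ k A
  refine ⟨fun a => ⟨a ⊗ₜ op 1, by rw [SA.algebraMap_tmul, mul_one]⟩, fun w => ?_, fun x hx => ?_⟩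
  · obtain ⟨y, rfl⟩ := KaehlerDifferential.fromIdeal_surjective k A w
    refine ⟨⟨(SA.equiv k A).symm y, ?_⟩, ?_⟩
    · rw [← SA.equiv_mem, AlgEquiv.apply_symm_apply]
      exact y.2
    · rw [h0]
      simp only [AlgEquiv.apply_symm_apply]
      rfl
  · rw [h0] at hx
    have h1 := (Ideal.toCotangent_eq_zero _ _).1 hx
    rw [Submodule.mem_smul_top_iff, smul_eq_mul, ← pow_two]
    have h2 : (kerI (SA k A) A ^ 2).map (SA.equiv k A).toRingEquiv =
        KaehlerDifferential.ideal k A ^ 2 := by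
      rw [Ideal.map_pow, SA.map_kerI]
    rw [← h2, Ideal.mem_map_of_equiv] at h1
    obtain ⟨z, hz, e⟩ := h1
    rwa [← (SA.equiv k A).injective e]

lemma SA.isNoetherianRing [Algebra.FiniteType k A] : IsNoetherianRing (SA k A) := by
  have : IsNoetherianRing A := Algebra.FiniteType.isNoetherianRing k A
  have : Algebra.FiniteType k Aᵐᵒᵖ := Algebra.FiniteType.equiv ‹_› (AlgEquiv.toOpposite k A)
  exact Algebra.FiniteType.isNoetherianRing A (SA k A)

/-- A prime P above the diagonal ideal contracts to a prime p of A. Étale coordinates near p give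
the regular sequence, and pure dimension fixes its length. -/
theorem SA.isLocallyRegular [Algebra.Smooth k A] {ℓ : ℕ}
    (hℓ : ∀ p ∈ minimalPrimes A, ringKrullDim (A ⧸ p) = ℓ) :
    IsLocallyRegular (kerI (SA k A) A) ℓ := by
  intro P hP hIP
  have := SA.isNoetherianRing k A
  let T := Localization.AtPrime P
  let e := SA.equiv k A
  let _ : Algebra (A ⊗[k] A) T := ((algebraMap (SA k A) T).comp e.symm.toRingEquiv.toRingHom).toAlgebra
  have he : ∀ z, algebraMap (A ⊗[k] A) T z = algebraMap (SA k A) T (e.symm z) := fun _ => rfl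
  have hflat : Module.Flat (A ⊗[k] A) T := by
    have h1 : Module.Flat (SA k A) T := IsLocalization.flat T P.primeCompl
    refine flat_of_algebraMap_eq (T := T) e.toRingEquiv fun s => ?_
    change algebraMap (SA k A) T (e.symm (e s)) = _
    rw [AlgEquiv.symm_apply_apply]
  let p : Ideal A := P.comap (algebraMap A (SA k A))
  have hp : p.IsPrime := hP.comap _
  obtain ⟨f, hf, n, _, _, _⟩ :=
    Algebra.IsSmoothAt.exists_isStandardEtale_mvPolynomial (R := k) (p := p)
  have hn : n = ℓ := by
    exact eq_of_etale (k := k) (f := f) (B := Localization.Away f) hℓ hf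
  subst hn
  have hf1 : (f ⊗ₜ op (1 : A) : SA k A) ∉ P := hf
  -- f ⊗ 1 - 1 ⊗ f lies in the diagonal ideal, hence in `P`; so inverting f in one factor of the
  -- local ring inverts it in the other.
  have hf2 : ((1 : A) ⊗ₜ op f : SA k A) ∉ P := fun h => hf1 <| by
    have h3 : (f ⊗ₜ op (1 : A) - (1 : A) ⊗ₜ op f : SA k A) ∈ P := hIP (by
      rw [RingHom.mem_ker, map_sub, SA.algebraMap_tmul, SA.algebraMap_tmul, mul_one, one_mul, sub_self])
    have := add_mem h3 h
    rwa [sub_add_cancel] at this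
  have hI : (kerI (SA k A) A).map (algebraMap (SA k A) T) =
      (KaehlerDifferential.ideal k A).map (algebraMap (A ⊗[k] A) T) := by
    rw [← SA.map_kerI]
    change _ = Ideal.map _ (Ideal.map (SA.equiv k A).toRingEquiv.toRingHom _)
    rw [Ideal.map_map]
    congr 1
    refine RingHom.ext fun x => ?_
    change _ = algebraMap (SA k A) T (e.symm (e x))
    rw [AlgEquiv.symm_apply_apply]
  refine exists_isReg_span_eq (B := Localization.Away f) f hI (fun h => ?_) ?_ ?_
  · have := Ideal.map_mono (f := algebraMap (SA k A) T) hIP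
    rw [h, Localization.AtPrime.map_eq_maximalIdeal, top_le_iff] at this
    exact Ideal.IsPrime.ne_top inferInstance this
  · exact IsLocalization.map_units T (⟨_, hf1⟩ : P.primeCompl)
  · exact IsLocalization.map_units T (⟨_, hf2⟩ : P.primeCompl)

end SA

/-! ### The Hamiltonian action on `Aᵉ` -/

section Ham

variable (k A : Type u) [Field k] [CommRing A] [Algebra k A] [PoissonAlgebra k A]

attribute [local instance] SA.algebra SA.moduleΩ

/-- The derivation `x ⊗ y ↦ -({a, x} ⊗ y + x ⊗ {a, y})` of `Aᵉ`. -/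
def SA.lie (a : A) : SA k A →ₗ[k] SA k A :=
  -(TensorProduct.map (ham k A a : A →ₗ[k] A) LinearMap.id +
    TensorProduct.map LinearMap.id ((opLinearEquiv k).toLinearMap ∘ₗ (ham k A a : A →ₗ[k] A) ∘ₗ
      (opLinearEquiv k).symm.toLinearMap))

lemma SA.lie_tmul (a x y : A) : SA.lie k A a (x ⊗ₜ op y) =
    -(pb k A a x ⊗ₜ op y + x ⊗ₜ op (pb k A a y)) := rfl

lemma SA.algebraMap_lie (a : A) (s : SA k A) :
    algebraMap (SA k A) A (SA.lie k A a s) = -pb k A a (algebraMap (SA k A) A s) := by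
  induction s using TensorProduct.induction_on with
  | zero => rw [map_zero, map_zero, pb, map_zero, neg_zero]
  | add x y hx hy => rw [map_add, map_add, map_add, hx, hy, pb, pb, pb, map_add, neg_add]
  | tmul x y =>
    obtain ⟨y, rfl⟩ := op_surjective y
    rw [SA.lie_tmul, map_neg, map_add, SA.algebraMap_tmul, SA.algebraMap_tmul, SA.algebraMap_tmul,
      pb_mul_right]
    ring

/-- The action of `SA.lie` on the diagonal ideal. -/
def SA.lieI (a : A) (x : kerI (SA k A) A) : kerI (SA k A) A :=
  ⟨SA.lie k A a x, by
    have hx : algebraMap (SA k A) A x = 0 := x.2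
    rw [RingHom.mem_ker, SA.algebraMap_lie, hx, pb, map_zero, neg_zero]⟩

/-- The sign comes from `SA.lie`, chosen to match n ↦ n H_a - H_a n; the underlying derivation of A
is -{a, -}. -/
lemma SA.conormal_lieI (a : A) (x : kerI (SA k A) A) :
    SA.conormal k A (SA.lieI k A a x) = -lieΩ (ham k A a) (SA.conormal k A x) := by
  change (KaehlerDifferential.D k A).tensorProductTo (SA.equiv k A (SA.lie k A a x)) =
    -lieΩ _ ((KaehlerDifferential.D k A).tensorProductTo (SA.equiv k A x))
  generalize (x : SA k A) = s
  have h0 : lieΩ (ham k A a) 0 = 0 := by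
    have := lieΩ_add (ham k A a) 0 0
    simpa using this
  induction s using TensorProduct.induction_on with
  | zero => simp only [map_zero, h0, neg_zero]
  | add x y hx hy => simp only [map_add, hx, hy, lieΩ_add, neg_add]
  | tmul x y =>
    obtain ⟨y, rfl⟩ := op_surjective y
    rw [SA.lie_tmul, map_neg, map_add, SA.equiv_tmul, SA.equiv_tmul, SA.equiv_tmul, map_neg,
      map_add, Derivation.tensorProductTo_tmul, Derivation.tensorProductTo_tmul,
      Derivation.tensorProductTo_tmul, lieΩ_smul, lieΩ_D, add_comm]
    rfl

end Ham

/-! ### Derived functors computed by an injective resolution -/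

section Derived

open Limits

universe v₁ v₂ u₁ u₂

/-- By the canonical t-structure, an object with homology in degree `n` only is a shifted object of
the abelian category, which can be recovered as that homology. -/
lemma nonempty_iso_singleFunctor_iff {D : Type u₂} [Category.{v₂} D] [Abelian D]
    [HasDerivedCategory D] (K : CochainComplex D ℤ) (n : ℤ) (Y : D) :
    Nonempty (DerivedCategory.Q.obj K ≅ (DerivedCategory.singleFunctor D n).obj Y) ↔
      (∀ i, i ≠ n → K.ExactAt i) ∧ Nonempty (K.homology n ≅ Y) := by
  have hs (Z : D) (i : ℤ) :
      (DerivedCategory.homologyFunctor D i).obj ((DerivedCategory.singleFunctor D n).obj Z) ≅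
      ((HomologicalComplex.single D (.up ℤ) n).obj Z).homology i :=
    (DerivedCategory.homologyFunctor D i).mapIso ((DerivedCategory.singleFunctorIsoCompQ D n).app Z)
      ≪≫ (DerivedCategory.homologyFunctorFactors D i).app _
  have hK (i : ℤ) : (DerivedCategory.homologyFunctor D i).obj (DerivedCategory.Q.obj K) ≅
      K.homology i := (DerivedCategory.homologyFunctorFactors D i).app K
  constructor
  · rintro ⟨e⟩
    have e' (i : ℤ) : K.homology i ≅ ((HomologicalComplex.single D (.up ℤ) n).obj Y).homology i :=
      (hK i).symm ≪≫ (DerivedCategory.homologyFunctor D i).mapIso e ≪≫ hs Y i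
    refine ⟨fun i hi => ?_, ⟨e' n ≪≫ HomologicalComplex.singleObjHomologySelfIso _ n Y⟩⟩
    rw [HomologicalComplex.exactAt_iff_isZero_homology]
    exact (HomologicalComplex.isZero_single_obj_homology (.up ℤ) n Y i hi).of_iso (e' i)
  · rintro ⟨h, ⟨e⟩⟩
    have hz (i : ℤ) (hi : i ≠ n) :
        IsZero ((DerivedCategory.homologyFunctor D i).obj (DerivedCategory.Q.obj K)) :=
      ((HomologicalComplex.exactAt_iff_isZero_homology _ _).1 (h i hi)).of_iso (hK i)
    have h1 : (DerivedCategory.Q.obj K).IsGE n :=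
      (DerivedCategory.isGE_iff _ _).2 fun i hi => hz i hi.ne
    have h2 : (DerivedCategory.Q.obj K).IsLE n :=
      (DerivedCategory.isLE_iff _ _).2 fun i hi => hz i hi.ne'
    obtain ⟨Z, ⟨f⟩⟩ := (DerivedCategory.Q.obj K).exists_iso_singleFunctor_obj_of_isGE_of_isLE n
    have g : Z ≅ Y := (HomologicalComplex.singleObjHomologySelfIso (.up ℤ) n Z).symm ≪≫
      (hs Z n).symm ≪≫ (DerivedCategory.homologyFunctor D n).mapIso f.symm ≪≫ hK n ≪≫ e
    exact ⟨f ≪≫ (DerivedCategory.singleFunctor D n).mapIso g⟩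

variable {C : Type u₁} {D : Type u₂} [Category.{v₁} C] [Category.{v₂} D] [Abelian C] [Abelian D]
  [HasDerivedCategory C] [HasDerivedCategory D] [EnoughInjectives C]
  (F : C ⥤ D) [F.Additive] {X : C} (I : InjectiveResolution X)

/-- The unit of the right derived functor is invertible on bounded below complexes of injectives,
and `X` is isomorphic to its resolution in the derived category. -/
lemma nonempty_rightDerivedFunctorPlus_iso :
    Nonempty ((F.rightDerivedFunctorPlus.obj
      ((DerivedCategory.Plus.singleFunctor C 0).obj X)).obj ≅
      DerivedCategory.Q.obj ((F.mapHomologicalComplex (.up ℤ)).obj I.cochainComplex)) := by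
  let L' : CochainComplex (InjectiveObject C) ℤ :=
    HomologicalComplex.liftObjectProperty _ I.cochainComplex inferInstance
  have hL' : L'.IsStrictlyGE 0 := by
    rw [← CochainComplex.isStrictlyGE_mapHomologicalComplex_obj_iff _ (InjectiveObject.ι _)]
    exact inferInstanceAs (I.cochainComplex.IsStrictlyGE 0)
  let L : CochainComplex.Plus (InjectiveObject C) := ⟨L', 0, hL'⟩
  let e₀ := asIso (DerivedCategory.Q.map I.ι')
  let e : (DerivedCategory.Plus.singleFunctor C 0).obj X ≅
      DerivedCategory.Plus.Qh.obj ((HomotopyCategory.Plus.quotient C).obj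
        ((InjectiveObject.ι C).mapCochainComplexPlus.obj L)) :=
    DerivedCategory.Plus.ι.preimageIso
      ((DerivedCategory.singleFunctorIsoCompQ C 0).app X ≪≫ e₀)
  let f := F.rightDerivedFunctorPlus.mapIso e ≪≫
    (asIso (F.rightDerivedFunctorPlusUnit.app
      ((HomotopyCategory.Plus.quotient C).obj
        ((InjectiveObject.ι C).mapCochainComplexPlus.obj L)))).symm
  exact ⟨DerivedCategory.Plus.ι.mapIso f⟩

theorem nonempty_rightDerivedFunctorPlus_iso_singleFunctor_iff (n : ℤ) (Y : D) :
    Nonempty (F.rightDerivedFunctorPlus.obj ((DerivedCategory.Plus.singleFunctor C 0).obj X) ≅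
      (DerivedCategory.Plus.singleFunctor D n).obj Y) ↔
      (∀ i, i ≠ n → ((F.mapHomologicalComplex (.up ℤ)).obj I.cochainComplex).ExactAt i) ∧
        Nonempty (((F.mapHomologicalComplex (.up ℤ)).obj I.cochainComplex).homology n ≅ Y) := by
  rw [← nonempty_iso_singleFunctor_iff]
  obtain ⟨e⟩ := nonempty_rightDerivedFunctorPlus_iso F I
  constructor
  · rintro ⟨f⟩
    exact ⟨e.symm ≪≫ DerivedCategory.Plus.ι.mapIso f⟩
  · rintro ⟨f⟩
    exact ⟨DerivedCategory.Plus.ι.preimageIso (e ≪≫ f)⟩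

end Derived

/-! ### Cohomology of complexes of modules in terms of elements -/

section Concrete

variable {R : Type u} [Ring R]

/-- Coboundaries of a cochain complex vanishing in negative degrees. -/
def IsCob (K : CochainComplex (ModuleCat.{u} R) ℤ) : (q : ℕ) → K.X q → Prop
  | 0, x => x = 0
  | q + 1, x => ∃ y : K.X (q : ℤ), (K.d (q : ℤ) ((q + 1 : ℕ) : ℤ)).hom y = x

/-- In degree zero the incoming differential starts from the zero module, so only zero is a
coboundary. -/
lemma isCob_iff (K : CochainComplex (ModuleCat.{u} R) ℤ) [K.IsStrictlyGE 0] (q : ℕ) (x : K.X q) :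
    IsCob K q x ↔ ∃ y : K.X (q - 1 : ℤ), (K.d (q - 1 : ℤ) q).hom y = x := by
  cases q with
  | zero =>
    have : Subsingleton (K.X ((0 : ℕ) - 1 : ℤ)) :=
      ModuleCat.subsingleton_of_isZero (K.isZero_of_isStrictlyGE 0 _ (by simp))
    constructor
    · intro h
      exact ⟨0, (map_zero _).trans (show x = 0 from h).symm⟩
    · rintro ⟨y, rfl⟩
      change _ = _
      rw [Subsingleton.elim y 0, map_zero]
  | succ q =>
    have e : ((q + 1 : ℕ) : ℤ) - 1 = q := by push_cast; ring
    generalize ((q + 1 : ℕ) : ℤ) - 1 = m at e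
    subst e
    exact Iff.rfl

/-- The first isomorphism theorem: an isomorphism from homology is a surjection from the cycles
whose kernel is the module of boundaries. This form avoids working with quotients. -/
lemma nonempty_homology_iso_iff (T : ShortComplex (ModuleCat.{u} R)) (Y : ModuleCat.{u} R) :
    Nonempty (T.homology ≅ Y) ↔ ∃ φ : LinearMap.ker T.g.hom →ₗ[R] Y, Function.Surjective φ ∧
        ∀ x, φ x = 0 ↔ ∃ y, T.f.hom y = x := by
  have hmem (x : LinearMap.ker T.g.hom) :
      x ∈ LinearMap.range T.moduleCatToCycles ↔ ∃ y, T.f.hom y = x := by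
    constructor
    · rintro ⟨y, rfl⟩
      exact ⟨y, rfl⟩
    · rintro ⟨y, h⟩
      exact ⟨y, Subtype.ext h⟩
  constructor
  · rintro ⟨f⟩
    let g : (LinearMap.ker T.g.hom ⧸ LinearMap.range T.moduleCatToCycles) ≃ₗ[R] Y :=
      (T.moduleCatHomologyIso.symm ≪≫ f).toLinearEquiv
    refine ⟨g.toLinearMap ∘ₗ Submodule.mkQ _, g.surjective.comp (Submodule.mkQ_surjective _),
      fun x => ?_⟩
    rw [← hmem, LinearMap.comp_apply, LinearEquiv.coe_coe, LinearEquiv.map_eq_zero_iff,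
      Submodule.mkQ_apply, Submodule.Quotient.mk_eq_zero]
  · rintro ⟨φ, hφ, hk⟩
    have hker : LinearMap.ker φ = LinearMap.range T.moduleCatToCycles := by
      ext x
      rw [hmem, LinearMap.mem_ker]
      exact hk x
    exact ⟨T.moduleCatHomologyIso ≪≫ (((Submodule.quotEquivOfEq _ _ hker.symm).trans
      (φ.quotKerEquivOfSurjective hφ)).toModuleIso)⟩

lemma exactAt_and_homology_iff (K : CochainComplex (ModuleCat.{u} R) ℤ) [K.IsStrictlyGE 0]
    (ℓ : ℕ) (Y : ModuleCat.{u} R) :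
    ((∀ i, i ≠ (ℓ : ℤ) → K.ExactAt i) ∧ Nonempty (K.homology ℓ ≅ Y)) ↔
      (∀ q : ℕ, q ≠ ℓ → ∀ x : K.X (q : ℤ), (K.d q ((q + 1 : ℕ) : ℤ)).hom x = 0 → IsCob K q x) ∧
      ∃ φ : LinearMap.ker (K.d ℓ ((ℓ + 1 : ℕ) : ℤ)).hom →ₗ[R] Y, Function.Surjective φ ∧
        ∀ x, φ x = 0 ↔ IsCob K ℓ x := by
  have h1 (q : ℕ) : K.ExactAt q ↔
      ∀ x : K.X (q : ℤ), (K.d q ((q + 1 : ℕ) : ℤ)).hom x = 0 → IsCob K q x := by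
    rw [K.exactAt_iff' (q - 1) q ((q + 1 : ℕ) : ℤ) (by simp) (by simp),
      ShortComplex.moduleCat_exact_iff]
    simp only [isCob_iff]
    rfl
  have hneg (i : ℤ) (hi : i < 0) : K.ExactAt i := by
    rw [HomologicalComplex.exactAt_iff]
    exact ShortComplex.exact_of_isZero_X₂ _ (K.isZero_of_isStrictlyGE 0 _ hi)
  refine and_congr ⟨fun h q hq => (h1 q).1 (h q (by exact_mod_cast hq)), fun h i hi => ?_⟩ ?_
  · by_cases h0 : i < 0
    · exact hneg i h0
    · lift i to ℕ using (by lia)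
      exact (h1 i).2 (h i (by exact_mod_cast hi))
  · have e : K.homology ℓ ≅ (K.sc' (ℓ - 1) ℓ ((ℓ + 1 : ℕ) : ℤ)).homology :=
      ShortComplex.homologyMapIso (K.isoSc' (ℓ - 1) ℓ ((ℓ + 1 : ℕ) : ℤ) (by simp) (by simp))
    rw [show Nonempty (K.homology ℓ ≅ Y) ↔
      Nonempty ((K.sc' (ℓ - 1) ℓ ((ℓ + 1 : ℕ) : ℤ)).homology ≅ Y) from
      ⟨fun ⟨f⟩ => ⟨e.symm ≪≫ f⟩, fun ⟨f⟩ => ⟨e ≪≫ f⟩⟩, nonempty_homology_iso_iff]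
    simp only [isCob_iff]
    rfl

end Concrete

/-! ### Exactness of injective resolutions, in terms of elements -/

section Resolution

variable {R : Type u} [Ring R] {N : ModuleCat.{u} R} (I : InjectiveResolution N)

/-- The augmentation of an injective resolution. -/
def resAug : N →ₗ[R] I.cochainComplex.X ((0 : ℕ) : ℤ) :=
  (I.ι.f 0 ≫ (I.cochainComplexXIso ((0 : ℕ) : ℤ) 0 rfl).inv).hom

lemma resAug_injective : Function.Injective (resAug I) := by
  have : Mono (I.ι.f 0) := inferInstance
  exact (ModuleCat.mono_iff_injective _).1 (mono_comp (I.ι.f 0) (I.cochainComplexXIso ((0 : ℕ) : ℤ) 0 rfl).inv)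

lemma resD_eq (q : ℕ) (x : I.cochainComplex.X (q : ℤ)) :
    (I.cochainComplex.d q ((q + 1 : ℕ) : ℤ)).hom x =
      (I.cochainComplexXIso ((q + 1 : ℕ) : ℤ) (q + 1) rfl).inv.hom
        ((I.cocomplex.d q (q + 1)).hom ((I.cochainComplexXIso (q : ℤ) q rfl).hom.hom x)) := by
  rw [I.cochainComplex_d (q : ℤ) ((q + 1 : ℕ) : ℤ) q (q + 1) rfl rfl]
  rfl

lemma exact_of_conj {X Y Z X' Y' Z' : Type*} [AddCommGroup X] [AddCommGroup Y] [AddCommGroup Z]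
    [AddCommGroup X'] [AddCommGroup Y'] [AddCommGroup Z'] {f : X → Y} {g : Y → Z}
    {f' : X' → Y'} {g' : Y' → Z'} (h : Function.Exact f' g') (a : X → X') (b : Y ≃+ Y')
    (c : Z' ≃+ Z) (ha : Function.Surjective a) (hf : ∀ x, b (f x) = f' (a x))
    (hg : ∀ y, g y = c (g' (b y))) : Function.Exact f g := by
  intro y
  rw [hg, AddEquiv.map_eq_zero_iff, h (b y)]
  constructor
  · rintro ⟨x', hx⟩
    obtain ⟨x, rfl⟩ := ha x'
    exact ⟨x, b.injective ((hf x).trans hx)⟩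
  · rintro ⟨x, rfl⟩
    exact ⟨a x, (hf x).symm⟩

lemma resAug_exact : Function.Exact (resAug I)
    (I.cochainComplex.d ((0 : ℕ) : ℤ) ((0 + 1 : ℕ) : ℤ)).hom := by
  have h : Function.Exact (I.ι.f 0).hom (I.cocomplex.d 0 1).hom :=
    (ShortComplex.ShortExact.moduleCat_exact_iff_function_exact
      (ShortComplex.mk (I.ι.f 0) (I.cocomplex.d 0 1) I.ι_f_zero_comp_complex_d)).1
      (ShortComplex.exact_of_f_is_kernel _ I.isLimitKernelFork)
  refine exact_of_conj h id (I.cochainComplexXIso ((0 : ℕ) : ℤ) 0 rfl).toLinearEquiv.toAddEquiv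
    (I.cochainComplexXIso ((0 + 1 : ℕ) : ℤ) (0 + 1) rfl).symm.toLinearEquiv.toAddEquiv
    Function.surjective_id (fun x => ?_) (fun y => resD_eq I 0 y)
  exact (I.cochainComplexXIso ((0 : ℕ) : ℤ) 0 rfl).toLinearEquiv.apply_symm_apply _

lemma resD_exact (q : ℕ) : Function.Exact (I.cochainComplex.d q ((q + 1 : ℕ) : ℤ)).hom
    (I.cochainComplex.d ((q + 1 : ℕ) : ℤ) ((q + 1 + 1 : ℕ) : ℤ)).hom := by
  have h : Function.Exact (I.cocomplex.d q (q + 1)).hom (I.cocomplex.d (q + 1) (q + 2)).hom :=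
    (ShortComplex.ShortExact.moduleCat_exact_iff_function_exact _).1 (I.exact_succ q)
  refine exact_of_conj h (I.cochainComplexXIso (q : ℤ) q rfl).toLinearEquiv
    (I.cochainComplexXIso ((q + 1 : ℕ) : ℤ) (q + 1) rfl).toLinearEquiv.toAddEquiv
    (I.cochainComplexXIso ((q + 1 + 1 : ℕ) : ℤ) (q + 1 + 1) rfl).symm.toLinearEquiv.toAddEquiv
    (LinearEquiv.surjective _) (fun x => ?_) (fun y => resD_eq I (q + 1) y)
  rw [resD_eq]
  exact (I.cochainComplexXIso ((q + 1 : ℕ) : ℤ) (q + 1) rfl).toLinearEquiv.apply_symm_apply _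

end Resolution

/-! ### Restriction of scalars of an injective resolution -/

section Restrict

variable {S R : Type u} [CommRing S] [Ring R] (φ : S →+* R)

/-- The restriction of scalars of a module along a ring homomorphism. -/
@[reducible] def resModule (N : ModuleCat.{u} R) : Module S N := Module.compHom N φ

/-- The restriction of scalars of a linear map. -/
def resLin {N N' : ModuleCat.{u} R} (f : N →ₗ[R] N') :
    letI := resModule φ N; letI := resModule φ N'; N →ₗ[S] N' :=
  letI := resModule φ N; letI := resModule φ N'
  { toFun := f, map_add' := map_add f, map_smul' := fun s n => map_smul f (φ s) n }

/-- The differential of an injective resolution, after restriction of scalars. -/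
def resD {N : ModuleCat.{u} R} (I : InjectiveResolution N) (q : ℕ) :
    letI := resModule φ (I.cochainComplex.X (q : ℤ))
    letI := resModule φ (I.cochainComplex.X ((q + 1 : ℕ) : ℤ))
    I.cochainComplex.X (q : ℤ) →ₗ[S] I.cochainComplex.X ((q + 1 : ℕ) : ℤ) :=
  resLin φ (I.cochainComplex.d q ((q + 1 : ℕ) : ℤ)).hom

/-- The augmentation of an injective resolution, after restriction of scalars. -/
def resE {N : ModuleCat.{u} R} (I : InjectiveResolution N) (e : S ≃+ N)
    (he : ∀ s t, e (s * t) = φ s • e t) :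
    letI := resModule φ (I.cochainComplex.X ((0 : ℕ) : ℤ))
    S →ₗ[S] I.cochainComplex.X ((0 : ℕ) : ℤ) :=
  letI := resModule φ (I.cochainComplex.X ((0 : ℕ) : ℤ))
  { toFun := fun s => resAug I (e s)
    map_add' := fun s t => by rw [map_add, map_add]
    map_smul' := fun s t => by
      rw [smul_eq_mul, he, map_smul]; rfl }

/-- Exactness does not depend on the scalars; the preservation of injectivity is the hypothesis
`hφ`, later supplied by flatness of U(A)ᵉ. -/
lemma isInjRes_of_resolution {N : ModuleCat.{u} R} (I : InjectiveResolution N) (e : S ≃+ N)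
    (he : ∀ s t, e (s * t) = φ s • e t)
    (hφ : ∀ M : ModuleCat.{u} R, Module.Injective R M → @Module.Injective S _ M _ (resModule φ M)) :
    letI := fun q : ℕ => resModule φ (I.cochainComplex.X (q : ℤ))
    IsInjRes (J := fun q : ℕ => I.cochainComplex.X (q : ℤ)) (resD φ I) (resE φ I e he) :=
  letI := fun q : ℕ => resModule φ (I.cochainComplex.X (q : ℤ))
  { injective := fun q => hφ _ (by
      have : Injective (ModuleCat.of R (I.cochainComplex.X (q : ℤ))) :=
        inferInstanceAs (Injective (I.cochainComplex.X (q : ℤ)))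
      exact Module.injective_module_of_injective_object R _)
    mono := (resAug_injective I).comp e.injective
    exact_zero := exact_of_conj (resAug_exact I) e (AddEquiv.refl _) (AddEquiv.refl _) e.surjective
      (fun _ => rfl) (fun _ => rfl)
    exact := fun q => resD_exact I q }

end Restrict

/-! ### Poisson bimodules as modules over Aᵉ with Hamiltonian operators -/

section Bimod

variable (k A : Type u) [Field k] [CommRing A] [Algebra k A] [PoissonAlgebra k A]

attribute [local instance] SA.algebra SA.moduleΩ bimodK invModule

/-- A Poisson bimodule as a module over `Aᵉ`. -/
@[reducible] def bimodSA (N : PBimod k A) : Module (SA k A) N :=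
  resModule (SA.toUEnvE k A).toRingHom N

attribute [local instance] bimodSA

lemma bimodSA_smul (N : PBimod k A) (a b : A) (n : N) : (a ⊗ₜ[k] op b : SA k A) • n =
    inL k A (UEnv.M k A a) • inR k A (UEnv.M k A b) • n := by
  rw [← mul_smul, Algebra.TensorProduct.tmul_mul_tmul, mul_one, one_mul]
  rfl

/-- Modulo these generators every tensor is congruent to its product: a ⊗ b - ab ⊗ 1 = -(a ⊗ 1)(b ⊗
1 - 1 ⊗ b). -/
lemma kerI_eq_span : kerI (SA k A) A =
    Ideal.span (Set.range fun a : A => (a ⊗ₜ op 1 - 1 ⊗ₜ op a : SA k A)) := by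
  refine le_antisymm (fun x hx => ?_) (Ideal.span_le.2 ?_)
  · have h : ∀ x : SA k A, x - (algebraMap (SA k A) A x) ⊗ₜ[k] op 1 ∈
        Ideal.span (Set.range fun a : A => (a ⊗ₜ op 1 - 1 ⊗ₜ op a : SA k A)) := by
      intro x
      induction x using TensorProduct.induction_on with
      | zero => simp
      | add x y hx hy =>
        rw [map_add, TensorProduct.add_tmul, add_sub_add_comm]
        exact add_mem hx hy
      | tmul a b =>
        obtain ⟨b, rfl⟩ := op_surjective b
        have : (a ⊗ₜ[k] op b - (algebraMap (SA k A) A (a ⊗ₜ op b)) ⊗ₜ[k] op 1 : SA k A) =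
            -((a ⊗ₜ[k] op 1 : SA k A) * (b ⊗ₜ[k] op 1 - 1 ⊗ₜ[k] op b)) := by
          rw [SA.algebraMap_tmul, mul_sub, Algebra.TensorProduct.tmul_mul_tmul,
            Algebra.TensorProduct.tmul_mul_tmul, ← op_mul, ← op_mul]
          simp
        rw [this]
        exact neg_mem (Ideal.mul_mem_left _ _ (Ideal.subset_span ⟨b, rfl⟩))
    have := h x
    rwa [(RingHom.mem_ker).1 hx, TensorProduct.zero_tmul, sub_zero] at this
  · rintro _ ⟨a, rfl⟩
    change algebraMap (SA k A) A _ = 0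
    rw [map_sub, SA.algebraMap_tmul, SA.algebraMap_tmul]
    simp

lemma mem_homSub_iff (N : PBimod k A) (n : N) : n ∈ homSub k A N ↔ KillI (kerI (SA k A) A) n := by
  rw [kerI_eq_span, killI_span_iff]
  simp only [Set.forall_mem_range, sub_smul, bimodSA_smul, UEnv.M_one, sub_eq_zero]
  have h1 : inL k A (1 : UEnv k A) = 1 := rfl
  have h2 : inR k A (1 : UEnv k A) = 1 := rfl
  simp only [h1, h2, one_smul]
  rfl

/-- The operator `n ↦ n H_a - H_a n` on a Poisson bimodule. -/
def bimodH (N : PBimod k A) (a : A) : N →+ N :=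
  DistribSMul.toAddMonoidHom N (inR k A (UEnv.H k A a) - inL k A (UEnv.H k A a))

lemma bimodH_apply (N : PBimod k A) (a : A) (n : N) :
    bimodH k A N a n = (inR k A (UEnv.H k A a) - inL k A (UEnv.H k A a)) • n := rfl

/-- The commutator with 1 ⊗ H_a - H_a ⊗ 1 preserves the image of Aᵉ, by the relation for M_{{a, b}},
and induces the derivation `SA.lie` there. -/
lemma toUEnvE_lie (a : A) (s : SA k A) : SA.toUEnvE k A (SA.lie k A a s) =
    (inR k A (UEnv.H k A a) - inL k A (UEnv.H k A a)) * SA.toUEnvE k A s -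
      SA.toUEnvE k A s * (inR k A (UEnv.H k A a) - inL k A (UEnv.H k A a)) := by
  induction s using TensorProduct.induction_on with
  | zero => simp
  | add x y hx hy => simp only [map_add, hx, hy, mul_add, add_mul]; abel
  | tmul x y =>
    obtain ⟨y, rfl⟩ := op_surjective y
    rw [SA.lie_tmul, map_neg, map_add, SA.toUEnvE_tmul, SA.toUEnvE_tmul, SA.toUEnvE_tmul,
      UEnv.M_pb, UEnv.M_pb]
    simp only [inL, inR, sub_mul, mul_sub, Algebra.TensorProduct.tmul_mul_tmul, one_mul, mul_one,
      MulOpposite.op_sub, MulOpposite.op_mul, TensorProduct.sub_tmul, TensorProduct.tmul_sub]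
    abel

lemma bimodH_smul (N : PBimod k A) (a : A) (s : SA k A) (n : N) :
    bimodH k A N a (s • n) = s • bimodH k A N a n + SA.lie k A a s • n := by
  change (inR k A (UEnv.H k A a) - inL k A (UEnv.H k A a)) • SA.toUEnvE k A s • n =
    SA.toUEnvE k A s • (inR k A (UEnv.H k A a) - inL k A (UEnv.H k A a)) • n +
      SA.toUEnvE k A (SA.lie k A a s) • n
  rw [toUEnvE_lie, ← mul_smul, ← mul_smul, ← add_smul]
  congr 1
  abel

/-- `Aᵉ` as a free module of rank one over itself. -/
def SA.envEquiv : SA k A ≃+ envBimod k A := (SA.equiv k A).toAddEquiv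

lemma envBimod_smul (x y : UEnv k A) (a b : A) :
    (x ⊗ₜ op y : UEnvE k A) • SA.envEquiv k A (a ⊗ₜ op b) =
      (leftAct k A x a) ⊗ₜ[k] (rightAct k A (op y) b) := rfl

lemma leftAct_M (a x : A) : leftAct k A (UEnv.M k A a) x = a * x := by
  rw [leftAct, UEnv.lift_M]; rfl

lemma leftAct_H (a x : A) : leftAct k A (UEnv.H k A a) x = pb k A a x := by
  rw [leftAct, UEnv.lift_H]

lemma rightAct_M (a x : A) : rightAct k A (op (UEnv.M k A a)) x = a * x := by
  change unop (UEnv.lift (B := (Module.End k A)ᵐᵒᵖ) _ _ _ _ _ _ _ (UEnv.M k A a)) x = _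
  rw [UEnv.lift_M]; rfl

lemma rightAct_H (a x : A) : rightAct k A (op (UEnv.H k A a)) x = pb k A x a := by
  change unop (UEnv.lift (B := (Module.End k A)ᵐᵒᵖ) _ _ _ _ _ _ _ (UEnv.H k A a)) x = _
  rw [UEnv.lift_H]; rfl

lemma SA.envEquiv_mul (s t : SA k A) :
    SA.envEquiv k A (s * t) = (SA.toUEnvE k A).toRingHom s • SA.envEquiv k A t := by
  induction t using TensorProduct.induction_on with
  | zero => rw [mul_zero, map_zero, smul_zero]
  | add x y hx hy => rw [mul_add, map_add, map_add, smul_add, hx, hy]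
  | tmul c d =>
  induction s using TensorProduct.induction_on with
  | zero => rw [zero_mul, map_zero, map_zero]; exact (zero_smul (UEnvE k A) (SA.envEquiv k A (c ⊗ₜ[k] d))).symm
  | add x y hx hy => rw [add_mul, map_add, map_add, add_smul, hx, hy]
  | tmul a b =>
    obtain ⟨b, rfl⟩ := op_surjective b
    obtain ⟨d, rfl⟩ := op_surjective d
    have h := envBimod_smul k A (UEnv.M k A a) (UEnv.M k A b) c d
    rw [leftAct_M, rightAct_M] at h
    have h' : SA.envEquiv k A (a ⊗ₜ[k] op b * c ⊗ₜ[k] op d) = (a * c) ⊗ₜ[k] (d * b) := by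
      rw [Algebra.TensorProduct.tmul_mul_tmul, ← op_mul]; rfl
    rw [mul_comm b d] at h
    exact h'.trans h.symm

lemma SA.envEquiv_lie (a : A) (s : SA k A) :
    SA.envEquiv k A (SA.lie k A a s) = bimodH k A _ a (SA.envEquiv k A s) := by
  induction s using TensorProduct.induction_on with
  | zero => rw [map_zero, map_zero, map_zero]
  | add x y hx hy => rw [map_add, map_add, map_add, map_add, hx, hy]
  | tmul c d =>
    obtain ⟨d, rfl⟩ := op_surjective d
    rw [bimodH_apply, sub_smul]
    have h1 : inR k A (UEnv.H k A a) • SA.envEquiv k A (c ⊗ₜ op d) = c ⊗ₜ[k] pb k A d a := by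
      have h := envBimod_smul k A 1 (UEnv.H k A a) c d
      rw [rightAct_H, map_one] at h
      exact h
    have h2 : inL k A (UEnv.H k A a) • SA.envEquiv k A (c ⊗ₜ op d) = pb k A a c ⊗ₜ[k] d := by
      have h := envBimod_smul k A (UEnv.H k A a) 1 c d
      rw [leftAct_H, op_one, map_one] at h
      exact h
    rw [h1, h2, SA.lie_tmul, pb_skew k d a, TensorProduct.tmul_neg]
    change -(pb k A a c ⊗ₜ[k] d + c ⊗ₜ[k] pb k A a d) =
      -(c ⊗ₜ[k] pb k A a d) - (pb k A a c ⊗ₜ[k] d : A ⊗[k] A)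
    abel

end Bimod

section Tower

variable (k A : Type u) [Field k] [CommRing A] [Algebra k A]

attribute [local instance] SA.algebra SA.moduleΩ

/-- `IsScalarTower` for an algebra between commutative rings. -/
abbrev IsTower (S A Ω : Type u) [CommRing S] [CommRing A] [Algebra S A] [AddCommGroup Ω]
    [Module A Ω] [Module S Ω] : Prop := IsScalarTower S A Ω

lemma SA.isTower : IsTower (SA k A) A Ω[A⁄k] := SA.isScalarTowerΩ k A

end Tower

/-! ### The equivalence of (a) and (c) -/

section Bimod

variable (k A : Type u) [Field k] [CommRing A] [Algebra k A] [PoissonAlgebra k A]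

attribute [local instance] SA.algebra SA.moduleΩ bimodK invModule bimodSA

lemma map_smul_of_generators {M N : Type u} [AddCommGroup M] [AddCommGroup N]
    [Module (UEnv k A)ᵐᵒᵖ M] [Module (UEnv k A)ᵐᵒᵖ N] (f : M →+ N)
    (h1 : ∀ a m, f (op (UEnv.M k A a) • m) = op (UEnv.M k A a) • f m)
    (h2 : ∀ a m, f (op (UEnv.H k A a) • m) = op (UEnv.H k A a) • f m)
    (x : (UEnv k A)ᵐᵒᵖ) (m : M) : f (x • m) = x • f m := by
  obtain ⟨x, rfl⟩ := op_surjective x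
  induction x using UEnv.induction generalizing m with
  | hk c =>
    have : algebraMap k (UEnv k A) c = UEnv.M k A (algebraMap k A c) :=
      ((UEnv.MA k A).commutes c).symm
    rw [this]
    exact h1 _ m
  | hM a => exact h1 a m
  | hH a => exact h2 a m
  | hadd x y hx hy => rw [MulOpposite.op_add, add_smul, add_smul, map_add, hx, hy]
  | hmul x y hx hy => rw [MulOpposite.op_mul, mul_smul, mul_smul, hy, hx]

/-- The underlying group of the right Poisson module `A`. -/
def rightTrivEquiv : A ≃+ rightTriv k A := AddEquiv.refl A

lemma rightTriv_smul_M (a x : A) :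
    op (UEnv.M k A a) • rightTrivEquiv k A x = rightTrivEquiv k A (a * x) := rightAct_M k A a x

lemma rightTriv_smul_H (a x : A) :
    op (UEnv.H k A a) • rightTrivEquiv k A x = rightTrivEquiv k A (pb k A x a) :=
  rightAct_H k A a x

variable {A} in
lemma pb_one_right (a : A) : pb k A a 1 = 0 := (ham k A a).map_one_eq_zero

/-- The right action of `H_a` on `Hom(ω, A)`. -/
def lieHom {ℓ : ℕ} (a : A) (G : topForms k A ℓ →ₗ[A] A) : topForms k A ℓ →ₗ[A] A where
  toFun w := G (topBr k A ℓ a w) - pb k A a (G w)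
  map_add' w w' := by
    have h : topBr k A ℓ a (w + w') = topBr k A ℓ a w + topBr k A ℓ a w' := by
      rw [topBr, lieForm, map_add]; rfl
    rw [h, map_add, map_add, pb, map_add]
    abel
  map_smul' c w := by
    rw [topBr, lieForm_smul, map_add, map_smul, map_smul, map_smul, smul_eq_mul, smul_eq_mul,
      smul_eq_mul, pb_mul_right, RingHom.id_apply, smul_eq_mul, topBr]
    change _ + pb k A a c * G w - _ = _
    ring

variable (I : InjectiveResolution (envBimod k A))

/-- The complex `Hom_{Aᵉ}(A, J)` of an injective resolution `J`. -/
abbrev homCx : CochainComplex (RightPMod k A) ℤ :=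
  ((homEnv k A).mapHomologicalComplex (.up ℤ)).obj I.cochainComplex

/-- The differential of an injective resolution of `Aᵉ`. -/
abbrev bimodD (q : ℕ) : I.cochainComplex.X (q : ℤ) →ₗ[SA k A] I.cochainComplex.X ((q + 1 : ℕ) : ℤ) :=
  resD (SA.toUEnvE k A).toRingHom I q

/-- The augmentation of an injective resolution of `Aᵉ`. -/
abbrev bimodE : SA k A →ₗ[SA k A] I.cochainComplex.X ((0 : ℕ) : ℤ) :=
  resE (SA.toUEnvE k A).toRingHom I (SA.envEquiv k A) (SA.envEquiv_mul k A)

lemma isInjRes_bimod [CharZero k] [Algebra.Smooth k A] :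
    IsInjRes (J := fun q : ℕ => I.cochainComplex.X (q : ℤ)) (bimodD k A I) (bimodE k A I) :=
  isInjRes_of_resolution _ I _ _ fun _ _ => injective_bimod k A fun _ _ => rfl

lemma isCob_iff_cobI (q : ℕ) (x : (homCx k A I).X (q : ℤ)) :
    IsCob (homCx k A I) q x ↔ CobI (J := fun q : ℕ => I.cochainComplex.X (q : ℤ)) (bimodD k A I)
      (kerI (SA k A) A) q (x : homSub k A (I.cochainComplex.X (q : ℤ))).1 := by
  cases q with
  | zero =>
    exact (Subtype.ext_iff (a1 := (x : homSub k A (I.cochainComplex.X ((0 : ℕ) : ℤ)))) (a2 := 0))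
  | succ q =>
    constructor
    · rintro ⟨y, rfl⟩
      exact ⟨(y : homSub k A (I.cochainComplex.X (q : ℤ))).1, (mem_homSub_iff k A _ _).1
        (y : homSub k A (I.cochainComplex.X (q : ℤ))).2, rfl⟩
    · rintro ⟨y, hy, h⟩
      exact ⟨(⟨y, (mem_homSub_iff k A _ _).2 hy⟩ : homSub k A (I.cochainComplex.X (q : ℤ))),
        Subtype.ext h⟩

variable {ℓ : ℕ}

/-- The `ℓ`-cocycles of `Hom_{Aᵉ}(A, J)`. -/
abbrev homCocyc (ℓ : ℕ) : Submodule (UEnv k A)ᵐᵒᵖ ((homCx k A I).X (ℓ : ℤ)) :=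
  LinearMap.ker ((homCx k A I).d ℓ ((ℓ + 1 : ℕ) : ℤ)).hom

/-- The underlying element of a cocycle. -/
def homCocyc.val (ξ : homCocyc k A I ℓ) : I.cochainComplex.X (ℓ : ℤ) :=
  (ξ.1 : homSub k A (I.cochainComplex.X (ℓ : ℤ))).1

/-- The form `G : ω → A` represents the class of the cocycle `ξ`. -/
def HasForm (ξ : homCocyc k A I ℓ) (G : topForms k A ℓ →ₗ[A] A) : Prop :=
  IsForm (J := fun q : ℕ => I.cochainComplex.X (q : ℤ)) (bimodD k A I) (bimodE k A I)
    (SA.conormal k A) (homCocyc.val k A I ξ) (exteriorPower.alternatingMapLinearEquiv.symm G)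

variable {k A I}

lemma HasForm.add {ξ ξ' : homCocyc k A I ℓ} {G G' : topForms k A ℓ →ₗ[A] A}
    (h : HasForm k A I ξ G) (h' : HasForm k A I ξ' G') : HasForm k A I (ξ + ξ') (G + G') := by
  have := SA.isTower k A
  have := IsForm.add h h'
  rwa [← map_add] at this

lemma HasForm.smul_M {ξ : homCocyc k A I ℓ} {G : topForms k A ℓ →ₗ[A] A}
    (h : HasForm k A I ξ G) (a : A) : HasForm k A I (op (UEnv.M k A a) • ξ) (a • G) := by
  have := SA.isTower k A
  have h1 := IsForm.smul h (1 ⊗ₜ[k] op a)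
  rw [SA.algebraMap_tmul, one_mul, ← map_smul] at h1
  have h2 : homCocyc.val k A I (op (UEnv.M k A a) • ξ) =
      (1 ⊗ₜ[k] op a : SA k A) • homCocyc.val k A I ξ := by
    rw [bimodSA_smul, UEnv.M_one]
    refine Eq.trans ?_ (one_smul (UEnvE k A) _).symm
    change ((invAct k A _ (op (UEnv.M k A a))) (ξ.1 : homSub k A (I.cochainComplex.X (ℓ : ℤ)))).1 = _
    rw [invAct_M]
    rfl
  rw [HasForm, h2]
  exact h1

/-- Naturality of forms under derivations, for n ↦ n H_a - H_a n on the resolution, `SA.lie` on Aᵉ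
and -{a, -} on A. The sign in `SA.conormal_lieI` turns the sum over the arguments into the Lie
derivative of a top form. -/
lemma HasForm.smul_H {ξ : homCocyc k A I ℓ} {G : topForms k A ℓ →ₗ[A] A}
    (h : HasForm k A I ξ G) (a : A) : HasForm k A I (op (UEnv.H k A a) • ξ) (lieHom k A a G) := by
  have h2 : homCocyc.val k A I (op (UEnv.H k A a) • ξ) =
      bimodH k A _ a (homCocyc.val k A I ξ) := by
    change ((invAct k A _ (op (UEnv.H k A a))) (ξ.1 : homSub k A (I.cochainComplex.X (ℓ : ℤ)))).1 = _
    rw [invAct_H]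
    rfl
  rw [HasForm, h2]
  have := SA.isTower k A
  refine IsForm.lie (J := fun q : ℕ => I.cochainComplex.X (q : ℤ)) h
    (SA.lie k A a).toAddMonoidHom (SA.lieI k A a) (fun _ => rfl)
    (fun q => bimodH k A (I.cochainComplex.X (q : ℤ)) a) (fun q s m => bimodH_smul k A _ a s m)
    (fun q m => map_smul (I.cochainComplex.d q ((q + 1 : ℕ) : ℤ)).hom _ m)
    (fun n => ?_) (fun x => -pb k A a x) (fun s => (SA.algebraMap_lie k A a s).symm) _ fun v => ?_
  · change resAug I (SA.envEquiv k A (SA.lie k A a n)) = _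
    rw [SA.envEquiv_lie]
    exact map_smul (resAug I) (inR k A (UEnv.H k A a) - inL k A (UEnv.H k A a)) (SA.envEquiv k A n)
  · change G (topBr k A ℓ a (exteriorPower.ιMulti A ℓ _)) -
      pb k A a (G (exteriorPower.ιMulti A ℓ _)) =
      -pb k A a (G (exteriorPower.ιMulti A ℓ _)) - ∑ i, G (exteriorPower.ιMulti A ℓ _)
    rw [topBr, lieForm_ιMulti, map_sum, sub_eq_neg_add, sub_eq_add_neg, ← Finset.sum_neg_distrib]
    congr 1
    refine Finset.sum_congr rfl fun i _ => ?_
    have : ⇑(SA.conormal k A) ∘ Function.update v i (SA.lieI k A a (v i)) =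
        Function.update (⇑(SA.conormal k A) ∘ v) i (-lieΩ (ham k A a) (SA.conormal k A (v i))) := by
      rw [Function.comp_update, SA.conormal_lieI]
    rw [this, AlternatingMap.map_update_neg, map_neg, neg_neg]
    rfl

variable [CharZero k] [Algebra.Smooth k A] (hℓ : ∀ p ∈ minimalPrimes A, ringKrullDim (A ⧸ p) = ℓ)

include hℓ

lemma homCx_exact (q : ℕ) (hq : q ≠ ℓ) (x : (homCx k A I).X (q : ℤ))
    (hx : ((homCx k A I).d q ((q + 1 : ℕ) : ℤ)).hom x = 0) : IsCob (homCx k A I) q x := by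
  have := SA.isNoetherianRing k A
  rw [isCob_iff_cobI]
  exact (isInjRes_bimod k A I).cobI (SA.isLocallyRegular k A hℓ) hq _
    ((mem_homSub_iff k A _ _).1 (x : homSub k A (I.cochainComplex.X (q : ℤ))).2)
    (congrArg (fun y : homSub k A (I.cochainComplex.X ((q + 1 : ℕ) : ℤ)) => y.1) hx)

omit hℓ [CharZero k] [Algebra.Smooth k A] in
lemma homCocyc.killI (ξ : homCocyc k A I ℓ) : KillI (kerI (SA k A) A) (homCocyc.val k A I ξ) :=
  (mem_homSub_iff k A _ _).1 (ξ.1 : homSub k A (I.cochainComplex.X (ℓ : ℤ))).2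

omit hℓ [CharZero k] [Algebra.Smooth k A] in
lemma homCocyc.d_val (ξ : homCocyc k A I ℓ) : bimodD k A I ℓ (homCocyc.val k A I ξ) = 0 :=
  congrArg (fun y : homSub k A (I.cochainComplex.X ((ℓ + 1 : ℕ) : ℤ)) => y.1) ξ.2

lemma exists_hasForm (ξ : homCocyc k A I ℓ) : ∃ G, HasForm k A I ξ G := by
  have := SA.isTower k A
  have := SA.isNoetherianRing k A
  obtain ⟨g, hg⟩ := exists_isForm (J := fun q : ℕ => I.cochainComplex.X (q : ℤ))
    (isInjRes_bimod k A I) (SA.isLocallyRegular k A hℓ) (SA.isConormal k A) (homCocyc.killI ξ)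
    (homCocyc.d_val ξ)
  exact ⟨exteriorPower.alternatingMapLinearEquiv g, by
    rwa [HasForm, LinearEquiv.symm_apply_apply]⟩

omit hℓ in
lemma HasForm.unique {ξ : homCocyc k A I ℓ} {G G' : topForms k A ℓ →ₗ[A] A}
    (h : HasForm k A I ξ G) (h' : HasForm k A I ξ G') : G = G' := by
  have := SA.isTower k A
  exact exteriorPower.alternatingMapLinearEquiv.symm.injective
    (IsForm.unique (isInjRes_bimod k A I) (SA.isConormal k A) h h')

lemma HasForm.eq_zero_iff {ξ : homCocyc k A I ℓ} {G : topForms k A ℓ →ₗ[A] A}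
    (h : HasForm k A I ξ G) : G = 0 ↔ IsCob (homCx k A I) ℓ ξ.1 := by
  have := SA.isTower k A
  have := SA.isNoetherianRing k A
  rw [isCob_iff_cobI]
  constructor
  · rintro rfl
    rw [HasForm, map_zero] at h
    exact IsForm.cobI (isInjRes_bimod k A I) (SA.isLocallyRegular k A hℓ) (homCocyc.killI ξ)
      (homCocyc.d_val ξ) h
  · intro hc
    exact exteriorPower.alternatingMapLinearEquiv.symm.injective
      ((IsForm.eq_zero_of_cobI (isInjRes_bimod k A I) (SA.isConormal k A) h hc).trans
        (map_zero _).symm)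

lemma exists_hasForm_eq (G : topForms k A ℓ →ₗ[A] A) :
    ∃ ξ : homCocyc k A I ℓ, HasForm k A I ξ G := by
  have := SA.isTower k A
  have := SA.isNoetherianRing k A
  obtain ⟨ξ, h1, h2, h3⟩ := exists_isForm_eq (J := fun q : ℕ => I.cochainComplex.X (q : ℤ))
    (isInjRes_bimod k A I) (SA.isLocallyRegular k A hℓ) (SA.isConormal k A)
    (exteriorPower.alternatingMapLinearEquiv.symm G)
  exact ⟨⟨(⟨ξ, (mem_homSub_iff k A _ _).2 h1⟩ : homSub k A (I.cochainComplex.X (ℓ : ℤ))),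
    Subtype.ext h2⟩, h3⟩

lemma bijective_of_forall_smul (G : topForms k A ℓ →ₗ[A] A)
    (hG : ∀ G' : topForms k A ℓ →ₗ[A] A, ∃ a : A, G' = a • G) : Function.Bijective G := by
  have := SA.isTower k A
  have := SA.isNoetherianRing k A
  -- The statement involves no resolution; one is chosen to have the local description of
  -- `IsInjRes.exists_local`.
  obtain ⟨I⟩ := (inferInstance : HasInjectiveResolution (envBimod k A)).out
  have := bijective_of_forall_eq_smul (isInjRes_bimod k A I) (SA.isLocallyRegular k A hℓ)
    (SA.isConormal k A) (exteriorPower.alternatingMapLinearEquiv.symm G) fun g' => by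
      obtain ⟨a, ha⟩ := hG (exteriorPower.alternatingMapLinearEquiv g')
      exact ⟨a, by rw [← map_smul, ← ha, LinearEquiv.symm_apply_apply]⟩
  rwa [LinearEquiv.apply_symm_apply] at this

-- The map sends a class to the value of its form at `w = e⁻¹(1)`. It respects H_a because {a, w} =
-- 0, and its kernel consists of coboundaries because `w` generates the top forms.
variable (I) in
lemma exists_homCocyc_map (h : IsHomologicallyUnimodular k A ℓ) :
    ∃ φ : homCocyc k A I ℓ →ₗ[(UEnv k A)ᵐᵒᵖ] rightTriv k A, Function.Surjective φ ∧
      ∀ ξ, φ ξ = 0 ↔ IsCob (homCx k A I) ℓ ξ.1 := by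
  obtain ⟨e, he⟩ := h
  choose F hF using exists_hasForm (I := I) hℓ
  let w := e.symm 1
  have hw (a : A) : topBr k A ℓ a w = 0 := by
    apply e.injective
    rw [he, map_zero, LinearEquiv.apply_symm_apply, pb_one_right]
  have hF_add ξ ξ' : F (ξ + ξ') = F ξ + F ξ' := (hF _).unique ((hF ξ).add (hF ξ'))
  have hgen (G : topForms k A ℓ →ₗ[A] A) (v) : G v = e v * G w := by
    rw [← smul_eq_mul, ← map_smul]
    congr 1
    apply e.injective
    rw [map_smul, LinearEquiv.apply_symm_apply, smul_eq_mul, mul_one]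
  let f : homCocyc k A I ℓ →+ rightTriv k A :=
    AddMonoidHom.mk' (fun ξ => rightTrivEquiv k A (F ξ w)) fun ξ ξ' => by
      rw [hF_add, LinearMap.add_apply, map_add]
  have hf (ξ) : f ξ = rightTrivEquiv k A (F ξ w) := rfl
  have hs := map_smul_of_generators k A f
    (fun a ξ => by
      rw [hf, hf, rightTriv_smul_M, (hF _).unique ((hF ξ).smul_M a)]
      rfl)
    (fun a ξ => by
      rw [hf, hf, rightTriv_smul_H, (hF _).unique ((hF ξ).smul_H a)]
      change rightTrivEquiv k A (F ξ (topBr k A ℓ a w) - pb k A a (F ξ w)) = _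
      rw [hw, map_zero, zero_sub, ← pb_skew])
  refine ⟨{ toFun := f, map_add' := map_add f, map_smul' := hs }, fun x => ?_, fun ξ => ?_⟩
  · obtain ⟨x, rfl⟩ := (rightTrivEquiv k A).surjective x
    obtain ⟨ξ, hξ⟩ := exists_hasForm_eq (I := I) hℓ (x • e.toLinearMap)
    refine ⟨ξ, ?_⟩
    change rightTrivEquiv k A (F ξ w) = _
    rw [(hF _).unique hξ]
    congr 1
    change x * e (e.symm 1) = _
    rw [LinearEquiv.apply_symm_apply, mul_one]
  · rw [← (hF ξ).eq_zero_iff hℓ]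
    change F ξ w = 0 ↔ _
    refine ⟨fun h => LinearMap.ext fun v => ?_, fun h => by rw [h]; rfl⟩
    rw [hgen, h, mul_zero]; rfl

/-- A cocycle mapped to 1 has a form that generates all forms, hence is bijective. Since {1, a} = 0,
the bracket of this class with `a` is a coboundary; the vanishing of its form says that G commutes
with the brackets. -/
lemma isHomologicallyUnimodular_of_map
    (φ : homCocyc k A I ℓ →ₗ[(UEnv k A)ᵐᵒᵖ] rightTriv k A) (hφ : Function.Surjective φ)
    (hk : ∀ ξ, φ ξ = 0 ↔ IsCob (homCx k A I) ℓ ξ.1) : IsHomologicallyUnimodular k A ℓ := by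
  obtain ⟨ξ, hξ⟩ := hφ (rightTrivEquiv k A 1)
  obtain ⟨G, hG⟩ := exists_hasForm hℓ ξ
  have hbij : Function.Bijective G := by
    refine bijective_of_forall_smul hℓ G fun G' => ?_
    obtain ⟨ξ', hξ'⟩ := exists_hasForm_eq (I := I) hℓ G'
    obtain ⟨a, ha⟩ := (rightTrivEquiv k A).surjective (φ ξ')
    refine ⟨a, LinearMap.ext fun w => ?_⟩
    have h1 : φ (ξ' + op (UEnv.M k A (-a)) • ξ) = 0 := by
      rw [map_add, map_smul, hξ, rightTriv_smul_M, ← ha, ← map_add, mul_one, add_neg_cancel,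
        map_zero]
    have h2 := ((hξ'.add (hG.smul_M (-a))).eq_zero_iff hℓ).2 ((hk _).1 h1)
    have h3 : G' w + -a * G w = 0 := LinearMap.congr_fun h2 w
    change G' w = a * G w
    linear_combination h3
  refine ⟨LinearEquiv.ofBijective G hbij, fun a w => ?_⟩
  have h1 : φ (op (UEnv.H k A a) • ξ) = 0 := by
    rw [map_smul, hξ, rightTriv_smul_H, pb_skew, pb_one_right, neg_zero, map_zero]
  have h2 := ((hG.smul_H a).eq_zero_iff hℓ).2 ((hk _).1 h1)
  exact sub_eq_zero.1 (LinearMap.congr_fun h2 w)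

theorem nonempty_rhomEnv_iso_iff [HasDerivedCategory (PBimod k A)]
    [HasDerivedCategory (RightPMod k A)] :
    Nonempty (rhomEnv k A ≅ (DerivedCategory.Plus.singleFunctor (RightPMod k A) (ℓ : ℤ)).obj
      (rightTriv k A)) ↔ IsHomologicallyUnimodular k A ℓ := by
  obtain ⟨I⟩ := (inferInstance : HasInjectiveResolution (envBimod k A)).out
  rw [rhomEnv, nonempty_rightDerivedFunctorPlus_iso_singleFunctor_iff (homEnv k A) I,
    exactAt_and_homology_iff]
  constructor
  · rintro ⟨-, φ, h1, h2⟩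
    exact isHomologicallyUnimodular_of_map hℓ φ h1 h2
  · intro h
    exact ⟨homCx_exact hℓ, exists_homCocyc_map I hℓ h⟩

end Bimod

/-! ### Ext out of a cyclic module, via an injective resolution -/

section Cyclic

variable {S : Type u} [CommRing S] {D : ModuleCat.{u} S} {d : D} {I : Ideal S}

/-- The element `d` generates the module `D`, with annihilator `I`. -/
structure IsCyclicGen (d : D) (I : Ideal S) : Prop where
  exists_smul (x : D) : ∃ s : S, s • d = x
  smul_eq_zero (s : S) : s • d = 0 ↔ s ∈ I

/-- Homomorphisms out of S/I are elements killed by I; thus Hom(D, J) is the subcomplex of J studied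
above. -/
lemma IsCyclicGen.exists_hom (h : IsCyclicGen d I) {N : ModuleCat.{u} S} {n : N}
    (hn : KillI I n) : ∃ f : D ⟶ N, f.hom d = n := by
  let p := LinearMap.toSpanSingleton S D d
  have hp : Function.Surjective p := fun x => h.exists_smul x
  have hk : LinearMap.ker p ≤ LinearMap.ker (LinearMap.toSpanSingleton S N n) := fun s hs =>
    hn s ((h.smul_eq_zero s).1 hs)
  refine ⟨ModuleCat.ofHom ((Submodule.liftQ _ _ hk) ∘ₗ
    (p.quotKerEquivOfSurjective hp).symm.toLinearMap), ?_⟩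
  have : (p.quotKerEquivOfSurjective hp).symm d = Submodule.Quotient.mk 1 := by
    rw [LinearEquiv.symm_apply_eq]
    exact (one_smul S d).symm
  change Submodule.liftQ _ _ hk ((p.quotKerEquivOfSurjective hp).symm d) = n
  rw [this]
  exact one_smul S n

lemma IsCyclicGen.hom_ext (h : IsCyclicGen d I) {N : ModuleCat.{u} S} {f g : D ⟶ N}
    (hfg : f.hom d = g.hom d) : f = g := by
  ext x
  obtain ⟨s, rfl⟩ := h.exists_smul x
  rw [map_smul, map_smul, hfg]

lemma IsCyclicGen.killI (h : IsCyclicGen d I) {N : ModuleCat.{u} S} (f : D ⟶ N) :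
    KillI I (f.hom d) := fun s hs => by
  rw [← map_smul, (h.smul_eq_zero s).2 hs, map_zero]

variable {N : ModuleCat.{u} S} (J : InjectiveResolution N)

/-- The differential of an injective resolution. -/
abbrev cxD (q : ℕ) : J.cocomplex.X q →ₗ[S] J.cocomplex.X (q + 1) := (J.cocomplex.d q (q + 1)).hom

/-- Degree zero is treated apart: the criterion used in positive degrees refers to the preceding
natural degree. Here the term in degree -1 is the zero object. -/
lemma extMk_zero_eq_zero {C : Type*} [Category* C] [Abelian C] [HasExt C] {X Y : C}
    (R : InjectiveResolution Y) (f : X ⟶ R.cocomplex.X 0) (hf : f ≫ R.cocomplex.d 0 1 = 0)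
    (h : R.extMk f 1 rfl hf = 0) : f = 0 := by
  rw [← R.extEquivCohomologyClass.apply_eq_iff_eq,
    InjectiveResolution.extEquivCohomologyClass_extMk,
    InjectiveResolution.extEquivCohomologyClass_zero,
    CochainComplex.HomComplex.CohomologyClass.mk_eq_zero_iff,
    CochainComplex.HomComplex.Cocycle.fromSingleMk_mem_coboundaries_iff _ _ _ _ _ (-1) (by simp)]
    at h
  obtain ⟨g, hg⟩ := h
  have hz : Limits.IsZero (R.cochainComplex.X (-1)) :=
    R.cochainComplex.isZero_of_isStrictlyGE 0 _ (by simp)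
  rw [hz.eq_of_tgt g 0, Limits.zero_comp] at hg
  rw [← cancel_mono (R.cochainComplexXIso ((0 : ℕ) : ℤ) 0 rfl).inv, Limits.zero_comp]
  exact hg.symm

lemma IsCyclicGen.extMk_eq_zero_iff (h : IsCyclicGen d I) {n : ℕ} (f : D ⟶ J.cocomplex.X n)
    (hf : f ≫ J.cocomplex.d n (n + 1) = 0) :
    J.extMk f (n + 1) rfl hf = 0 ↔ CobI (J := fun q => J.cocomplex.X q) (cxD J) I n (f.hom d) := by
  cases n with
  | zero =>
    constructor
    · intro h0
      rw [extMk_zero_eq_zero J f hf h0]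
      rfl
    · intro h0
      have : f = 0 := h.hom_ext h0
      subst this
      exact J.extMk_zero _ _
  | succ n =>
    rw [J.extMk_eq_zero_iff f (n + 1 + 1) rfl hf n rfl]
    constructor
    · rintro ⟨g, rfl⟩
      exact ⟨g.hom d, h.killI g, rfl⟩
    · rintro ⟨y, hy, e⟩
      obtain ⟨g, hg⟩ := h.exists_hom hy
      refine ⟨g, h.hom_ext ?_⟩
      rw [← e, ← hg]
      rfl

lemma isInjRes_cocomplex (J : InjectiveResolution (ModuleCat.of S S)) :
    IsInjRes (J := fun q => J.cocomplex.X q) (cxD J) ((J.ι.f 0).hom : S →ₗ[S] J.cocomplex.X 0) where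
  injective q := by
    have : Injective (ModuleCat.of S (J.cocomplex.X q)) :=
      inferInstanceAs (Injective (J.cocomplex.X q))
    exact Module.injective_module_of_injective_object S _
  mono := (ModuleCat.mono_iff_injective _).1 (inferInstance : Mono (J.ι.f 0))
  exact_zero := (ShortComplex.ShortExact.moduleCat_exact_iff_function_exact
      (ShortComplex.mk (J.ι.f 0) (J.cocomplex.d 0 1) J.ι_f_zero_comp_complex_d)).1
      (ShortComplex.exact_of_f_is_kernel _ J.isLimitKernelFork)
  exact q := (ShortComplex.ShortExact.moduleCat_exact_iff_function_exact _).1 (J.exact_succ q)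

/-- Multiplication by an element, on an injective resolution of a module. -/
def smulHom (z : S) (f : N ⟶ N) (hf : ∀ n, f.hom n = z • n) : InjectiveResolution.Hom J J f where
  hom :=
    { f := fun q => ModuleCat.ofHom (LinearMap.lsmul S (J.cocomplex.X q) z)
      comm' := fun i j _ => by
        ext x
        exact map_smul (J.cocomplex.d i j).hom z x }
  ι_f_zero_comp_hom_f_zero := by
    rw [CochainComplex.single₀_map_f_zero]
    ext x
    exact ((congrArg (J.ι.f 0).hom (hf x)).trans (map_smul (J.ι.f 0).hom z x)).symm

end Cyclic

/-! ### Ext of the diagonal bimodule of A with values in Aᵉ -/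

section Ext

variable (k A : Type u) [Field k] [CommRing A] [Algebra k A]

attribute [local instance] SA.algebra SA.moduleΩ

/-- The underlying group of the bimodule `A`. -/
def diagEquiv : A ≃+ diagBimod k A := AddEquiv.refl A

lemma isCyclicGen_diagBimod :
    IsCyclicGen (diagEquiv k A 1) (kerI (SA k A) A) := by
  have h : ∀ s : SA k A, s • (diagEquiv k A 1) =
      diagEquiv k A (algebraMap (SA k A) A s) := fun s => by
    induction s using TensorProduct.induction_on with
    | zero => rw [map_zero, map_zero]; exact zero_smul (SA k A) (diagEquiv k A 1)
    | add x y hx hy => rw [add_smul, map_add, map_add, hx, hy]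
    | tmul x y =>
      obtain ⟨y, rfl⟩ := op_surjective y
      change x * (1 * y) = x * y
      rw [one_mul]
  refine ⟨fun x => ?_, fun s => ?_⟩
  · obtain ⟨s, hs⟩ := (SA.isConormal k A).algebraMap_surjective x
    exact ⟨s, (h s).trans (congrArg (diagEquiv k A) hs)⟩
  · rw [h]
    exact Iff.rfl

variable [Algebra.Smooth k A] {ℓ : ℕ} (hℓ : ∀ p ∈ minimalPrimes A, ringKrullDim (A ⧸ p) = ℓ)

include hℓ

theorem subsingleton_ext_diagBimod (i : ℕ) (hi : i ≠ ℓ) :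
    Subsingleton (Abelian.Ext (diagBimod k A) (regBimod k A) i) := by
  have := SA.isNoetherianRing k A
  obtain ⟨J⟩ := (inferInstance : HasInjectiveResolution (regBimod k A)).out
  refine subsingleton_of_forall_eq 0 fun α => ?_
  obtain ⟨f, hf, rfl⟩ := J.extMk_surjective α (i + 1) rfl
  rw [(isCyclicGen_diagBimod k A).extMk_eq_zero_iff]
  refine (isInjRes_cocomplex J).cobI (SA.isLocallyRegular k A hℓ) hi _
    ((isCyclicGen_diagBimod k A).killI f) ?_
  exact congrArg (fun g => g.hom (diagEquiv k A 1)) hf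

/-- The isomorphism Ext^ℓ(A, Aᵉ) ≅ Hom(ω, A) followed by evaluation at a generator of ω. Forms are
linear over Aᵉ acting through the multiplication of A, so both bimodule actions are plain
multiplication. -/
theorem exists_ext_diagBimod_equiv (e : topForms k A ℓ ≃ₗ[A] A) :
    ∃ E : Abelian.Ext (diagBimod k A) (regBimod k A) ℓ ≃+ A, ∀ (r s : A) ξ,
      E (ξ.comp (Abelian.Ext.mk₀ (rmulBimod k A (s ⊗ₜ op r))) (add_zero ℓ)) = r * E ξ * s := by
  have := SA.isNoetherianRing k A
  have := SA.isTower k A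
  obtain ⟨J⟩ := (inferInstance : HasInjectiveResolution (regBimod k A)).out
  have hcyc := isCyclicGen_diagBimod k A
  have hJ := isInjRes_cocomplex J
  have hreg := SA.isLocallyRegular k A hℓ
  have hcon := SA.isConormal k A
  let ε : SA k A →ₗ[SA k A] J.cocomplex.X 0 := (J.ι.f 0).hom
  have hJ : IsInjRes (J := fun q => J.cocomplex.X q) (cxD J) ε := isInjRes_cocomplex J
  choose f hf hfα using fun α : Abelian.Ext (diagBimod k A) (regBimod k A) ℓ =>
    J.extMk_surjective α (ℓ + 1) rfl
  -- The form depends only on the Ext class, and not on the chosen representative.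
  have hcob {f g : diagBimod k A ⟶ J.cocomplex.X ℓ} (hf : f ≫ J.cocomplex.d ℓ (ℓ + 1) = 0)
      (hg : g ≫ J.cocomplex.d ℓ (ℓ + 1) = 0) (h : J.extMk f (ℓ + 1) rfl hf = J.extMk g (ℓ + 1) rfl hg)
      {Gf Gg : Ω[A⁄k] [⋀^Fin ℓ]→ₗ[A] A}
      (h1 : IsForm (J := fun q => J.cocomplex.X q) (cxD J) ε (SA.conormal k A)
        (f.hom (diagEquiv k A 1)) Gf)
      (h2 : IsForm (J := fun q => J.cocomplex.X q) (cxD J) ε (SA.conormal k A)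
        (g.hom (diagEquiv k A 1)) Gg) : Gf = Gg := by
    rw [← sub_eq_zero, J.sub_extMk, hcyc.extMk_eq_zero_iff] at h
    exact sub_eq_zero.1 ((h1.sub h2).eq_zero_of_cobI hJ hcon h)
  have hker {f : diagBimod k A ⟶ J.cocomplex.X ℓ} (hf : f ≫ J.cocomplex.d ℓ (ℓ + 1) = 0) :
      cxD J ℓ (f.hom (diagEquiv k A 1)) = 0 :=
    congrArg (fun g => g.hom (diagEquiv k A 1)) hf
  choose G hG using fun α => exists_isForm (J := fun q => J.cocomplex.X q) hJ hreg hcon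
    (hcyc.killI (f α)) (hker (hf α))
  let w := e.symm 1
  let val (g : Ω[A⁄k] [⋀^Fin ℓ]→ₗ[A] A) : A := exteriorPower.alternatingMapLinearEquiv g w
  have hval (g : Ω[A⁄k] [⋀^Fin ℓ]→ₗ[A] A) (h : val g = 0) : g = 0 := by
    apply exteriorPower.alternatingMapLinearEquiv.injective
    rw [map_zero]
    refine LinearMap.ext fun v => ?_
    have : v = e v • w := by
      apply e.injective
      rw [map_smul, LinearEquiv.apply_symm_apply, smul_eq_mul, mul_one]
    rw [this, map_smul]
    exact (congrArg (e v • ·) h).trans (smul_zero _)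
  have hadd (α β) : G (α + β) = G α + G β := by
    refine hcob (hf (α + β)) (g := f α + f β) ?_ ?_ (hG _) ((hG α).add (hG β))
    · rw [Preadditive.add_comp, hf, hf, add_zero]
    · rw [hfα, ← J.add_extMk _ _ _ _ (hf α) (hf β), hfα, hfα]
  let E : Abelian.Ext (diagBimod k A) (regBimod k A) ℓ →+ A :=
    AddMonoidHom.mk' (fun α => val (G α)) fun α β => by
      simp only [val]
      rw [hadd, map_add]; rfl
  have hE : Function.Bijective E := by
    constructor
    · rw [injective_iff_map_eq_zero]
      intro α hα
      have h0 := hG α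
      rw [hval _ hα] at h0
      rw [← hfα α, hcyc.extMk_eq_zero_iff]
      exact h0.cobI hJ hreg (hcyc.killI (f α)) (hker (hf α))
    · intro a
      obtain ⟨x, h1, h2, h3⟩ := exists_isForm_eq (J := fun q => J.cocomplex.X q) hJ hreg hcon
        (exteriorPower.alternatingMapLinearEquiv.symm (a • e.toLinearMap))
      obtain ⟨g, hg⟩ := hcyc.exists_hom h1
      have hg' : g ≫ J.cocomplex.d ℓ (ℓ + 1) = 0 := hcyc.hom_ext (by
        refine Eq.trans ?_ h2
        rw [← hg]
        rfl)
      refine ⟨J.extMk g (ℓ + 1) rfl hg', ?_⟩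
      have := hcob (hf (J.extMk g (ℓ + 1) rfl hg')) hg' (hfα _) (hG _) (by rw [hg]; exact h3)
      change val (G _) = a
      rw [this]
      simp only [val]
      rw [LinearEquiv.apply_symm_apply]
      change a * e (e.symm 1) = a
      rw [LinearEquiv.apply_symm_apply, mul_one]
  refine ⟨AddEquiv.ofBijective E hE, fun r s α => ?_⟩
  change val (G _) = r * val (G α) * s
  -- As Aᵉ is commutative, right multiplication by s ⊗ r is multiplication by a scalar, and lifts to
  -- the resolution as multiplication by that scalar.
  let φ := smulHom J (s ⊗ₜ op r) (rmulBimod k A (s ⊗ₜ op r)) fun n => mul_comm n _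
  have h1 : (f α ≫ φ.hom.f ℓ) ≫ J.cocomplex.d ℓ (ℓ + 1) = 0 := by
    rw [Category.assoc, φ.hom.comm, reassoc_of% (hf α), Limits.zero_comp]
  have h2 : α.comp (Abelian.Ext.mk₀ (rmulBimod k A (s ⊗ₜ op r))) (add_zero ℓ) =
      J.extMk (f α ≫ φ.hom.f ℓ) (ℓ + 1) rfl h1 := by
    conv_lhs => rw [← hfα α]
    exact InjectiveResolution.extMk_comp_mk₀ _ _ _ _ φ
  have h3 := hcob (hf _) h1 ((hfα _).trans h2) (hG _) ((hG α).smul (s ⊗ₜ op r))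
  rw [h3, SA.algebraMap_tmul]
  simp only [val]
  rw [map_smul]
  change s * r * _ = _
  ring

end Ext

/-! ### Projective dimension of the diagonal bimodule -/

section ProjDim

lemma IsCyclicGen.nonempty_equiv {S : Type u} [CommRing S] {D : ModuleCat.{u} S} {d : D}
    {I : Ideal S} (h : IsCyclicGen d I) : Nonempty ((S ⧸ I) ≃ₗ[S] D) := by
  let p := LinearMap.toSpanSingleton S D d
  have hp : Function.Surjective p := fun x => h.exists_smul x
  have hk : LinearMap.ker p = I := Ideal.ext fun s => h.smul_eq_zero s
  exact ⟨(Submodule.quotEquivOfEq _ _ hk.symm).trans (p.quotKerEquivOfSurjective hp)⟩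

/-- Adding an element of the sequence gives a short exact sequence 0 → R/K → R/K → R/K' → 0, with
first map `t j`, which raises the projective dimension by at most one. -/
lemma IsReg.hasProjectiveDimensionLE {R : Type u} [CommRing R] {t : ℕ → R} {ℓ : ℕ}
    (h : IsReg t ℓ) (j : ℕ) (hj : j ≤ ℓ) :
    HasProjectiveDimensionLE (ModuleCat.of R (R ⧸ Ideal.span (t '' Set.Iio j))) j := by
  induction j with
  | zero =>
    have e : (R ⧸ Ideal.span (t '' Set.Iio 0)) ≃ₗ[R] R :=
      Submodule.quotEquivOfEqBot _ (by simp)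
    have : Module.Projective R (R ⧸ Ideal.span (t '' Set.Iio 0)) :=
      Module.Projective.of_equiv e.symm
    exact (projective_iff_hasProjectiveDimensionLE_zero _).1
      ((IsProjective.iff_projective (R ⧸ Ideal.span (t '' Set.Iio 0))).1 this)
  | succ j ih =>
    have hle : Ideal.span (t '' Set.Iio j) ≤ Ideal.span (t '' Set.Iio (j + 1)) :=
      Ideal.span_mono (Set.image_mono (Set.Iio_subset_Iio (Nat.le_succ j)))
    have hmem : t j ∈ Ideal.span (t '' Set.Iio (j + 1)) :=
      Ideal.subset_span ⟨j, Nat.lt_succ_self j, rfl⟩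
    let f : (R ⧸ Ideal.span (t '' Set.Iio j)) →ₗ[R] (R ⧸ Ideal.span (t '' Set.Iio j)) :=
      LinearMap.lsmul R _ (t j)
    let g := Submodule.factor hle
    have w : g ∘ₗ f = 0 := by
      ext
      change Submodule.Quotient.mk (t j * 1) = (0 : R ⧸ Ideal.span (t '' Set.Iio (j + 1)))
      rwa [mul_one, Submodule.Quotient.mk_eq_zero]
    let C := ShortComplex.moduleCatMk f g w
    have hC : C.ShortExact := by
      have h1 : Mono C.f := (ModuleCat.mono_iff_injective _).2 (by
        change Function.Injective f
        rw [injective_iff_map_eq_zero]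
        intro x
        induction x using Submodule.Quotient.induction_on with | _ s
        intro hs
        change Submodule.Quotient.mk (t j * s) = _ at hs
        rw [Submodule.Quotient.mk_eq_zero] at hs ⊢
        exact h j hj s hs)
      have h2 : Epi C.g := (ModuleCat.epi_iff_surjective _).2
        (Submodule.factor_surjective hle)
      refine { exact := (ShortComplex.moduleCat_exact_iff _).2 fun x => ?_ }
      change g x = 0 → ∃ y, f y = x
      induction x using Submodule.Quotient.induction_on with | _ s
      intro hs
      change Submodule.Quotient.mk s = _ at hs
      rw [Submodule.Quotient.mk_eq_zero, mem_span_image_Iio_iff] at hs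
      obtain ⟨c, rfl⟩ := hs
      refine ⟨Submodule.Quotient.mk (c j), ?_⟩
      change Submodule.Quotient.mk (t j * c j) = _
      rw [Submodule.Quotient.eq, Finset.sum_range_succ, sub_add_cancel_right, neg_mem_iff,
        mem_span_image_Iio_iff]
      exact ⟨c, rfl⟩
    have := ih (by omega)
    have h2 : HasProjectiveDimensionLT C.X₂ (j + 1) := this
    exact hC.hasProjectiveDimensionLT_X₃ (n := j + 1) this
      (hasProjectiveDimensionLT_of_ge _ (j + 1) _ (by omega))

/-- For finite modules over noetherian rings the bound can be checked at maximal ideals. There S/I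
is either the quotient by a regular sequence or zero. -/
lemma IsLocallyRegular.hasProjectiveDimensionLE {S : Type u} [CommRing S] [IsNoetherianRing S]
    {I : Ideal S} {ℓ : ℕ} (h : IsLocallyRegular I ℓ) {D : ModuleCat.{u} S} {d : D}
    (hd : IsCyclicGen d I) : HasProjectiveDimensionLE D ℓ := by
  obtain ⟨e⟩ := hd.nonempty_equiv
  have : Module.Finite S D := Module.Finite.equiv e
  rw [ModuleCat.hasProjectiveDimensionLE_iff_forall_maximalSpectrum]
  intro m
  have := m.2.isPrime
  let T := Localization m.1.primeCompl
  let D' := D.localizedModule m.1.primeCompl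
  let φ := D.localizedModuleMkLinearMap m.1.primeCompl
  have hφ : IsLocalizedModule m.1.primeCompl φ := inferInstance
  have : IsScalarTower S T D' := inferInstance
  have hcyc : IsCyclicGen (φ d : D') (I.map (algebraMap S T)) := by
    constructor
    · intro x
      obtain ⟨⟨y, u⟩, rfl⟩ := IsLocalizedModule.mk'_surjective m.1.primeCompl φ x
      obtain ⟨s, rfl⟩ := hd.exists_smul y
      refine ⟨IsLocalization.mk' T s u, ?_⟩
      have := IsLocalizedModule.mk'_smul_mk' T φ s d u 1
      simpa using this
    · intro z
      obtain ⟨s, u, rfl⟩ := IsLocalization.exists_mk'_eq m.1.primeCompl z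
      have := IsLocalizedModule.mk'_smul_mk' T φ s d u 1
      rw [IsLocalizedModule.mk'_one] at this
      rw [this, IsLocalizedModule.mk'_eq_zero', IsLocalization.mk'_mem_map_algebraMap_iff]
      simp only [Submonoid.smul_def, ← hd.smul_eq_zero, mul_smul, exists_prop, Subtype.exists]
  by_cases hI : I ≤ m.1
  · obtain ⟨t, ht, hspan⟩ := h m.1 hI
    rw [← hspan] at hcyc
    obtain ⟨e⟩ := hcyc.nonempty_equiv
    have := ht.hasProjectiveDimensionLE ℓ le_rfl
    exact ModuleCat.hasProjectiveDimensionLE_of_linearEquiv (M := ModuleCat.of T _) e ℓ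
  · obtain ⟨s, hs, hsm⟩ := Set.not_subset.1 hI
    have htop : I.map (algebraMap S T) = ⊤ :=
      Ideal.eq_top_of_isUnit_mem _ (Ideal.mem_map_of_mem _ hs)
        (IsLocalization.map_units T (⟨s, hsm⟩ : m.1.primeCompl))
    rw [htop] at hcyc
    have : Subsingleton D' := subsingleton_of_forall_eq 0 fun x => by
      obtain ⟨s, rfl⟩ := hcyc.exists_smul x
      exact (hcyc.smul_eq_zero s).2 trivial
    have := (ModuleCat.isZero_of_subsingleton D').hasProjectiveDimensionLT_zero
    exact hasProjectiveDimensionLT_of_ge D' 0 _ (by omega)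

variable (k A : Type u) [Field k] [CommRing A] [Algebra k A]

theorem hasProjectiveDimensionLE_diagBimod [Algebra.Smooth k A] {ℓ : ℕ}
    (hℓ : ∀ p ∈ minimalPrimes A, ringKrullDim (A ⧸ p) = ℓ) :
    HasProjectiveDimensionLE (diagBimod k A) ℓ := by
  have := SA.isNoetherianRing k A
  exact (SA.isLocallyRegular k A hℓ).hasProjectiveDimensionLE (isCyclicGen_diagBimod k A)

end ProjDim

/-! ### Finite resolutions by finitely generated projectives -/

section FiniteResolution

/-- A projective resolution obtained by splicing a surjection from a projective object with a
projective resolution of its kernel. -/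
lemma exists_splice {V : Type*} [Category* V] [Abelian V] (C : ShortComplex V)
    (hC : C.ShortExact) (h₂ : Projective C.X₂) (P : ProjectiveResolution C.X₁) :
    ∃ Q : ProjectiveResolution C.X₃, Q.complex.X 0 = C.X₂ ∧
      ∀ n, Q.complex.X (n + 1) = P.complex.X n := by
  let p : P.complex.X 0 ⟶ C.X₁ := P.π.f 0
  have hp : P.complex.d 1 0 ≫ p = 0 := P.complex_d_comp_π_f_zero
  have hpe : Epi p := inferInstanceAs (Epi (P.π.f 0))
  have hp₀ : (ShortComplex.mk _ _ hp).Exact := P.exact₀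
  have := hC.mono_f
  have := hC.epi_g
  have w : P.complex.d 1 0 ≫ p ≫ C.f = 0 := by rw [reassoc_of% hp, Limits.zero_comp]
  have w' : (p ≫ C.f) ≫ C.g = 0 := by rw [Category.assoc, C.zero, Limits.comp_zero]
  let K := ChainComplex.augment P.complex (p ≫ C.f) w
  have h1 : (ShortComplex.mk _ _ w).Exact := by
    let φ : ShortComplex.mk _ _ hp ⟶ ShortComplex.mk _ _ w :=
      { τ₁ := 𝟙 _, τ₂ := 𝟙 _, τ₃ := C.f }
    have : Epi φ.τ₁ := inferInstanceAs (Epi (𝟙 _))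
    have : IsIso φ.τ₂ := inferInstanceAs (IsIso (𝟙 _))
    have : Mono φ.τ₃ := hC.mono_f
    exact (ShortComplex.exact_iff_of_epi_of_isIso_of_mono φ).1 hp₀
  have h0 : (ShortComplex.mk _ _ w').Exact := by
    let φ : ShortComplex.mk _ _ w' ⟶ C := { τ₁ := p, τ₂ := 𝟙 _, τ₃ := 𝟙 _ }
    have : Epi φ.τ₁ := hpe
    have : IsIso φ.τ₂ := inferInstanceAs (IsIso (𝟙 _))
    have : Mono φ.τ₃ := inferInstanceAs (Mono (𝟙 _))
    exact (ShortComplex.exact_iff_of_epi_of_isIso_of_mono φ).2 hC.exact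
  have hK (n : ℕ) : K.ExactAt (n + 1) := by
    rw [HomologicalComplex.exactAt_iff' _ (n + 1 + 1) (n + 1) n (by simp) (by simp)]
    match n with
    | 0 => exact h1
    | n + 1 => exact P.exact_succ n
  refine ⟨{ complex := K
            projective := fun n => by
              match n with
              | 0 => exact h₂
              | n + 1 => exact P.projective n
            π := (ChainComplex.toSingle₀Equiv K C.X₃).symm ⟨C.g, w'⟩
            quasiIso := ⟨fun n => ?_⟩ }, rfl, fun n => rfl⟩
  cases n with
  | zero =>
    rw [ChainComplex.quasiIsoAt₀_iff, ShortComplex.quasiIso_iff_of_zeros']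
    · refine (ShortComplex.exact_and_epi_g_iff_of_iso ?_).2 ⟨h0, hC.epi_g⟩
      refine ShortComplex.isoMk (Iso.refl _) (Iso.refl _) (Iso.refl _) ?_ ?_
      · exact (Category.id_comp _).trans (Category.comp_id _).symm
      · have h := ChainComplex.toSingle₀Equiv_symm_apply_f_zero (C := K) C.g w'
        exact (Category.id_comp _).trans (h.symm.trans (Category.comp_id _).symm)
    all_goals rfl
  | succ n =>
    rw [quasiIsoAt_iff_exactAt']
    · exact hK n
    · exact ChainComplex.exactAt_succ_single_obj _ _

/-- Take a finite free cover: its kernel is finite over the noetherian ring and has smaller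
projective dimension, so splicing goes by induction. -/
lemma exists_finite_projectiveResolution {S : Type u} [CommRing S] [IsNoetherianRing S] (n : ℕ)
    (M : ModuleCat.{u} S) [Module.Finite S M] [HasProjectiveDimensionLE M n] :
    ∃ P : ProjectiveResolution M, (∀ i, Module.Finite S (P.complex.X i)) ∧
      ∀ i, n < i → Limits.IsZero (P.complex.X i) := by
  induction n generalizing M with
  | zero =>
    have : Projective M := (projective_iff_hasProjectiveDimensionLE_zero M).2 inferInstance
    have h0 (i : ℕ) (hi : 0 < i) : Limits.IsZero ((ProjectiveResolution.self M).complex.X i) :=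
      HomologicalComplex.isZero_single_obj_X _ _ _ _ hi.ne'
    refine ⟨ProjectiveResolution.self M, fun i => ?_, h0⟩
    rcases i.eq_zero_or_pos with rfl | hi
    · exact Module.Finite.equiv
        ((HomologicalComplex.singleObjXSelf (ComplexShape.down ℕ) 0 M).toLinearEquiv.symm)
    · have := ModuleCat.subsingleton_of_isZero (h0 i hi)
      infer_instance
  | succ n ih =>
    obtain ⟨F, _, _, _, _, f, hf⟩ := Module.exists_finite_presentation S M
    let C := f.shortComplexKer
    have hC : C.ShortExact := LinearMap.shortExact_shortComplexKer hf
    have h₂ : Projective C.X₂ := ModuleCat.projective_of_categoryTheory_projective C.X₂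
    have := (hC.hasProjectiveDimensionLT_X₃_iff n h₂).1 ‹HasProjectiveDimensionLE M (n + 1)›
    have : HasProjectiveDimensionLE C.X₁ n := this
    have : Module.Finite S C.X₁ := inferInstanceAs (Module.Finite S (LinearMap.ker f))
    obtain ⟨P, h1, h2⟩ := ih C.X₁
    obtain ⟨Q, h3, h4⟩ := exists_splice C hC h₂ P
    refine ⟨Q, fun i => ?_, fun i hi => ?_⟩
    · cases i with
      | zero => rw [h3]; exact inferInstanceAs (Module.Finite S F)
      | succ i => rw [h4]; exact h1 i
    · cases i with
      | zero => omega
      | succ i => rw [h4]; exact h2 i (by omega)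

variable (k A : Type u) [Field k] [CommRing A] [Algebra k A]

theorem isHomologicallySmooth [Algebra.Smooth k A] {ℓ : ℕ}
    (hℓ : ∀ p ∈ minimalPrimes A, ringKrullDim (A ⧸ p) = ℓ) : IsHomologicallySmooth k A := by
  have := SA.isNoetherianRing k A
  have := hasProjectiveDimensionLE_diagBimod k A hℓ
  obtain ⟨e⟩ := (isCyclicGen_diagBimod k A).nonempty_equiv
  have : Module.Finite (SA k A) (diagBimod k A) := Module.Finite.equiv e
  obtain ⟨P, h1, h2⟩ := exists_finite_projectiveResolution (S := SA k A) ℓ (diagBimod k A)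
  exact ⟨P, h1, ℓ, h2⟩

end FiniteResolution

lemma projective_finsupp {R ι P : Type*} [Ring R] [AddCommGroup P] [Module R P]
    [Module.Projective R P] : Module.Projective R (ι →₀ P) := by
  classical
  exact Module.Projective.of_equiv (finsuppLEquivDirectSum R P ι).symm

/-! ### Tensoring a bimodule resolution with a module -/

section BaseChange

variable {k A B : Type u} [Field k] [CommRing A] [CommRing B] [Algebra k A] [Algebra k B]

attribute [local instance] Algebra.TensorProduct.rightAlgebra

lemma smulCommClass_of_isScalarTower (Q : Type u) [AddCommGroup Q] [Module (A ⊗[k] B) Q]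
    [Module A Q] [Module B Q] [IsScalarTower A (A ⊗[k] B) Q] [IsScalarTower B (A ⊗[k] B) Q] :
    SMulCommClass B A Q where
  smul_comm b a q := by
    rw [← algebraMap_smul (A ⊗[k] B) b (a • q), ← algebraMap_smul (A ⊗[k] B) a q,
      ← algebraMap_smul (A ⊗[k] B) a (b • q), ← algebraMap_smul (A ⊗[k] B) b q, smul_comm]

lemma projective_tensor_right : Module.Projective B (A ⊗[k] B) := by
  let e : A ⊗[k] B ≃ₗ[B] B ⊗[k] A :=
    { (TensorProduct.comm k A B).toAddEquiv with
      map_smul' := fun b x => by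
        change TensorProduct.comm k A B (b • x) = b • TensorProduct.comm k A B x
        induction x using TensorProduct.induction_on with
        | zero => rw [smul_zero, map_zero, smul_zero]
        | add x y hx hy => rw [smul_add, map_add, map_add, smul_add, hx, hy]
        | tmul x y =>
          rw [Algebra.smul_def]
          change TensorProduct.comm k A B ((1 ⊗ₜ b) * (x ⊗ₜ y)) = _
          rw [Algebra.TensorProduct.tmul_mul_tmul, one_mul]
          rfl }
  exact Module.Projective.of_equiv e.symm

/-- (A ⊗ B) ⊗_B M ≅ A ⊗_k M is free over A, k being a field; a projective bimodule is a summand of a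
sum of copies of A ⊗ B. -/
lemma projective_tensor_of_projective (Q : Type u) [AddCommGroup Q] [Module (A ⊗[k] B) Q]
    [Module A Q] [Module B Q] [IsScalarTower A (A ⊗[k] B) Q] [IsScalarTower B (A ⊗[k] B) Q]
    [SMulCommClass B A Q] [Module.Projective (A ⊗[k] B) Q]
    (M : Type u) [AddCommGroup M] [Module B M] : Module.Projective A (Q ⊗[B] M) := by
  let S := A ⊗[k] B
  let _ : Module k M := Module.compHom M (algebraMap k B)
  have : IsScalarTower k B M := IsScalarTower.of_algebraMap_smul fun _ _ => rfl
  have e : S ⊗[B] M ≃ₗ[A] A ⊗[k] M := Algebra.IsPushout.cancelBaseChange k A B S M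
  have h1 : Module.Projective A (S ⊗[B] M) := Module.Projective.of_equiv e.symm
  have h2 : Module.Projective A ((Q →₀ S) ⊗[B] M) := by
    have : SMulCommClass B A S := smulCommClass_of_isScalarTower (k := k) (A := A) (B := B) S
    have : SMulCommClass B A (Q →₀ S) := inferInstance
    have : Module.Projective A (Q →₀ S ⊗[B] M) := projective_finsupp
    classical
    exact Module.Projective.of_equiv
      ((TensorProduct.finsuppLeft B S S M Q).restrictScalars A).symm
  obtain ⟨s, hs⟩ := (Module.projective_def' (R := S) (P := Q)).1 inferInstance
  let f : (Q →₀ S) →ₗ[S] Q := Finsupp.linearCombination S id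
  refine Module.Projective.of_split
    ((AlgebraTensorModule.map (R := B) s (LinearMap.id : M →ₗ[B] M)).restrictScalars A)
    ((AlgebraTensorModule.map (R := B) f (LinearMap.id : M →ₗ[B] M)).restrictScalars A) ?_
  ext x
  change (AlgebraTensorModule.map (R := B) f (LinearMap.id : M →ₗ[B] M))
    (AlgebraTensorModule.map (R := B) s (LinearMap.id : M →ₗ[B] M) x) = x
  rw [← LinearMap.comp_apply, ← AlgebraTensorModule.map_comp, hs, LinearMap.id_comp,
    AlgebraTensorModule.map_id]
  rfl

lemma hasProjectiveDimensionLE_tensor_succ {n : ℕ} {K F Q : Type u}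
    [AddCommGroup K] [Module (A ⊗[k] B) K] [Module A K] [Module B K]
    [IsScalarTower A (A ⊗[k] B) K] [IsScalarTower B (A ⊗[k] B) K] [SMulCommClass B A K]
    [AddCommGroup F] [Module (A ⊗[k] B) F] [Module A F] [Module B F]
    [IsScalarTower A (A ⊗[k] B) F] [IsScalarTower B (A ⊗[k] B) F] [SMulCommClass B A F]
    [AddCommGroup Q] [Module (A ⊗[k] B) Q] [Module A Q] [Module B Q]
    [IsScalarTower A (A ⊗[k] B) Q] [IsScalarTower B (A ⊗[k] B) Q] [SMulCommClass B A Q]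
    (i : K →ₗ[A ⊗[k] B] F) (f : F →ₗ[A ⊗[k] B] Q) (hif : Function.Exact i f)
    (hf : Function.Surjective f) (r : F →ₗ[B] K) (hr : r ∘ₗ i.restrictScalars B = LinearMap.id)
    (M : Type u) [AddCommGroup M] [Module B M] [Module.Projective A (F ⊗[B] M)]
    (hK : HasProjectiveDimensionLE (ModuleCat.of A (K ⊗[B] M)) n) :
    HasProjectiveDimensionLE (ModuleCat.of A (Q ⊗[B] M)) (n + 1) := by
  let iM := (AlgebraTensorModule.map (R := B) i (LinearMap.id : M →ₗ[B] M)).restrictScalars A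
  let fM := (AlgebraTensorModule.map (R := B) f (LinearMap.id : M →ₗ[B] M)).restrictScalars A
  have hex : Function.Exact (LinearMap.rTensor M (i.restrictScalars B))
    (LinearMap.rTensor M (f.restrictScalars B)) := rTensor_exact M hif hf
  have hex' : Function.Exact iM fM := hex
  let C := ShortComplex.moduleCatMk iM fM hex'.linearMap_comp_eq_zero
  have hC : C.ShortExact := by
    have h1 : Mono C.f := (ModuleCat.mono_iff_injective _).2 (by
      refine Function.LeftInverse.injective (g := LinearMap.rTensor M r) fun x => ?_
      change (LinearMap.rTensor M r) (LinearMap.rTensor M (i.restrictScalars B) x) = x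
      rw [← LinearMap.rTensor_comp_apply, hr, LinearMap.rTensor_id]
      rfl)
    have h2 : Epi C.g := (ModuleCat.epi_iff_surjective _).2
      (LinearMap.rTensor_surjective M (g := f.restrictScalars B) hf)
    exact { exact := (ShortComplex.ShortExact.moduleCat_exact_iff_function_exact _).2 hex' }
  have hF : Projective (ModuleCat.of A (F ⊗[B] M)) :=
    (IsProjective.iff_projective (F ⊗[B] M)).1 inferInstance
  exact (hC.hasProjectiveDimensionLT_X₃_iff n hF).2 hK

/-- As `Q` is projective over B, its free bimodule cover splits over B. The kernel is again
projective over B, and tensoring with `M` keeps the sequence exact. -/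
lemma hasProjectiveDimensionLE_tensor (n : ℕ) (Q : Type u) [AddCommGroup Q] [Module (A ⊗[k] B) Q]
    [Module A Q] [Module B Q] [IsScalarTower A (A ⊗[k] B) Q] [IsScalarTower B (A ⊗[k] B) Q]
    [SMulCommClass B A Q] [Module.Projective B Q]
    (hQ : HasProjectiveDimensionLE (ModuleCat.of (A ⊗[k] B) Q) n)
    (M : Type u) [AddCommGroup M] [Module B M] :
    HasProjectiveDimensionLE (ModuleCat.of A (Q ⊗[B] M)) n := by
  let S := A ⊗[k] B
  induction n generalizing Q with
  | zero =>
    have : Module.Projective S Q :=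
      (IsProjective.iff_projective Q).2 ((projective_iff_hasProjectiveDimensionLE_zero _).2 hQ)
    have := projective_tensor_of_projective (k := k) (A := A) (B := B) Q M
    exact (projective_iff_hasProjectiveDimensionLE_zero _).1
      ((IsProjective.iff_projective (Q ⊗[B] M)).1 this)
  | succ n ih =>
    let F := Q →₀ A ⊗[k] B
    let f : F →ₗ[S] Q := Finsupp.linearCombination S id
    have hf : Function.Surjective f := Finsupp.linearCombination_surjective S Function.surjective_id
    let K := LinearMap.ker f
    let i : K →ₗ[S] F := K.subtype
    have hSc : SMulCommClass B A S := smulCommClass_of_isScalarTower (k := k) (A := A) (B := B) S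
    have hFc : SMulCommClass B A F := inferInstanceAs (SMulCommClass B A (Q →₀ S))
    have hKc : SMulCommClass B A K := smulCommClass_of_isScalarTower (k := k) (A := A) (B := B) K
    -- the presentation of `Q` splits over `B`
    obtain ⟨σ, hσ⟩ := Module.projective_lifting_property (f.restrictScalars B)
      (LinearMap.id : Q →ₗ[B] Q) hf
    let r : F →ₗ[B] K := LinearMap.codRestrict (K.restrictScalars B)
      (LinearMap.id - σ ∘ₗ f.restrictScalars B) fun x => by
        change f (x - σ (f x)) = 0
        rw [map_sub, sub_eq_zero]
        exact (LinearMap.congr_fun hσ (f x)).symm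
    have hr : r ∘ₗ i.restrictScalars B = LinearMap.id := by
      refine LinearMap.ext fun x => Subtype.ext ?_
      change (x : F) - σ (f x) = x
      rw [show f x = 0 from x.2, map_zero, sub_zero]
    have hFB : Module.Projective B F := by
      have : Module.Projective B S := projective_tensor_right
      exact projective_finsupp (P := S)
    have hKB : Module.Projective B K := Module.Projective.of_split (i.restrictScalars B) r hr
    have h₂ : Projective (ModuleCat.of S F) :=
      (IsProjective.iff_projective F).1 (inferInstanceAs (Module.Projective S (Q →₀ S)))
    have hC : f.shortComplexKer.ShortExact := LinearMap.shortExact_shortComplexKer hf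
    have hK := ih K ((hC.hasProjectiveDimensionLT_X₃_iff n h₂).1 hQ)
    have := projective_tensor_of_projective (k := k) (A := A) (B := B) F M
    exact hasProjectiveDimensionLE_tensor_succ (K := K) i f (LinearMap.exact_subtype_ker_map f) hf
      r hr M hK

end BaseChange

/-! ### Global dimension of a smooth algebra -/

section GlobalDimension

section Diagonal

variable {k A B : Type u} [Field k] [CommRing A] [CommRing B] [Algebra k A] [Algebra k B]

attribute [local instance] Algebra.TensorProduct.rightAlgebra

/-- `Q` is the diagonal bimodule, so Q ⊗_B M ≅ M: a bimodule bound for `Q` bounds every module. -/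
lemma hasProjectiveDimensionLE_of_diagonal {n : ℕ} (φ : B ≃+* A) {Q : Type u} [AddCommGroup Q]
    [Module (A ⊗[k] B) Q] (c : A ≃+ Q)
    (hc : ∀ a b x, (a ⊗ₜ[k] b) • c x = c (a * (x * φ b)))
    (h : HasProjectiveDimensionLE (ModuleCat.of (A ⊗[k] B) Q) n) (M : ModuleCat.{u} A) :
    HasProjectiveDimensionLE M n := by
  let _ : Module A Q := Module.compHom Q (algebraMap A (A ⊗[k] B))
  let _ : Module B Q := Module.compHom Q (algebraMap B (A ⊗[k] B))
  have : IsScalarTower A (A ⊗[k] B) Q := IsScalarTower.of_algebraMap_smul fun _ _ => rfl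
  have : IsScalarTower B (A ⊗[k] B) Q := IsScalarTower.of_algebraMap_smul fun _ _ => rfl
  have : SMulCommClass B A Q := smulCommClass_of_isScalarTower (k := k) (A := A) (B := B) Q
  have hcA (a x : A) : a • c x = c (a * x) := (hc a 1 x).trans (by rw [map_one, mul_one])
  have hcB (b : B) (x : A) : b • c x = c (x * φ b) := (hc 1 b x).trans (by rw [one_mul])
  let e : Q ≃ₗ[B] B :=
    { c.symm.trans φ.symm.toAddEquiv with
      map_smul' := fun b q => by
        obtain ⟨x, rfl⟩ := c.surjective q
        change φ.symm (c.symm (b • c x)) = b * φ.symm (c.symm (c x))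
        rw [hcB, c.symm_apply_apply, c.symm_apply_apply, map_mul, φ.symm_apply_apply, mul_comm] }
  have : Module.Projective B Q := Module.Projective.of_equiv e.symm
  let _ : Module B M := Module.compHom M φ.toRingHom
  let E₀ : Q ⊗[B] M ≃ₗ[B] M :=
    (TensorProduct.congr e (LinearEquiv.refl _ _)).trans (TensorProduct.lid B M)
  have hE (x : A) (m : M) : E₀ (c x ⊗ₜ m) = x • m := by
    change φ (φ.symm (c.symm (c x))) • m = x • m
    rw [c.symm_apply_apply, φ.apply_symm_apply]
  let E : Q ⊗[B] M ≃ₗ[A] M :=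
    { E₀.toAddEquiv with
      map_smul' := fun a z => by
        change E₀ (a • z) = a • E₀ z
        induction z using TensorProduct.induction_on with
        | zero => rw [smul_zero, map_zero, smul_zero]
        | add x y hx hy => rw [smul_add, map_add, map_add, smul_add, hx, hy]
        | tmul q m =>
          obtain ⟨x, rfl⟩ := c.surjective q
          rw [TensorProduct.smul_tmul', hcA, hE, hE, mul_smul] }
  have := hasProjectiveDimensionLE_tensor (k := k) (A := A) (B := B) n Q h M
  exact ModuleCat.hasProjectiveDimensionLE_of_linearEquiv (M := ModuleCat.of A (Q ⊗[B] M)) E n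

end Diagonal

variable (k A : Type u) [Field k] [CommRing A] [Algebra k A] [Algebra.Smooth k A] {ℓ : ℕ}
  (hℓ : ∀ p ∈ minimalPrimes A, ringKrullDim (A ⧸ p) = ℓ)

include k hℓ

/-- The global dimension of a smooth algebra of pure dimension `ℓ` is at most `ℓ`. -/
theorem hasProjectiveDimensionLE_of_smooth (M : ModuleCat.{u} A) :
    HasProjectiveDimensionLE M ℓ :=
  hasProjectiveDimensionLE_of_diagonal (k := k) (B := Aᵐᵒᵖ) (RingEquiv.toOpposite A).symm
    (diagEquiv k A) (fun _ _ _ => rfl) (hasProjectiveDimensionLE_diagBimod k A hℓ) M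

theorem hasInjectiveDimensionLE_of_smooth (M : ModuleCat.{u} A) :
    HasInjectiveDimensionLE M ℓ := by
  refine (hasInjectiveDimensionLT_iff _ _).2 fun i hi Y ξ => ?_
  have := hasProjectiveDimensionLE_of_smooth k A hℓ Y
  exact ξ.eq_zero_of_hasProjectiveDimensionLT (ℓ + 1) hi

end GlobalDimension

/-! ### The injective dimension of A is not smaller than ℓ -/

section LowerBound

/-- A section of the differential `dJ m` over the next cocycles, applied to a numerator, is linear.
So it stays killed by the sequence after localization and makes the top class of 1 a coboundary;
that class is 1 in the quotient by the sequence. -/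
lemma IsInjRes.one_mem_span_of_section {S : Type u} [CommRing S] [IsNoetherianRing S]
    (M : Submonoid S) {J : ℕ → Type u} [∀ q, AddCommGroup (J q)] [∀ q, Module S (J q)]
    {dJ : ∀ q, J q →ₗ[S] J (q + 1)} {ε : S →ₗ[S] J 0} (h : IsInjRes dJ ε) {m : ℕ}
    {t : ℕ → Localization M} (ht : IsReg t (m + 1))
    (g : LinearMap.ker (dJ (m + 1)) →ₗ[S] J m) (hg : ∀ y, dJ m (g y) = y) :
    (1 : Localization M) ∈ Ideal.span (t '' Set.Iio (m + 1)) := by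
  have h' := h.localize M
  obtain ⟨-, h2, -, h4⟩ := h'.cohomology ht
  obtain ⟨y, hy⟩ := h2 1
  rw [← h4 1 y hy]
  have hk : Kill t (m + 1) y := hy.kill h'.exact_zero h'.exact
  have hd : locD M dJ (m + 1) y = 0 := hy.cocycle h'.exact_zero h'.exact
  obtain ⟨⟨a, s⟩, hs⟩ := IsLocalizedModule.surj M (locMap M J (m + 1)) y
  change (s : S) • y = locMap M J (m + 1) a at hs
  have ha : locMap M J (m + 2) (dJ (m + 1) a) = 0 := by
    rw [← locD_locMap, ← hs, LinearMap.map_smul_of_tower, hd, smul_zero]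
  obtain ⟨c, hc⟩ := (IsLocalizedModule.eq_zero_iff M (locMap M J (m + 2))).1 ha
  let b : LinearMap.ker (dJ (m + 1)) := ⟨(c : S) • a, by rw [LinearMap.mem_ker, map_smul]; exact hc⟩
  have hb : ((c * s : M) : S) • y = locMap M J (m + 1) b := by
    change _ = locMap M J (m + 1) ((c : S) • a)
    rw [map_smul, ← hs, smul_smul]
    rfl
  refine ⟨IsLocalizedModule.mk' (locMap M J m) (g b) (c * s), fun i hi => ?_, ?_⟩
  · obtain ⟨x, u, hx⟩ := IsLocalization.exists_mk'_eq M (t i)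
    have h0 : t i • locMap M J (m + 1) b = 0 := by
      rw [← hb, smul_comm, hk i hi, smul_zero]
    have h1 : locMap M J (m + 1) (x • (b : J (m + 1))) = 0 := by
      rw [locMap_smul, ← IsLocalization.mk'_spec (Localization M) x u, hx, mul_comm, mul_smul, h0,
        smul_zero]
    obtain ⟨c', hc'⟩ := (IsLocalizedModule.eq_zero_iff M (locMap M J (m + 1))).1 h1
    have h2 : (c' : S) • x • g b = 0 := by
      have hb' : (c' : S) • x • b = 0 := Subtype.ext hc'
      rw [← map_smul, ← map_smul, hb', map_zero]
    rw [← hx, IsLocalizedModule.mk'_smul_mk', IsLocalizedModule.mk'_eq_zero']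
    exact ⟨c', h2⟩
  · have hu := IsLocalization.map_units (Localization M) (c * s)
    rw [← hu.smul_left_cancel, ← map_smul, algebraMap_smul, algebraMap_smul, hb]
    have : ((c * s : M) : S) • IsLocalizedModule.mk' (locMap M J m) (g b) (c * s) =
        locMap M J m (g b) := IsLocalizedModule.mk'_cancel' (locMap M J m) (g b) (c * s)
    rw [this, locD_locMap, hg]

lemma IsReg.one_mem_span_of_hasInjectiveDimensionLT {S : Type u} [CommRing S] [IsNoetherianRing S]
    [Nontrivial S] (M : Submonoid S) {ℓ : ℕ} {t : ℕ → Localization M} (ht : IsReg t ℓ)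
    [HasInjectiveDimensionLT (ModuleCat.of S S) ℓ] :
    (1 : Localization M) ∈ Ideal.span (t '' Set.Iio ℓ) := by
  cases ℓ with
  | zero =>
    have := ModuleCat.subsingleton_of_isZero
      (isZero_of_hasInjectiveDimensionLT_zero (ModuleCat.of S S))
    exact (not_subsingleton S this).elim
  | succ m =>
    obtain ⟨J⟩ := (inferInstance : HasInjectiveResolution (ModuleCat.of S S)).out
    let K := LinearMap.ker (cxD J (m + 1))
    -- The inclusion of the cocycles represents a class in Ext^{m+1}(K, S). This group vanishes by
    -- the bound on the injective dimension, so the inclusion factors through the differential.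
    let ι : ModuleCat.of S K ⟶ J.cocomplex.X (m + 1) := ModuleCat.ofHom K.subtype
    have hι : ι ≫ J.cocomplex.d (m + 1) (m + 2) = 0 := by
      ext x
      exact x.2
    have h0 := (J.extMk ι (m + 2) rfl hι).eq_zero_of_hasInjectiveDimensionLT (m + 1) le_rfl
    obtain ⟨g, hg⟩ := (J.extMk_eq_zero_iff ι (m + 2) rfl hι m rfl).1 h0
    exact (isInjRes_cocomplex J).one_mem_span_of_section M ht g.hom
      fun y => congrArg (fun f => f.hom y) hg

/-- A k-point: by Zariski's lemma residue fields are finite over k, hence equal to it. -/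
lemma exists_algHom_of_finiteType (k B : Type u) [Field k] [IsAlgClosed k] [CommRing B]
    [Nontrivial B] [Algebra k B] [Algebra.FiniteType k B] : Nonempty (B →ₐ[k] k) := by
  obtain ⟨m, hm⟩ := Ideal.exists_maximal B
  let _ : Field (B ⧸ m) := Ideal.Quotient.field m
  have : Algebra.FiniteType k (B ⧸ m) :=
    Algebra.FiniteType.of_surjective (Ideal.Quotient.mkₐ k m) Ideal.Quotient.mk_surjective
  have : Module.Finite k (B ⧸ m) := finite_of_finite_type_of_isJacobsonRing k (B ⧸ m)
  have hb := IsAlgClosed.algebraMap_bijective_of_isIntegral (k := k) (K := B ⧸ m)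
  exact ⟨((AlgEquiv.ofBijective (Algebra.ofId k (B ⧸ m)) hb).symm : (B ⧸ m) →ₐ[k] k).comp
    (Ideal.Quotient.mkₐ k m)⟩

lemma isReg_X_sub_C (n : ℕ) {k : Type*} [CommRing k] (a : Fin n → k) :
    IsReg (fun j => if h : j < n then
      (MvPolynomial.X ⟨j, h⟩ - MvPolynomial.C (a ⟨j, h⟩) : MvPolynomial (Fin n) k) else 0) n := by
  let φ (a : Fin n → k) : MvPolynomial (Fin n) k →ₐ[k] MvPolynomial (Fin n) k :=
    MvPolynomial.aeval fun i => MvPolynomial.X i - MvPolynomial.C (a i)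
  have hφ (a b : Fin n → k) (hab : a + b = 0) : (φ a).comp (φ b) = AlgHom.id k _ := by
    ext i : 1
    have : b i = -a i := by
      rw [eq_neg_iff_add_eq_zero, add_comm]
      exact congrFun hab i
    simp [φ, this, MvPolynomial.algebraMap_eq]
  let e : MvPolynomial (Fin n) k ≃ₐ[k] MvPolynomial (Fin n) k :=
    AlgEquiv.ofAlgHom (φ a) (φ (-a)) (hφ _ _ (add_neg_cancel a)) (hφ _ _ (neg_add_cancel a))
  convert (isReg_X n k).of_ringEquiv e.toRingEquiv using 1
  funext j
  split_ifs with h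
  · change _ = φ a (MvPolynomial.X ⟨j, h⟩)
    simp [φ]
  · exact (map_zero e).symm

/-- Translate the variables to vanish at a k-point of `B`. Flatness keeps them regular, and the
point shows that they do not generate the unit ideal, which `IsReg` alone does not exclude. -/
lemma exists_isReg_one_notMem (k B : Type u) [Field k] [IsAlgClosed k] [CommRing B] [Nontrivial B]
    [Algebra k B] [Algebra.FiniteType k B] (n : ℕ) [Algebra (MvPolynomial (Fin n) k) B]
    [IsScalarTower k (MvPolynomial (Fin n) k) B] [Module.Flat (MvPolynomial (Fin n) k) B] :
    ∃ t : ℕ → B, IsReg t n ∧ 1 ∉ Ideal.span (t '' Set.Iio n) := by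
  obtain ⟨φ⟩ := exists_algHom_of_finiteType k B
  let a (i : Fin n) : k := φ (algebraMap (MvPolynomial (Fin n) k) B (MvPolynomial.X i))
  refine ⟨_, (isReg_X_sub_C n a).of_flat (R' := B), fun h1 => ?_⟩
  refine one_ne_zero ((map_one φ).symm.trans (?_ : φ 1 = 0))
  rw [← RingHom.mem_ker]
  refine Ideal.span_le.2 ?_ h1
  rintro _ ⟨j, hj, rfl⟩
  have hj' : j < n := hj
  have hC : algebraMap (MvPolynomial (Fin n) k) B (MvPolynomial.C (a ⟨j, hj⟩)) =
      algebraMap k B (a ⟨j, hj⟩) :=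
    (IsScalarTower.algebraMap_apply k (MvPolynomial (Fin n) k) B _).symm
  rw [SetLike.mem_coe, RingHom.mem_ker]
  beta_reduce
  rw [dif_pos hj', map_sub, map_sub, hC, AlgHom.commutes,
    sub_eq_zero]
  rfl

variable (k A : Type u) [Field k] [IsAlgClosed k] [CommRing A] [Nontrivial A] [Algebra k A]
  [Algebra.Smooth k A] {ℓ : ℕ} (hℓ : ∀ p ∈ minimalPrimes A, ringKrullDim (A ⧸ p) = ℓ)

include k hℓ

lemma not_hasInjectiveDimensionLT : ¬ HasInjectiveDimensionLT (ModuleCat.of A A) ℓ := by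
  intro hinj
  have : IsNoetherianRing A := Algebra.FiniteType.isNoetherianRing k A
  obtain ⟨p, hp⟩ := Ideal.exists_maximal A
  have := hp.isPrime
  obtain ⟨f, hf, n, _, _, _⟩ :=
    Algebra.IsSmoothAt.exists_isStandardEtale_mvPolynomial (R := k) (p := p)
  let B := Localization.Away f
  have hn : n = ℓ := eq_of_etale (k := k) (f := f) (B := B) hℓ hf
  subst hn
  let R := MvPolynomial (Fin n) k
  have hflat : Module.Flat R B := Algebra.Smooth.flat R B
  have : Nontrivial B := by
    refine ⟨1, 0, fun h => ?_⟩
    rw [← map_one (algebraMap A B), IsLocalization.map_eq_zero_iff (Submonoid.powers f)] at h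
    obtain ⟨⟨_, i, rfl⟩, hi⟩ := h
    have hi : f ^ i = 0 := (mul_one _).symm.trans hi
    exact hf (this.mem_of_pow_mem i (hi.symm ▸ p.zero_mem))
  have : Algebra.FiniteType A B := IsLocalization.finiteType_of_monoid_fg (Submonoid.powers f) B
  have : Algebra.FiniteType k B := Algebra.FiniteType.trans (S := A) inferInstance inferInstance
  obtain ⟨t, ht, h1⟩ := exists_isReg_one_notMem k B n
  exact h1 (ht.one_mem_span_of_hasInjectiveDimensionLT (Submonoid.powers f))

theorem injectiveDimension_eq : injectiveDimension (ModuleCat.of A A) = ℓ := by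
  have := hasInjectiveDimensionLE_of_smooth k A hℓ (ModuleCat.of A A)
  exact le_antisymm ((injectiveDimension_le_iff _ _).2 this)
    ((injectiveDimension_ge_iff _ _).2 (not_hasInjectiveDimensionLT k A hℓ))

theorem injectiveDimension_op_eq : injectiveDimension (ModuleCat.of Aᵐᵒᵖ A) = ℓ := by
  let _ : RingHomInvPair (RingHomClass.toRingHom (RingEquiv.toOpposite A) : A →+* Aᵐᵒᵖ)
      (RingHomClass.toRingHom (RingEquiv.toOpposite A).symm : Aᵐᵒᵖ →+* A) :=
    RingHomInvPair.of_ringEquiv (RingEquiv.toOpposite A)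
  let _ : RingHomInvPair (RingHomClass.toRingHom (RingEquiv.toOpposite A).symm : Aᵐᵒᵖ →+* A)
      (RingHomClass.toRingHom (RingEquiv.toOpposite A) : A →+* Aᵐᵒᵖ) :=
    RingHomInvPair.of_ringEquiv_symm (RingEquiv.toOpposite A)
  let e : A ≃ₛₗ[(RingHomClass.toRingHom (RingEquiv.toOpposite A) : A →+* Aᵐᵒᵖ)] A :=
    { AddEquiv.refl A with map_smul' := fun a x => mul_comm a x }
  rw [← injectiveDimension_eq k A hℓ]
  exact (ModuleCat.injectiveDimension_eq_of_semiLinearEquiv (M := ModuleCat.of A A)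
    (N := ModuleCat.of Aᵐᵒᵖ A) (RingEquiv.toOpposite A) e).symm

end LowerBound

/-! ### A trivialization of ω makes A Calabi-Yau -/

section CalabiYau

variable (k A : Type u) [Field k] [IsAlgClosed k] [CommRing A] [Nontrivial A] [Algebra k A]
  [Algebra.Smooth k A] {ℓ : ℕ} (hℓ : ∀ p ∈ minimalPrimes A, ringKrullDim (A ⧸ p) = ℓ)

include hℓ

theorem isCalabiYau_of_topForms_equiv (e : topForms k A ℓ ≃ₗ[A] A) : IsCalabiYau k A :=
  ⟨ℓ, AlgEquiv.refl,
    { smooth := isHomologicallySmooth k A hℓ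
      injDim_left := injectiveDimension_eq k A hℓ
      injDim_right := injectiveDimension_op_eq k A hℓ
      ext_zero := fun i hi => subsingleton_ext_diagBimod k A hℓ i hi
      ext_top := exists_ext_diagBimod_equiv k A hℓ e },
    1, fun x => by simp⟩

end CalabiYau

/-! ### Homological unimodularity and the modular class -/

section Unimodular

variable {k A : Type u} [Field k] [CommRing A] [Algebra k A] [PoissonAlgebra k A] {ℓ : ℕ}

/-- Two trivializations of ω differ by a unit `u`. Comparing the brackets at the top form sent to 1
by the Poisson one gives {a, u} + δ(a) u = 0. -/
lemma IsHomologicallyUnimodular.isUnimodular (h : IsHomologicallyUnimodular k A ℓ) :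
    IsUnimodular k A ℓ := by
  obtain ⟨e, he⟩ := h
  refine ⟨⟨0, fun a b => by simp [pb], e, fun a w => by simpa using he a w⟩, ?_⟩
  rintro δ ⟨-, e', he'⟩
  let f : A ≃ₗ[A] A := e'.symm.trans e
  have hf (x : A) : f x = x * f 1 := by
    rw [← smul_eq_mul, ← map_smul, smul_eq_mul, mul_one]
  have hf' (x : A) : f.symm x = x * f.symm 1 := by
    rw [← smul_eq_mul, ← map_smul, smul_eq_mul, mul_one]
  let u : Aˣ := ⟨f.symm 1, f 1,
    by rw [← hf, f.apply_symm_apply], by rw [← hf', f.symm_apply_apply]⟩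
  have hu (w : topForms k A ℓ) : e' w = e w * u := by
    have := hf' (e w)
    exact (congrArg e' (e.symm_apply_apply w)).symm.trans this
  refine ⟨u, fun a => ?_⟩
  have h1 : e (e.symm 1) = 1 := e.apply_symm_apply 1
  have h := he' a (e.symm 1)
  rw [hu, hu, he, h1, one_mul, pb_one_right, zero_mul, pb_skew k a] at h
  linear_combination (-(↑u⁻¹ : A)) * h - δ a * u.inv_mul

/-- If δ = u⁻¹{u, -}, then {a, u⁻¹} = u⁻¹ δ(a), so rescaling the trivialization by u⁻¹ absorbs the
modular term. -/
lemma IsUnimodular.isHomologicallyUnimodular (h : IsUnimodular k A ℓ) :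
    IsHomologicallyUnimodular k A ℓ := by
  obtain ⟨⟨δ, hδ⟩, h⟩ := h
  obtain ⟨u, hu⟩ := h δ hδ
  obtain ⟨-, e, he⟩ := hδ
  refine ⟨e.trans (LinearEquiv.smulOfUnit u⁻¹), fun a w => ?_⟩
  change (↑u⁻¹ : A) * e (topBr k A ℓ a w) = pb k A a ((↑u⁻¹ : A) * e w)
  have h0 := pb_mul_right k a (u : A) (↑u⁻¹ : A)
  rw [u.mul_inv, pb_one_right, pb_skew k a (u : A)] at h0
  rw [he, hu, pb_mul_right]
  linear_combination ((↑u⁻¹ : A) * e w) * h0 + e w * pb k A a (↑u⁻¹ : A) * u.inv_mul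

end Unimodular

end Poisson

end

/-- For a smooth affine Poisson algebra `A`, all of whose irreducible components have dimension `ℓ`:
homological unimodularity, Calabi-Yau and unimodular, and `RHom_{Aᵉ}(A, Aᵉ) ≅ A[-ℓ]` as (complexes
of) right Poisson modules are equivalent. -/
theorem lemma4p3 {k A : Type u} [Field k] [IsAlgClosed k] [CharZero k] [CommRing A] [Nontrivial A]
    [Algebra k A] [Algebra.Smooth k A] [PoissonAlgebra k A]
    [HasDerivedCategory (Poisson.PBimod k A)] [HasDerivedCategory (Poisson.RightPMod k A)]
    (ℓ : ℕ) (hℓ : ∀ p ∈ minimalPrimes A, ringKrullDim (A ⧸ p) = ℓ) :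
    List.TFAE
      [Poisson.IsHomologicallyUnimodular k A ℓ,
       Poisson.IsCalabiYau k A ∧ Poisson.IsUnimodular k A ℓ,
       Nonempty (Poisson.rhomEnv k A ≅
        (DerivedCategory.Plus.singleFunctor (Poisson.RightPMod k A) (ℓ : ℤ)).obj
          (Poisson.rightTriv k A))] := by
  tfae_have 1 → 2 := fun h =>
    ⟨h.elim fun e _ => Poisson.isCalabiYau_of_topForms_equiv k A hℓ e, h.isUnimodular⟩
  tfae_have 2 → 1 := fun h => h.2.isHomologicallyUnimodular
  tfae_have 3 ↔ 1 := Poisson.nonempty_rhomEnv_iso_iff hℓ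
  tfae_finish
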